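/- Let $\mathcal G$ be a connected metric graph with finitely many vertices and edges (loops and multiple edges allowed), each edge $e$ being identified with a bounded interval $[0,|e|]$ or with a half-line $[0,+\infty)$. Let $H^1(\mathcal G)$ be the space of continuous functions $u:\mathcal G\to\mathbb R$ with $u|_e\in H^1(e)$ for every edge $e$. For $u\in H^1(\mathcal G)$ put \[ E(u,\mathcal G)=\frac12\int_{\mathcal G}|u'|^2-\frac16\int_{\mathcal G}|u|^6,\qquad H^1_\mu(\mathcal G)=\Big\{u\in H^1(\mathcal G):\int_{\mathcal G}|u|^2=\mu\Big\}, \] and let the critical mass $\mu_{\mathcal G}$ be defined by the condition that $3/\mu_{\mathcal G}^2$ is the smallest constant $K\ge 0$ such that \[ \|u\|_{L^6(\mathcal G)}^6\le K\,\|u\|_{L^2(\mathcal G)}^4\,\|u'\|_{L^2(\mathcal G)}^2\qquad\text{for all }u\in H^1(\mathcal G). \] For a half-line $\ell$ of $\mathcal G$, let $\mathcal G\setminus\ell$ be the metric graph obtained from $\mathcal G$ by removing the open half-line $\ell$ (its finite end vertex is kept). Assume that 1. $\mathcal G$ has at least two half-lines and at least one bounded edge; 2. $\mu_{\mathcal G\setminus\ell}=\mu_{\mathcal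 G}$ for every half-line $\ell$ of $\mathcal G$. Then there exists $\bar\mu\in(0,\mu_{\mathcal G})$ such that, for every $\mu\in(\bar\mu,\mu_{\mathcal G})$, the functional $E(\cdot,\mathcal G)$ constrained to $H^1_\mu(\mathcal G)$ has a critical point which is a local minimizer in the $H^1$ topology. For these $\mu$, $E(\cdot,\mathcal G)$ has no global minimizer (ground state) on $H^1_\mu(\mathcal G)$. -/

import Mathlib

open MeasureTheory Set
open scoped ContDiff

noncomputable section

/-! ### The Sobolev space of an open interval -/

/-- `g` is a weak derivative of `u` on the open set `U ⊆ ℝ`. -/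
def IsWeakDeriv (U : Set ℝ) (u g : ℝ → ℝ) : Prop :=
  ∀ φ : ℝ → ℝ, ContDiff ℝ ∞ φ → HasCompactSupport φ → tsupport φ ⊆ U →
    ∫ x in U, u x * deriv φ x = - ∫ x in U, g x * φ x

/-- `u ∈ L²(U)` has a weak derivative in `L²(U)`, that is, `u ∈ H¹(U)`. -/
def MemH1On (U : Set ℝ) (u : ℝ → ℝ) : Prop :=
  MemLp u 2 (volume.restrict U) ∧
    ∃ g : ℝ → ℝ, MemLp g 2 (volume.restrict U) ∧ IsWeakDeriv U u g

open Classical in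
/-- A representative of the weak derivative `u' ∈ L²(U)` of `u` on `U` (and `0` if there is none). -/
def weakDeriv (U : Set ℝ) (u : ℝ → ℝ) : ℝ → ℝ :=
  if h : ∃ g : ℝ → ℝ, MemLp g 2 (volume.restrict U) ∧ IsWeakDeriv U u g then h.choose else 0

theorem weakDeriv_spec {U : Set ℝ} {u : ℝ → ℝ} (h : MemH1On U u) :
    MemLp (weakDeriv U u) 2 (volume.restrict U) ∧ IsWeakDeriv U u (weakDeriv U u) := by
  unfold weakDeriv
  rw [dif_pos h.2]
  exact h.2.choose_spec

/-- Weak derivatives in `L²` are unique up to null sets, so `weakDeriv` is well defined. -/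
theorem weakDeriv_ae_eq {U : Set ℝ} (hU : IsOpen U) {u g : ℝ → ℝ}
    (hg : MemLp g 2 (volume.restrict U)) (hug : IsWeakDeriv U u g) :
    weakDeriv U u =ᵐ[volume.restrict U] g := by
  have hex : ∃ g : ℝ → ℝ, MemLp g 2 (volume.restrict U) ∧ IsWeakDeriv U u g := ⟨g, hg, hug⟩
  have hw : MemLp (weakDeriv U u) 2 (volume.restrict U) ∧ IsWeakDeriv U u (weakDeriv U u) := by
    unfold weakDeriv
    rw [dif_pos hex]
    exact hex.choose_spec
  have hloc : ∀ f : ℝ → ℝ, MemLp f 2 (volume.restrict U) → LocallyIntegrableOn f U volume := by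
    intro f hf
    exact locallyIntegrableOn_of_locallyIntegrable_restrict
      (hf.locallyIntegrable (by norm_num))
  have hint : ∀ f : ℝ → ℝ, MemLp f 2 (volume.restrict U) → ∀ φ : ℝ → ℝ, ContDiff ℝ ∞ φ →
      HasCompactSupport φ → Integrable (fun x => f x * φ x) (volume.restrict U) := by
    intro f hf φ hφ hc
    have h2 : MemLp φ 2 (volume.restrict U) := hφ.continuous.memLp_of_hasCompactSupport hc
    exact hf.integrable_mul h2
  have key := hU.ae_eq_zero_of_integral_contDiff_smul_eq_zero
    (f := fun x => weakDeriv U u x - g x) (μ := volume)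
    ((hloc _ hw.1).sub (hloc _ hg)) (by
      intro φ hφ hc hs
      have e : ∫ x in U, φ x • (weakDeriv U u x - g x) = 0 := by
        have e1 : ∀ x, φ x • (weakDeriv U u x - g x) = weakDeriv U u x * φ x - g x * φ x := by
          intro x; simp only [smul_eq_mul]; ring
        simp_rw [e1]
        rw [integral_sub (hint _ hw.1 φ hφ hc) (hint _ hg φ hφ hc)]
        have a := hw.2 φ hφ hc hs
        have b := hug φ hφ hc hs
        linarith
      rw [← e, setIntegral_eq_integral_of_forall_compl_eq_zero]
      intro x hx
      have : φ x = 0 := image_eq_zero_of_notMem_tsupport (fun h => hx (hs h))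
      simp [this])
  rw [Filter.EventuallyEq, ae_restrict_iff' hU.measurableSet]
  filter_upwards [key] with x hx hxU
  exact sub_eq_zero.mp (hx hxU)

/-! ### Metric graphs -/

/-- A metric graph with vertices `V` (not counting those at infinity), bounded edges `B` and
half-lines `H`. A bounded edge `b` is the interval `[0, len b]`, glued at `0` to the vertex
`src b` and at `len b` to `tgt b`; loops and multiple edges are allowed. A half-line `h` is
`[0, ∞)`, glued at `0` to the vertex `foot h`. -/
structure MetricGraph (V B H : Type*) where
  src : B → V
  tgt : B → V
  len : B → ℝ
  len_pos : ∀ b, 0 < len b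
  foot : H → V

namespace MetricGraph

variable {V B H : Type*}

/-- The graph is connected: it has a vertex, and any two vertices are joined by a finite path of
bounded edges (each half-line is attached to a vertex). -/
def Connected (G : MetricGraph V B H) : Prop :=
  (SimpleGraph.fromRel fun v w => ∃ b, G.src b = v ∧ G.tgt b = w).Connected

/-- The graph obtained by removing the open half-line `l` (and its vertex at infinity). -/
def removeHalfLine (G : MetricGraph V B H) (l : H) : MetricGraph V B {h : H // h ≠ l} where
  src := G.src
  tgt := G.tgt
  len := G.len
  len_pos := G.len_pos
  foot := fun h => G.foot h

/-- The closed interval with which an edge is identified. -/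
def edge (G : MetricGraph V B H) : B ⊕ H → Set ℝ
  | Sum.inl b => Icc 0 (G.len b)
  | Sum.inr _ => Ici 0

/-- An edge without its end points. -/
def openEdge (G : MetricGraph V B H) : B ⊕ H → Set ℝ
  | Sum.inl b => Ioo 0 (G.len b)
  | Sum.inr _ => Ioi 0

/-- A function on the graph is a family of functions on the edges, `u e` being relevant on
`G.edge e` only. It is continuous on the graph if it is continuous on each closed edge and takes a
single value at each vertex. -/
def IsContinuous (G : MetricGraph V B H) (u : B ⊕ H → ℝ → ℝ) : Prop :=
  (∀ e, ContinuousOn (u e) (G.edge e)) ∧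
    ∃ w : V → ℝ,
      (∀ b : B, u (Sum.inl b) 0 = w (G.src b) ∧ u (Sum.inl b) (G.len b) = w (G.tgt b)) ∧
      ∀ h : H, u (Sum.inr h) 0 = w (G.foot h)

/-- `u ∈ H¹(G)`. -/
def MemH1 (G : MetricGraph V B H) (u : B ⊕ H → ℝ → ℝ) : Prop :=
  G.IsContinuous u ∧ ∀ e, MemH1On (G.openEdge e) (u e)

/-- The derivative `u'` on every edge. -/
def der (G : MetricGraph V B H) (u : B ⊕ H → ℝ → ℝ) : B ⊕ H → ℝ → ℝ :=
  fun e => weakDeriv (G.openEdge e) (u e)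

section Functionals

variable [Fintype B] [Fintype H]

/-- `∫_G f`. -/
def integral (G : MetricGraph V B H) (f : B ⊕ H → ℝ → ℝ) : ℝ :=
  ∑ e, ∫ x in G.openEdge e, f e x

/-- The mass `∫_G |u|²`. -/
def mass (G : MetricGraph V B H) (u : B ⊕ H → ℝ → ℝ) : ℝ :=
  G.integral fun e x => |u e x| ^ 2

/-- `∫_G |u'|²`. -/
def kinetic (G : MetricGraph V B H) (u : B ⊕ H → ℝ → ℝ) : ℝ :=
  G.integral fun e x => |G.der u e x| ^ 2

/-- `∫_G |u|⁶`. -/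
def sextic (G : MetricGraph V B H) (u : B ⊕ H → ℝ → ℝ) : ℝ :=
  G.integral fun e x => |u e x| ^ 6

/-- The critical NLS energy `E(u, G)`. -/
def energy (G : MetricGraph V B H) (u : B ⊕ H → ℝ → ℝ) : ℝ :=
  1 / 2 * G.kinetic u - 1 / 6 * G.sextic u

/-- The norm of `H¹(G)`. -/
def h1Norm (G : MetricGraph V B H) (u : B ⊕ H → ℝ → ℝ) : ℝ :=
  Real.sqrt (G.mass u + G.kinetic u)

/-- The mass sphere `H¹_μ(G)`. -/
def massSphere (G : MetricGraph V B H) (μ : ℝ) : Set (B ⊕ H → ℝ → ℝ) :=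
  {u | G.MemH1 u ∧ G.mass u = μ}

/-- The best constant `K` in the Gagliardo-Nirenberg inequality
`‖u‖₆⁶ ≤ K ‖u‖₂⁴ ‖u'‖₂²` on `H¹(G)`. -/
def gnConstant (G : MetricGraph V B H) : ℝ :=
  sInf {K : ℝ | 0 ≤ K ∧ ∀ u, G.MemH1 u → G.sextic u ≤ K * G.mass u ^ 2 * G.kinetic u}

/-- The critical mass `μ_G`, defined by `K = 3 / μ_G²`. -/
def criticalMass (G : MetricGraph V B H) : ℝ :=
  Real.sqrt (3 / G.gnConstant)

/-- `u` is a critical point of `E(·, G)` constrained to `H¹_μ(G)`: the differential of the energy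
at `u` vanishes on the tangent space `{φ ∈ H¹(G) : ∫_G u φ = 0}`. -/
def IsCriticalPoint (G : MetricGraph V B H) (μ : ℝ) (u : B ⊕ H → ℝ → ℝ) : Prop :=
  u ∈ G.massSphere μ ∧
    ∀ φ, G.MemH1 φ → G.integral (fun e x => u e x * φ e x) = 0 →
      HasDerivAt (fun t : ℝ => G.energy (u + t • φ)) 0 0

/-- `u` is a local minimizer of `E(·, G)` on `H¹_μ(G)`, in the `H¹` topology. -/
def IsLocalMinimizer (G : MetricGraph V B H) (μ : ℝ) (u : B ⊕ H → ℝ → ℝ) : Prop :=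
  u ∈ G.massSphere μ ∧
    ∃ ε : ℝ, 0 < ε ∧ ∀ v ∈ G.massSphere μ, G.h1Norm (v - u) < ε → G.energy u ≤ G.energy v

/-- `u` is a ground state of mass `μ`: a global minimizer of `E(·, G)` on `H¹_μ(G)`. -/
def IsGroundState (G : MetricGraph V B H) (μ : ℝ) (u : B ⊕ H → ℝ → ℝ) : Prop :=
  u ∈ G.massSphere μ ∧ ∀ v ∈ G.massSphere μ, G.energy u ≤ G.energy v

end Functionals

end MetricGraph

end

/-!
The half-line has critical mass `halfLineMass = √3π/4`, and everything rests on a quantitative form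
of this fact. Let `Φ = calibration M` be the primitive of the speed `|s| √((M⁴ - s⁴)/3)` of the
soliton of height `M`. Where `|u| ≤ M`, Young's inequality bounds the variation of `Φ ∘ u` along a
piece of an edge by the integral of `u'²/2 + (M⁴u² - u⁶)/6`, the cost of that piece; the total cost
is `E(u) + M⁴ mass(u)/6`, while `Φ(M) = M⁴ halfLineMass/6`. Since the graph is connected and has a
half-line, some path leads from the maximum point of `|u|` to infinity, so that
`E(u) ≥ M⁴ (halfLineMass - mass(u))/6` for `M = max |u|` (`MemH1.energy_ge`; the same holds on every
single half-line). Scaling yields the Gagliardo-Nirenberg inequality,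
`0 < halfLineMass ≤ criticalMass`, and `E > 0` below the critical mass. As a half-line carries
functions of any mass with arbitrarily small kinetic energy, the infimum of `E` is `0` and it is not
attained: there are no ground states.

The local minimizer minimizes `E` among the functions of mass `μ` with mass at most `c` on the
half-lines (`outerMass`), for a small constant `c`. Three facts make this work.

* The barrier (`RemovableHalfLines.exists_barrier`). If some half-line `l` carries a mass bounded
  away from `0` and from `halfLineMass`, then the energy on `l` is at least a multiple of the fourth
  power of its maximum, and, as `G.removeHalfLine l` has the same critical mass, the energy on the
  rest of the graph controls its kinetic term. So `E(u)` controls `(max |u|)⁴`, which is bounded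
  below because most of the mass sits on the bounded edges. Hence `E ≥ η > 0` where `outerMass u = c`.
* The competitor (`RemovableHalfLines.exists_core_competitor`). There are functions of critical mass
  with `outerMass u < c` and `E(u) < η`. If the graph has a vertex of degree one on a bounded edge,
  or if its critical mass is at least that of the line, a concentrated truncated soliton on a
  bounded edge will do. Otherwise take an almost optimal function for the Gagliardo-Nirenberg inequality,
  with `E(u) ≤ ε M⁴`. By the estimate behind the barrier no half-line has an intermediate mass, and
  counting passes of `Φ ∘ u` excludes heavy half-lines. If `M` were large, then `|u|` would drop on
  both sides of its maximum within a fixed distance, possibly beyond a vertex, which makes two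
  passes and costs twice `halfLineMass`. So `M` is bounded and `E(u)` is small.
* Compactness (`exists_limit_of_bounded`). A minimizing sequence converges weakly and loses no mass
  on the bounded edges; the parts moving to infinity have nonnegative energy since their mass is
  below `halfLineMass`. If the limit `w` had mass less than `μ`, multiplying it by a constant would
  lower its energy, which is already less than a third of its kinetic term, until the mass `μ` is
  restored; the barrier cannot be met on the way.

The minimizer stays off the barrier, so the constraint `outerMass u ≤ c` is inactive: the minimizer
is a local minimizer and a constrained critical point.
-/

noncomputable section

open Filter Topology

/-! ### Sobolev functions of one variable -/

/-- `u ∈ H¹(S)` with derivative `g`, for an interval `S`: both are in `L²(S)` and `u` is a primitive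
of `g` on `S`. In contrast with `MemH1On`, the function `u` is the continuous representative, and
the end points of `S` may belong to `S`. -/
structure SobolevOn (S : Set ℝ) (u g : ℝ → ℝ) : Prop where
  memLp : MemLp u 2 (volume.restrict S)
  memLp_deriv : MemLp g 2 (volume.restrict S)
  sub_eq : ∀ x ∈ S, ∀ y ∈ S, u y - u x = ∫ t in x..y, g t

theorem MeasureTheory.MemLp.locallyIntegrable_indicator {S : Set ℝ} (hS : MeasurableSet S)
    {g : ℝ → ℝ} (hg : MemLp g 2 (volume.restrict S)) :
    LocallyIntegrable (S.indicator g) volume :=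
  ((memLp_indicator_iff_restrict hS).2 hg).locallyIntegrable (by norm_num)

theorem MeasureTheory.LocallyIntegrable.intervalIntegrable' {f : ℝ → ℝ}
    (hf : LocallyIntegrable f volume) (a b : ℝ) : IntervalIntegrable f volume a b :=
  intervalIntegrable_iff.mpr <|
    (hf.integrableOn_isCompact isCompact_uIcc).mono_set uIoc_subset_uIcc

theorem intervalIntegral_indicator_eq {S : Set ℝ} [S.OrdConnected] {g : ℝ → ℝ} {x y : ℝ}
    (hx : x ∈ S) (hy : y ∈ S) : ∫ t in x..y, S.indicator g t = ∫ t in x..y, g t := by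
  refine intervalIntegral.integral_congr fun t ht => ?_
  exact indicator_of_mem (OrdConnected.uIcc_subset inferInstance hx hy ht) g

namespace SobolevOn

variable {S T : Set ℝ} {u v g f : ℝ → ℝ}

theorem mono (h : SobolevOn S u g) (hT : T ⊆ S) : SobolevOn T u g :=
  ⟨h.memLp.mono_measure (Measure.restrict_mono_set _ hT),
    h.memLp_deriv.mono_measure (Measure.restrict_mono_set _ hT),
    fun x hx y hy => h.sub_eq x (hT hx) y (hT hy)⟩

theorem const_mul (h : SobolevOn S u g) (c : ℝ) :
    SobolevOn S (fun x => c * u x) (fun x => c * g x) := by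
  refine ⟨h.memLp.const_mul c, h.memLp_deriv.const_mul c, fun x hx y hy => ?_⟩
  rw [← mul_sub, h.sub_eq x hx y hy, intervalIntegral.integral_const_mul]

section

variable [hS : S.OrdConnected]

theorem _root_.intervalIntegrable_of_memLp_two (hg : MemLp g 2 (volume.restrict S)) {x y : ℝ}
    (hx : x ∈ S) (hy : y ∈ S) : IntervalIntegrable g volume x y := by
  have h1 := (hg.locallyIntegrable_indicator hS.measurableSet).intervalIntegrable' x y
  refine h1.congr ?_
  intro t ht
  exact indicator_of_mem (hS.uIcc_subset hx hy (uIoc_subset_uIcc ht)) g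

theorem intervalIntegrable (h : SobolevOn S u g) {x y : ℝ} (hx : x ∈ S) (hy : y ∈ S) :
    IntervalIntegrable g volume x y :=
  intervalIntegrable_of_memLp_two h.memLp_deriv hx hy

theorem add (h : SobolevOn S u g) (h' : SobolevOn S v f) :
    SobolevOn S (fun x => u x + v x) (fun x => g x + f x) := by
  refine ⟨h.memLp.add h'.memLp, h.memLp_deriv.add h'.memLp_deriv, fun x hx y hy => ?_⟩
  rw [intervalIntegral.integral_add (h.intervalIntegrable hx hy) (h'.intervalIntegrable hx hy),
    ← h.sub_eq x hx y hy, ← h'.sub_eq x hx y hy]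
  ring

theorem continuousOn (h : SobolevOn S u g) : ContinuousOn u S := by
  rcases S.eq_empty_or_nonempty with rfl | ⟨x, hx⟩
  · exact continuousOn_empty _
  have hc : Continuous fun y => u x + ∫ t in x..y, S.indicator g t :=
    continuous_const.add (intervalIntegral.continuous_primitive
      (h.memLp_deriv.locallyIntegrable_indicator hS.measurableSet).intervalIntegrable' x)
  refine hc.continuousOn.congr fun y hy => ?_
  simp only
  rw [intervalIntegral_indicator_eq hx hy, ← h.sub_eq x hx y hy]
  ring

/-- Chain rule for a `C¹` function of an absolutely continuous one, in integrated form. -/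
theorem comp_sub_eq (h : SobolevOn S u g) {Φ F : ℝ → ℝ} (hΦ : ∀ s, HasDerivAt Φ (F s) s)
    (hF : Continuous F) {x y : ℝ} (hx : x ∈ S) (hy : y ∈ S) :
    Φ (u y) - Φ (u x) = ∫ t in x..y, F (u t) * g t := by
  set w : ℝ → ℝ := fun t => u x + ∫ s in x..t, g s with hw
  have hwu : ∀ t ∈ uIcc x y, w t = u t := fun t ht => by
    rw [hw]; simp only; rw [← h.sub_eq x hx t (hS.uIcc_subset hx hy ht)]; ring
  have hint := h.intervalIntegrable hx hy
  have hwac0 := hint.absolutelyContinuousOnInterval_intervalIntegral left_mem_uIcc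
  have hwc : ContinuousOn w (uIcc x y) := continuousOn_const.add hwac0.continuousOn
  -- `Φ` is Lipschitz on the compact range of `w`, so `Φ ∘ w` is absolutely continuous
  obtain ⟨K, hK⟩ : ∃ K : NNReal, ∀ s ∈ uIcc x y, ∀ t ∈ uIcc x y,
      dist (Φ (w s)) (Φ (w t)) ≤ K * dist (w s) (w t) := by
    obtain ⟨R, hR⟩ := (isCompact_uIcc.image_of_continuousOn hwc).isBounded.subset_closedBall 0
    obtain ⟨C, hC⟩ := (isCompact_closedBall (0 : ℝ) R).exists_bound_of_continuousOn hF.continuousOn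
    refine ⟨Real.toNNReal |C|, fun s hs t ht => ?_⟩
    rw [Real.coe_toNNReal _ (abs_nonneg C)]
    have := (convex_closedBall (0 : ℝ) R).norm_image_sub_le_of_norm_hasDerivWithin_le
      (f := Φ) (f' := F) (C := |C|) (fun z _ => (hΦ z).hasDerivWithinAt)
      (fun z hz => (hC z hz).trans (le_abs_self C)) (hR ⟨t, ht, rfl⟩) (hR ⟨s, hs, rfl⟩)
    simpa [dist_eq_norm] using this
  have hac : AbsolutelyContinuousOnInterval (fun t => Φ (w t)) x y := by
    rw [absolutelyContinuousOnInterval_iff] at hwac0 ⊢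
    intro ε hε
    obtain ⟨δ, hδ, H⟩ := hwac0 (ε / (K + 1)) (by positivity)
    refine ⟨δ, hδ, fun E hE hEδ => ?_⟩
    have h1 := H E hE hEδ
    have h2 : ∑ i ∈ Finset.range E.1, dist (Φ (w (E.2 i).1)) (Φ (w (E.2 i).2)) ≤
        K * ∑ i ∈ Finset.range E.1,
          dist (∫ v in x..(E.2 i).1, g v) (∫ v in x..(E.2 i).2, g v) := by
      rw [Finset.mul_sum]
      refine Finset.sum_le_sum fun i hi => ?_
      have hm := hE.1 i hi
      refine (hK _ hm.1 _ hm.2).trans_eq ?_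
      simp [hw]
    have hK0 : (0 : ℝ) ≤ K := K.2
    calc _ ≤ _ := h2
      _ ≤ K * (ε / (K + 1)) := by gcongr
      _ < ε := by
        rw [← mul_div_assoc, div_lt_iff₀ (by positivity)]; nlinarith
  have key := hac.integral_deriv_eq_sub
  simp only [hwu y right_mem_uIcc, hwu x left_mem_uIcc] at key
  rw [← key]
  refine intervalIntegral.integral_congr_ae ?_
  filter_upwards [hint.ae_hasDerivAt_integral] with t ht htm
  have htm' := uIoc_subset_uIcc htm
  have hd : HasDerivAt w (g t) t := (ht htm' x left_mem_uIcc).const_add (u x)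
  have := (hΦ (w t)).comp t hd
  rw [← hwu t htm']
  exact this.deriv

/-- The converse of `sobolevOn_of_isWeakDeriv`: primitives of `L²` functions are weakly
differentiable. -/
theorem isWeakDeriv (h : SobolevOn S u g) (hopen : IsOpen S) : IsWeakDeriv S u g := by
  intro φ hφ hc hs
  rcases (tsupport φ).eq_empty_or_nonempty with he | hne
  · have : φ = 0 := by rwa [tsupport_eq_empty_iff] at he
    subst this
    simp
  obtain ⟨a, ha, b, hb, hab, hsub⟩ : ∃ a ∈ S, ∃ b ∈ S, a ≤ b ∧ tsupport φ ⊆ Ioo a b := by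
    have hk : IsCompact (tsupport φ) := hc
    obtain ⟨m, hm⟩ := hk.exists_isLeast hne
    obtain ⟨M, hM⟩ := hk.exists_isGreatest hne
    obtain ⟨ε, hε, hball⟩ := Metric.isOpen_iff.1 hopen m (hs hm.1)
    obtain ⟨ε', hε', hball'⟩ := Metric.isOpen_iff.1 hopen M (hs hM.1)
    refine ⟨m - ε / 2, hball ?_, M + ε' / 2, hball' ?_, ?_, fun x hx => ⟨?_, ?_⟩⟩
    · simp [abs_of_pos hε]; linarith
    · simp [abs_of_pos hε']; linarith
    · have := hm.2 hM.1; linarith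
    · have := hm.2 hx; linarith
    · have := hM.2 hx; linarith
  have hzero : ∀ x, x ∉ Ioo a b → φ x = 0 := fun x hx =>
    image_eq_zero_of_notMem_tsupport fun hx' => hx (hsub hx')
  have hzero' : ∀ x, x ∉ Ioo a b → deriv φ x = 0 := fun x hx => by
    by_contra hne'
    exact hx (hsub (tsupport_deriv_subset (𝕜 := ℝ) (subset_tsupport _ hne')))
  have hIoc : Ioc a b ⊆ S := fun t ht => hS.out ha hb ⟨ht.1.le, ht.2⟩
  have conv : ∀ w : ℝ → ℝ, (∀ x, x ∉ Ioo a b → w x = 0) → ∫ x in S, w x = ∫ x in a..b, w x := by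
    intro w hw
    rw [intervalIntegral.integral_of_le hab]
    refine setIntegral_eq_of_subset_of_forall_sdiff_eq_zero hS.measurableSet hIoc
      fun x hx => hw x ?_
    exact fun hx' => hx.2 (Ioo_subset_Ioc_self hx')
  rw [conv _ (fun x hx => by rw [hzero' x hx, mul_zero]),
    conv _ (fun x hx => by rw [hzero x hx, mul_zero])]
  set w : ℝ → ℝ := fun t => u a + ∫ s in a..t, g s with hw
  have hwu : ∀ t ∈ uIcc a b, w t = u t := fun t ht => by
    rw [hw]; simp only; rw [← h.sub_eq a ha t (hS.uIcc_subset ha hb ht)]; ring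
  have hint := h.intervalIntegrable ha hb
  have hwac : AbsolutelyContinuousOnInterval w a b := by
    have := hint.absolutelyContinuousOnInterval_intervalIntegral left_mem_uIcc
    rw [absolutelyContinuousOnInterval_iff] at this ⊢
    simpa only [hw, dist_add_left] using this
  have hφac : AbsolutelyContinuousOnInterval φ a b :=
    ContDiffOn.absolutelyContinuousOnInterval (hφ.of_le (m := 1) (by simp)).contDiffOn
  have key := hwac.integral_mul_deriv_eq_deriv_mul hφac
  rw [hzero a (by simp), hzero b (by simp)] at key
  have e1 : ∫ x in a..b, u x * deriv φ x = ∫ x in a..b, w x * deriv φ x :=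
    intervalIntegral.integral_congr fun t ht => congrArg (· * deriv φ t) (hwu t ht).symm
  have e2 : ∫ x in a..b, g x * φ x = ∫ x in a..b, deriv w x * φ x := by
    refine intervalIntegral.integral_congr_ae ?_
    filter_upwards [hint.ae_hasDerivAt_integral] with t ht htm
    have hd : HasDerivAt w (g t) t :=
      (ht (uIoc_subset_uIcc htm) a left_mem_uIcc).const_add (u a)
    rw [hd.deriv]
  rw [e1, e2, key]
  ring

end

end SobolevOn

/-- du Bois-Reymond lemma: a function with vanishing weak derivative on an interval is constant. -/
theorem ae_eq_const_of_isWeakDeriv_zero {U : Set ℝ} (hU : IsOpen U) [hc : U.OrdConnected]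
    {v : ℝ → ℝ} (hv : LocallyIntegrableOn v U) (h0 : IsWeakDeriv U v 0) :
    ∃ C : ℝ, ∀ᵐ x, x ∈ U → v x = C := by
  rcases U.eq_empty_or_nonempty with rfl | ⟨c, hcU⟩
  · exact ⟨0, by simp⟩
  obtain ⟨ε, hε, hball⟩ := Metric.isOpen_iff.1 hU c hcU
  let B : ContDiffBump c := ⟨ε / 4, ε / 2, by linarith, by linarith⟩
  set ρ : ℝ → ℝ := B.normed volume
  have hρs : tsupport ρ ⊆ U := by
    rw [ContDiffBump.tsupport_normed_eq]
    exact (Metric.closedBall_subset_ball (by change ε / 2 < ε; linarith)).trans hball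
  have hρd : ContDiff ℝ ∞ ρ := B.contDiff_normed
  have hρc : HasCompactSupport ρ := B.hasCompactSupport_normed
  have hρi : ∫ x, ρ x = 1 := B.integral_normed
  -- `v` annihilates test functions of zero mean, since those are derivatives of test functions
  have hmean : ∀ θ : ℝ → ℝ, ContDiff ℝ ∞ θ → HasCompactSupport θ → tsupport θ ⊆ U →
      ∫ x, θ x = 0 → ∫ x in U, v x * θ x = 0 := by
    intro θ hθ hθc hθs hθ0
    rcases (tsupport θ).eq_empty_or_nonempty with he | hne
    · have : θ = 0 := by rwa [tsupport_eq_empty_iff] at he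
      subst this
      simp
    have hk : IsCompact (tsupport θ) := hθc
    obtain ⟨m, hm⟩ := hk.exists_isLeast hne
    obtain ⟨M, hM⟩ := hk.exists_isGreatest hne
    have hmM : m ≤ M := hm.2 hM.1
    have hz : ∀ x, x ∉ Icc m M → θ x = 0 := fun x hx =>
      image_eq_zero_of_notMem_tsupport fun hx' => hx ⟨hm.2 hx', hM.2 hx'⟩
    have hii : ∀ a b, IntervalIntegrable θ volume a b := fun a b =>
      hθ.continuous.intervalIntegrable a b
    set φ : ℝ → ℝ := fun x => ∫ t in m..x, θ t with hφdef
    have hφ' : ∀ x, HasDerivAt φ (θ x) x := fun x =>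
      intervalIntegral.integral_hasDerivAt_right (hii _ _)
        hθ.continuous.stronglyMeasurable.stronglyMeasurableAtFilter hθ.continuous.continuousAt
    have hderiv : deriv φ = θ := funext fun x => (hφ' x).deriv
    have hzero : ∀ x, x ∉ Icc m M → φ x = 0 := by
      intro x hx
      by_cases hxm : x < m
      · refine (intervalIntegral.integral_zero_ae (ae_of_all _ fun t ht => ?_)
          : ∫ t in m..x, θ t = 0)
        rw [uIoc_of_ge hxm.le] at ht
        rcases ht.2.lt_or_eq with h | h
        · exact hz t fun h' => by linarith [h'.1]
        · -- at the end point `m` the function vanishes by continuity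
          subst h
          have hcl : t ∈ closure (Iio t) := by simp
          exact (closure_minimal (fun y hy => hz y fun h' => absurd h'.1 (not_le.2 hy))
            (isClosed_eq hθ.continuous continuous_const)) hcl
      · have hMx : M < x := by
          by_contra hcon
          exact hx ⟨not_lt.1 hxm, not_lt.1 hcon⟩
        have : ∫ t, θ t = ∫ t in m..x, θ t := by
          rw [intervalIntegral.integral_of_le (hmM.trans hMx.le), ← integral_Icc_eq_integral_Ioc]
          exact (setIntegral_eq_integral_of_forall_compl_eq_zero (s := Icc m x) fun t ht =>
            hz t fun h' : t ∈ Icc m M => ht ⟨h'.1, h'.2.trans hMx.le⟩).symm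
        change ∫ t in m..x, θ t = 0
        rw [← this, hθ0]
    have hsupp : tsupport φ ⊆ Icc m M :=
      closure_minimal (fun x hx => by_contra fun h' => hx (hzero x h')) isClosed_Icc
    have hφd : ContDiff ℝ ∞ φ := by
      rw [contDiff_infty_iff_deriv, hderiv]
      exact ⟨fun x => (hφ' x).differentiableAt, hθ⟩
    have := h0 φ hφd (isCompact_Icc.of_isClosed_subset (isClosed_tsupport _) hsupp)
      (hsupp.trans (hc.out (hθs hm.1) (hθs hM.1)))
    simpa [hderiv] using this
  have hvint : ∀ φ : ℝ → ℝ, Continuous φ → HasCompactSupport φ → tsupport φ ⊆ U →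
      IntegrableOn (fun x => v x * φ x) U := by
    intro φ hφ hφc hφs
    have h1 : IntegrableOn (fun x => v x * φ x) (tsupport φ) :=
      ((hv.integrableOn_compact_subset hφs hφc).mul_continuousOn hφ.continuousOn hφc)
    refine h1.of_forall_sdiff_eq_zero hU.measurableSet fun x hx => ?_
    rw [image_eq_zero_of_notMem_tsupport hx.2, mul_zero]
  refine ⟨∫ x in U, v x * ρ x, ?_⟩
  set C := ∫ x in U, v x * ρ x with hC
  have key := hU.ae_eq_zero_of_integral_contDiff_smul_eq_zero (f := fun x => v x - C) (μ := volume)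
    (hv.sub ((locallyIntegrable_const C).locallyIntegrableOn U)) (by
      intro ψ hψ hψc hψs
      set I := ∫ x, ψ x
      have hIU : ∫ x in U, ψ x = I := setIntegral_eq_integral_of_forall_compl_eq_zero fun x hx =>
        image_eq_zero_of_notMem_tsupport fun h => hx (hψs h)
      have hs' : tsupport (fun x => ψ x - I * ρ x) ⊆ tsupport ψ ∪ tsupport ρ := by
        refine closure_minimal (fun x hx => ?_) ((isClosed_tsupport _).union (isClosed_tsupport _))
        by_contra hcon
        rw [mem_union, not_or] at hcon
        exact hx (by simp [image_eq_zero_of_notMem_tsupport hcon.1,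
          image_eq_zero_of_notMem_tsupport hcon.2])
      have hψi : Integrable ψ := hψ.continuous.integrable_of_hasCompactSupport hψc
      have hρint : Integrable ρ := hρd.continuous.integrable_of_hasCompactSupport hρc
      have h1 := hmean (fun x => ψ x - I * ρ x) (hψ.sub (contDiff_const.mul hρd))
        ((hψc.isCompact.union hρc.isCompact).of_isClosed_subset (isClosed_tsupport _) hs')
        (hs'.trans (union_subset hψs hρs)) (by
          rw [integral_sub hψi (hρint.const_mul I), integral_const_mul, hρi]; simp [I])
      have h2 : ∫ x in U, v x * (ψ x - I * ρ x) = (∫ x in U, v x * ψ x) - I * C := by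
        have : ∀ x, v x * (ψ x - I * ρ x) = v x * ψ x - I * (v x * ρ x) := fun x => by ring
        simp_rw [this]
        rw [integral_sub (hvint ψ hψ.continuous hψc hψs)
          ((hvint ρ hρd.continuous hρc hρs).const_mul I), integral_const_mul]
      have h3 : ∫ x in U, ψ x • (v x - C) = (∫ x in U, v x * ψ x) - I * C := by
        have : ∀ x, ψ x • (v x - C) = v x * ψ x - C * ψ x := fun x => by
          simp only [smul_eq_mul]; ring
        simp_rw [this]
        rw [integral_sub (hvint ψ hψ.continuous hψc hψs) (hψi.integrableOn.const_mul C),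
          integral_const_mul, hIU, mul_comm C]
      rw [← setIntegral_eq_integral_of_forall_compl_eq_zero (s := U), h3, ← h2, h1]
      intro x hx
      rw [image_eq_zero_of_notMem_tsupport fun h => hx (hψs h), zero_smul])
  filter_upwards [key] with x hx hxU
  linarith [hx hxU]

/-- A continuous function on an interval `S` with a weak derivative in `L²` on the interior `U` is a
primitive of that derivative, up to the end points. -/
theorem sobolevOn_of_isWeakDeriv {U S : Set ℝ} (hU : IsOpen U) [hcU : U.OrdConnected]
    [hcS : S.OrdConnected] (hUS : U ⊆ S) (hSU : S ⊆ closure U) (hae : S =ᵐ[volume] U)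
    {u g : ℝ → ℝ} (hu : MemLp u 2 (volume.restrict U)) (hg : MemLp g 2 (volume.restrict U))
    (hcont : ContinuousOn u S) (h : IsWeakDeriv U u g) : SobolevOn S u g := by
  have hr : volume.restrict S = volume.restrict U := Measure.restrict_congr_set hae
  refine ⟨hr ▸ hu, hr ▸ hg, ?_⟩
  rcases S.eq_empty_or_nonempty with rfl | ⟨c, hcS'⟩
  · simp
  have hgl := hg.locallyIntegrable_indicator hU.measurableSet
  have hPc : Continuous fun y => ∫ t in c..y, U.indicator g t :=
    intervalIntegral.continuous_primitive hgl.intervalIntegrable' c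
  set P : ℝ → ℝ := fun y => ∫ t in c..y, U.indicator g t with hP
  have hPw : IsWeakDeriv U P g := by
    intro φ hφ hφc hφs
    -- localise to a bounded interval, on which `P` is square integrable
    rcases (tsupport φ).eq_empty_or_nonempty with he | hne
    · have : φ = 0 := by rwa [tsupport_eq_empty_iff] at he
      subst this
      simp
    have hk : IsCompact (tsupport φ) := hφc
    obtain ⟨R, hR⟩ := hk.isBounded.subset_ball 0
    have hoc : (U ∩ Metric.ball 0 R).OrdConnected := by
      rw [Real.ball_eq_Ioo]
      exact OrdConnected.inter hcU ordConnected_Ioo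
    have hsub : U ∩ Metric.ball 0 R ⊆ U := inter_subset_left
    have hsob : SobolevOn (U ∩ Metric.ball 0 R) P g := by
      refine ⟨?_, hg.mono_measure (Measure.restrict_mono_set _ hsub), fun x hx y hy => ?_⟩
      · have : MemLp P 2 (volume.restrict (Metric.closedBall 0 R)) := by
          obtain ⟨K, hK⟩ :=
            (isCompact_closedBall (0 : ℝ) R).exists_bound_of_continuousOn hPc.continuousOn
          have : IsFiniteMeasure (volume.restrict (Metric.closedBall (0 : ℝ) R)) :=
            ⟨by rw [Measure.restrict_apply_univ]; exact measure_closedBall_lt_top⟩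
          exact MemLp.of_bound hPc.aestronglyMeasurable K
            ((ae_restrict_iff' measurableSet_closedBall).2 (ae_of_all _ hK))
        exact this.mono_measure (Measure.restrict_mono_set _
          (inter_subset_right.trans Metric.ball_subset_closedBall))
      · rw [hP]
        simp only
        rw [intervalIntegral.integral_interval_sub_left (hgl.intervalIntegrable' _ _)
          (hgl.intervalIntegrable' _ _), intervalIntegral_indicator_eq (hsub hx) (hsub hy)]
    have := hsob.isWeakDeriv (hU.inter Metric.isOpen_ball) φ hφ hφc (subset_inter hφs hR)
    have hred : ∀ w : ℝ → ℝ, (∀ x, x ∉ tsupport φ → w x = 0) →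
        ∫ x in U, w x = ∫ x in U ∩ Metric.ball 0 R, w x := fun w hw =>
      setIntegral_eq_of_subset_of_forall_sdiff_eq_zero hU.measurableSet hsub fun x hx =>
        hw x fun hx' => hx.2 ⟨hx.1, hR hx'⟩
    rw [hred _ fun x hx => ?_, hred _ fun x hx => ?_]
    · exact this
    · rw [image_eq_zero_of_notMem_tsupport hx, mul_zero]
    · rw [show deriv φ x = 0 from by_contra fun hne' =>
        hx (tsupport_deriv_subset (𝕜 := ℝ) (subset_tsupport _ hne')), mul_zero]
  have huloc : LocallyIntegrableOn u U := locallyIntegrableOn_of_locallyIntegrable_restrict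
      (hu.locallyIntegrable (by norm_num))
  have hint : ∀ w φ : ℝ → ℝ, LocallyIntegrableOn w U → Continuous φ → HasCompactSupport φ →
      tsupport φ ⊆ U → ∀ ψ : ℝ → ℝ, Continuous ψ → (∀ x, x ∉ tsupport φ → ψ x = 0) →
      IntegrableOn (fun x => w x * ψ x) U := by
    intro w φ hw hφ hφc hφs ψ hψ hψ0
    have h1 : IntegrableOn (fun x => w x * ψ x) (tsupport φ) :=
      ((hw.integrableOn_compact_subset hφs hφc).mul_continuousOn hψ.continuousOn hφc)
    refine h1.of_forall_sdiff_eq_zero hU.measurableSet fun x hx => ?_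
    rw [hψ0 x hx.2, mul_zero]
  have hdiff : IsWeakDeriv U (fun x => u x - P x) 0 := by
    intro φ hφ hφc hφs
    have hd0 : ∀ x, x ∉ tsupport φ → deriv φ x = 0 := fun x hx => by_contra fun hne' =>
        hx (tsupport_deriv_subset (𝕜 := ℝ) (subset_tsupport _ hne'))
    have hdc : Continuous (deriv φ) := hφ.continuous_deriv (by simp)
    have e : ∀ x, (u x - P x) * deriv φ x = u x * deriv φ x - P x * deriv φ x := fun x => by ring
    simp_rw [e]
    rw [integral_sub (hint _ φ huloc hφ.continuous hφc hφs _ hdc hd0)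
      (hint _ φ (hPc.locallyIntegrable.locallyIntegrableOn _) hφ.continuous hφc hφs _ hdc hd0),
      h φ hφ hφc hφs, hPw φ hφ hφc hφs]
    simp
  obtain ⟨C, hC⟩ := ae_eq_const_of_isWeakDeriv_zero hU
    (huloc.sub (hPc.locallyIntegrable.locallyIntegrableOn _)) hdiff
  have hUeq : ∀ x ∈ U, u x = C + P x := by
    have h1 : (fun x => u x) =ᵐ[volume.restrict U] fun x => C + P x := by
      rw [Filter.EventuallyEq, ae_restrict_iff' hU.measurableSet]
      filter_upwards [hC] with x hx hxU
      have h' : u x - P x = C := hx hxU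
      linarith
    exact Measure.eqOn_open_of_ae_eq h1 hU (hcont.mono hUS)
      (continuous_const.add hPc).continuousOn
  have hSeq : ∀ x ∈ S, u x = C + P x := by
    intro x hx
    have h1 : Tendsto u (𝓝[U] x) (𝓝 (u x)) := (hcont x hx).mono hUS
    have h2 : Tendsto (fun x => C + P x) (𝓝[U] x) (𝓝 (C + P x)) :=
      (continuous_const.add hPc).continuousAt.continuousWithinAt
    have : (𝓝[U] x).NeBot := mem_closure_iff_nhdsWithin_neBot.1 (hSU hx)
    refine tendsto_nhds_unique h1 (h2.congr' ?_)
    filter_upwards [self_mem_nhdsWithin] with y hy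
    exact (hUeq y hy).symm
  intro x hx y hy
  rw [hSeq x hx, hSeq y hy, add_sub_add_left_eq_sub, hP]
  simp only
  rw [intervalIntegral.integral_interval_sub_left (hgl.intervalIntegrable' _ _)
    (hgl.intervalIntegrable' _ _)]
  refine intervalIntegral.integral_congr_ae ?_
  filter_upwards [hae.mem_iff] with t ht htm
  exact indicator_of_mem (ht.1 (hcS.uIcc_subset hx hy (uIoc_subset_uIcc htm))) g

/-! ### The calibration of the critical energy -/

/-- The critical mass `√3π/4` of the half-line. -/
def halfLineMass : ℝ := √3 * Real.pi / 4

theorem halfLineMass_pos : 0 < halfLineMass := by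
  unfold halfLineMass; positivity

/-- The speed `|u'|`, as a function of the value `u`, of the soliton of height `M`. For `|s| > M`
the square root takes the value `0`. -/
def solitonSpeed (M s : ℝ) : ℝ := |s| * √((M ^ 4 - s ^ 4) / 3)

/-- The calibration: the primitive of `solitonSpeed M` vanishing at `0`. -/
def calibration (M s : ℝ) : ℝ := ∫ t in (0 : ℝ)..s, solitonSpeed M t

theorem continuous_solitonSpeed (M : ℝ) : Continuous (solitonSpeed M) := by
  unfold solitonSpeed; fun_prop

theorem hasDerivAt_calibration (M s : ℝ) : HasDerivAt (calibration M) (solitonSpeed M s) s :=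
  intervalIntegral.integral_hasDerivAt_right
    ((continuous_solitonSpeed M).intervalIntegrable _ _)
    (continuous_solitonSpeed M).stronglyMeasurable.stronglyMeasurableAtFilter
    (continuous_solitonSpeed M).continuousAt

theorem calibration_neg (M s : ℝ) : calibration M (-s) = -calibration M s := by
  unfold calibration
  have h := intervalIntegral.integral_comp_neg (solitonSpeed M) (a := 0) (b := s)
  have e : ∀ t, solitonSpeed M (-t) = solitonSpeed M t := fun t => by
    simp only [solitonSpeed, abs_neg]; ring_nf
  simp only [e, neg_zero] at h
  rw [h, intervalIntegral.integral_symm]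

theorem solitonSpeed_nonneg (M s : ℝ) : 0 ≤ solitonSpeed M s := by
  unfold solitonSpeed; positivity

theorem calibration_nonneg (M : ℝ) {s : ℝ} (hs : 0 ≤ s) : 0 ≤ calibration M s :=
  intervalIntegral.integral_nonneg hs fun t _ => solitonSpeed_nonneg M t

theorem abs_calibration (M s : ℝ) : |calibration M s| = calibration M |s| := by
  rcases le_total 0 s with h | h
  · rw [abs_of_nonneg h, abs_of_nonneg (calibration_nonneg M h)]
  · rw [abs_of_nonpos h, calibration_neg]
    refine abs_of_nonpos ?_
    have := calibration_nonneg M (neg_nonneg.2 h)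
    rw [calibration_neg] at this
    linarith

theorem calibration_mono (M : ℝ) : Monotone (calibration M) :=
  monotone_of_deriv_nonneg (fun s => (hasDerivAt_calibration M s).differentiableAt) fun s => by
    rw [(hasDerivAt_calibration M s).deriv]; exact solitonSpeed_nonneg M s

theorem calibration_le {M s : ℝ} (hs : 0 ≤ s) : calibration M s ≤ M ^ 2 * s ^ 2 / 2 := by
  have h1 : calibration M s ≤ ∫ t in (0 : ℝ)..s, M ^ 2 * t := by
    refine intervalIntegral.integral_mono_on hs
      ((continuous_solitonSpeed M).intervalIntegrable _ _)
      ((by fun_prop : Continuous fun t : ℝ => M ^ 2 * t).intervalIntegrable _ _) fun t ht => ?_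
    unfold solitonSpeed
    rw [abs_of_nonneg ht.1, mul_comm]
    refine mul_le_mul_of_nonneg_right ?_ ht.1
    rw [Real.sqrt_le_left (by positivity)]
    nlinarith [sq_nonneg (M ^ 2), sq_nonneg (t ^ 2)]
  rw [intervalIntegral.integral_const_mul, integral_id] at h1
  linarith

/-- The calibration of the maximum is the critical mass of the half-line, up to scaling. -/
theorem calibration_self {M : ℝ} (hM : 0 ≤ M) : calibration M M = M ^ 4 / 6 * halfLineMass := by
  rcases hM.eq_or_lt with rfl | hM
  · simp [calibration]
  have hq : ∫ x in (0 : ℝ)..1, √(1 - x ^ 2) = Real.pi / 4 := by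
    have h := integral_sqrt_one_sub_sq
    have hc : Continuous fun x : ℝ => √(1 - x ^ 2) := by fun_prop
    rw [← intervalIntegral.integral_add_adjacent_intervals (b := 0)
      (hc.intervalIntegrable _ _) (hc.intervalIntegrable _ _)] at h
    have h2 := intervalIntegral.integral_comp_neg (fun x : ℝ => √(1 - x ^ 2)) (a := 0) (b := 1)
    simp only [neg_sq, neg_zero] at h2
    rw [← h2] at h
    linarith
  have hsub := intervalIntegral.integral_comp_mul_deriv (a := 0) (b := M)
    (f := fun t : ℝ => t ^ 2 / M ^ 2) (f' := fun t => 2 * t / M ^ 2)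
    (g := fun x : ℝ => √(1 - x ^ 2))
    (fun t _ => by simpa using (hasDerivAt_pow 2 t).div_const (M ^ 2))
    (by fun_prop) (by fun_prop)
  have e1 : (0 : ℝ) ^ 2 / M ^ 2 = 0 := by simp
  have e2 : M ^ 2 / M ^ 2 = 1 := div_self (by positivity)
  rw [e1, e2, hq] at hsub
  have h3 : (0 : ℝ) < √3 := by positivity
  have h33 : √3 * √3 = 3 := Real.mul_self_sqrt (by norm_num)
  have key : calibration M M = M ^ 4 / (2 * √3) *
      ∫ t in (0 : ℝ)..M, ((fun x : ℝ => √(1 - x ^ 2)) ∘ fun t : ℝ => t ^ 2 / M ^ 2) t *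
        (2 * t / M ^ 2) := by
    rw [← intervalIntegral.integral_const_mul]
    refine intervalIntegral.integral_congr fun t ht => ?_
    rw [uIcc_of_le hM.le] at ht
    simp only [solitonSpeed, Function.comp, abs_of_nonneg ht.1]
    have : (M ^ 4 - t ^ 4) / 3 = (M ^ 2) ^ 2 * (1 - (t ^ 2 / M ^ 2) ^ 2) / 3 := by
      field_simp
    rw [this, Real.sqrt_div' _ (by norm_num), Real.sqrt_mul (by positivity),
      Real.sqrt_sq (by positivity)]
    field_simp
  rw [key, hsub]
  unfold halfLineMass
  field_simp
  nlinarith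

/-- The critical energy on a set `T` of a function `u` with derivative `g`. -/
def energyOn (T : Set ℝ) (u g : ℝ → ℝ) : ℝ :=
  1 / 2 * (∫ x in T, g x ^ 2) - 1 / 6 * ∫ x in T, u x ^ 6

/-- The energy density with the Lagrange multiplier `M⁴/3` of the soliton of height `M`. -/
def calibDensity (M : ℝ) (u g : ℝ → ℝ) (x : ℝ) : ℝ :=
  g x ^ 2 / 2 + (M ^ 4 * u x ^ 2 - u x ^ 6) / 6

theorem speed_mul_le_calibDensity {M : ℝ} {u g : ℝ → ℝ} {x : ℝ} (h : |u x| ≤ M) :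
    |solitonSpeed M (u x) * g x| ≤ calibDensity M u g x := by
  have hpow : u x ^ 4 ≤ M ^ 4 := by
    have := pow_le_pow_left₀ (abs_nonneg _) h 4
    rwa [Even.pow_abs (by decide)] at this
  have hsq : solitonSpeed M (u x) ^ 2 = (M ^ 4 * u x ^ 2 - u x ^ 6) / 3 := by
    unfold solitonSpeed
    rw [mul_pow, sq_abs, Real.sq_sqrt (by linarith)]
    ring
  unfold calibDensity
  rw [abs_le]
  constructor <;> nlinarith [sq_nonneg (solitonSpeed M (u x) + g x),
    sq_nonneg (solitonSpeed M (u x) - g x)]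

theorem calibDensity_nonneg {M : ℝ} {u g : ℝ → ℝ} {x : ℝ} (h : |u x| ≤ M) :
    0 ≤ calibDensity M u g x :=
  (abs_nonneg _).trans (speed_mul_le_calibDensity h)

namespace SobolevOn

variable {S T : Set ℝ} {u g : ℝ → ℝ} {M : ℝ}

theorem integrableOn_sq (h : SobolevOn S u g) : IntegrableOn (fun x => u x ^ 2) S :=
  h.memLp.integrable_sq

theorem integrableOn_deriv_sq (h : SobolevOn S u g) : IntegrableOn (fun x => g x ^ 2) S :=
  h.memLp_deriv.integrable_sq

theorem integrableOn_pow_six (h : SobolevOn S u g) (hS : MeasurableSet S)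
    (hM : ∀ x ∈ S, |u x| ≤ M) : IntegrableOn (fun x => u x ^ 6) S := by
  refine (h.integrableOn_sq.const_mul (M ^ 4)).mono' (h.memLp.aestronglyMeasurable.pow 6) ?_
  rw [ae_restrict_iff' hS]
  refine ae_of_all _ fun x hx => ?_
  have := pow_le_pow_left₀ (abs_nonneg _) (hM x hx) 4
  rw [Even.pow_abs (by decide)] at this
  rw [Real.norm_eq_abs, abs_of_nonneg (by positivity)]
  nlinarith [sq_nonneg (u x)]

theorem integrableOn_calibDensity (h : SobolevOn S u g) (hS : MeasurableSet S)
    (hM : ∀ x ∈ S, |u x| ≤ M) : IntegrableOn (calibDensity M u g) S :=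
  (h.integrableOn_deriv_sq.div_const 2).add
    (((h.integrableOn_sq.const_mul _).sub (h.integrableOn_pow_six hS hM)).div_const 6)

theorem integral_calibDensity (h : SobolevOn S u g) (hS : MeasurableSet S)
    (hM : ∀ x ∈ S, |u x| ≤ M) :
    ∫ x in S, calibDensity M u g x = energyOn S u g + M ^ 4 / 6 * ∫ x in S, u x ^ 2 := by
  unfold calibDensity energyOn
  have h1 := h.integrableOn_deriv_sq.div_const 2
  have h2 := h.integrableOn_sq.const_mul (M ^ 4)
  have h3 := h.integrableOn_pow_six hS hM
  have h23 : IntegrableOn (fun x => (M ^ 4 * u x ^ 2 - u x ^ 6) / 6) S := (h2.sub h3).div_const 6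
  rw [integral_add h1 h23, integral_div, integral_div, integral_sub h2 h3, integral_const_mul]
  ring

/-- Passing from the value `u x` to the value `u y` costs at least the variation of the
calibration. -/
theorem abs_calibration_sub_le [hS : S.OrdConnected] (h : SobolevOn S u g)
    (hM : ∀ x ∈ S, |u x| ≤ M) {x y : ℝ} (hx : x ∈ S) (hy : y ∈ S) (hxy : x ≤ y) :
    |calibration M (u y) - calibration M (u x)| ≤ ∫ t in Ioc x y, calibDensity M u g t := by
  have hsub : Ioc x y ⊆ S := fun t ht => hS.out hx hy ⟨ht.1.le, ht.2⟩
  rw [h.comp_sub_eq (hasDerivAt_calibration M) (continuous_solitonSpeed M) hx hy,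
    intervalIntegral.integral_of_le hxy]
  rw [← Real.norm_eq_abs]
  refine (norm_integral_le_integral_norm _).trans ?_
  refine integral_mono_of_nonneg (ae_of_all _ fun t => norm_nonneg _)
    ((h.integrableOn_calibDensity hS.measurableSet hM).mono_set hsub) ?_
  rw [Filter.EventuallyLE, ae_restrict_iff' measurableSet_Ioc]
  exact ae_of_all _ fun t ht => speed_mul_le_calibDensity (hM t (hsub ht))

theorem integral_calibDensity_mono (h : SobolevOn S u g) (hS : MeasurableSet S)
    (hM : ∀ x ∈ S, |u x| ≤ M) (hT : T ⊆ S) :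
    ∫ t in T, calibDensity M u g t ≤ ∫ t in S, calibDensity M u g t :=
  setIntegral_mono_set (h.integrableOn_calibDensity hS hM)
    ((ae_restrict_iff' hS).2 (ae_of_all _ fun t ht => calibDensity_nonneg (hM t ht)))
    (ae_of_all _ hT)

theorem abs_le_Ioi_of_abs_le_Ici {a : ℝ} {f : ℝ → ℝ} (h : ∀ x ∈ Ici a, |f x| ≤ M) :
    ∀ x ∈ Ioi a, |f x| ≤ M := fun x hx => h x (mem_Ici_of_Ioi hx)

/-- A square integrable function takes small values arbitrarily far away. -/
theorem exists_ge_abs_lt {a : ℝ} (h : SobolevOn (Ici a) u g) {x ε : ℝ} (hx : a ≤ x)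
    (hε : 0 < ε) : ∃ y, x ≤ y ∧ |u y| < ε := by
  by_contra! hcon
  have hi : IntegrableOn (fun x => u x ^ 2) (Ici x) :=
    h.integrableOn_sq.mono_set (Ici_subset_Ici.2 hx)
  have hc : IntegrableOn (fun _ : ℝ => ε ^ 2) (Ici x) := by
    refine hi.mono' aestronglyMeasurable_const ((ae_restrict_iff' measurableSet_Ici).2 ?_)
    refine ae_of_all _ fun y hy => ?_
    rw [Real.norm_eq_abs, abs_of_nonneg (sq_nonneg _), ← sq_abs (u y)]
    exact pow_le_pow_left₀ hε.le (hcon y hy) 2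
  rw [integrableOn_const_iff] at hc
  simp [hε.ne'] at hc

/-- Passing from the value `u x` to `0` at infinity. -/
theorem calibration_abs_le_integral_Ioi {a : ℝ} (h : SobolevOn (Ici a) u g)
    (hM : ∀ x ∈ Ici a, |u x| ≤ M) {x : ℝ} (hx : a ≤ x) :
    calibration M |u x| ≤ ∫ t in Ioi x, calibDensity M u g t := by
  refine le_of_forall_pos_le_add fun ε hε => ?_
  obtain ⟨y, hxy, hy⟩ := h.exists_ge_abs_lt hx
    (show 0 < √(ε / (M ^ 2 + 1)) by positivity)
  have h1 := h.abs_calibration_sub_le hM (mem_Ici.2 hx) (mem_Ici.2 (hx.trans hxy)) hxy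
  have h2 : ∫ t in Ioc x y, calibDensity M u g t ≤ ∫ t in Ioi x, calibDensity M u g t :=
    (h.mono (fun t ht => mem_Ici.2 (hx.trans (le_of_lt ht)))).integral_calibDensity_mono
      measurableSet_Ioi (fun t ht => hM t (mem_Ici.2 (hx.trans (le_of_lt ht))))
      Ioc_subset_Ioi_self
  have h3 := abs_sub_abs_le_abs_sub (calibration M (u x)) (calibration M (u y))
  rw [abs_sub_comm, abs_calibration, abs_calibration] at h3
  have h4 := calibration_le (M := M) (abs_nonneg (u y))
  have h5 : |u y| ^ 2 ≤ ε / (M ^ 2 + 1) := by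
    have := pow_le_pow_left₀ (abs_nonneg _) hy.le 2
    rwa [Real.sq_sqrt (by positivity)] at this
  have h6 : M ^ 2 * |u y| ^ 2 ≤ ε := by
    calc M ^ 2 * |u y| ^ 2 ≤ (M ^ 2 + 1) * (ε / (M ^ 2 + 1)) := by gcongr; linarith
      _ = ε := by field_simp
  linarith

theorem tendsto_zero {a : ℝ} (h : SobolevOn (Ici a) u g) : Tendsto u atTop (𝓝 0) := by
  have hi : IntegrableOn (fun t => u t ^ 2 + g t ^ 2) (Ioi a) :=
    (h.integrableOn_sq.add h.integrableOn_deriv_sq).mono_set Ioi_subset_Ici_self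
  have hlim := intervalIntegral_tendsto_integral_Ioi a hi tendsto_id
  have hbound : ∀ x, a ≤ x → u x ^ 2 ≤ (∫ t in Ioi a, (u t ^ 2 + g t ^ 2)) -
      ∫ t in a..x, (u t ^ 2 + g t ^ 2) := by
    intro x hx
    refine le_of_forall_pos_le_add fun ε hε => ?_
    obtain ⟨y, hxy, hy⟩ := h.exists_ge_abs_lt hx (show 0 < √ε by positivity)
    have hy2 : u y ^ 2 ≤ ε := by
      have := pow_le_pow_left₀ (abs_nonneg _) hy.le 2
      rwa [Real.sq_sqrt hε.le, sq_abs] at this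
    have h1 := h.comp_sub_eq (Φ := fun s => s ^ 2) (F := fun s => 2 * s)
      (fun s => by simpa using hasDerivAt_pow 2 s) (by fun_prop)
      (mem_Ici.2 hx) (mem_Ici.2 (hx.trans hxy))
    have hsub : Ioc x y ⊆ Ioi a := fun t ht => lt_of_le_of_lt hx ht.1
    have h2 : -(∫ t in x..y, 2 * u t * g t) ≤ ∫ t in Ioc x y, (u t ^ 2 + g t ^ 2) := by
      rw [intervalIntegral.integral_of_le hxy, ← integral_neg]
      refine integral_mono_ae ?_ (hi.mono_set hsub) (ae_of_all _ fun t => ?_)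
      · have hm := (h.memLp.integrable_mul h.memLp_deriv).const_mul (-2)
        refine (IntegrableOn.mono_set hm (hsub.trans Ioi_subset_Ici_self)).congr
          (ae_of_all _ fun t => ?_)
        simp only [Pi.mul_apply]; ring
      · simp only; nlinarith [sq_nonneg (u t + g t)]
    have h3 : ∫ t in Ioc x y, (u t ^ 2 + g t ^ 2) ≤ ∫ t in Ioi x, (u t ^ 2 + g t ^ 2) :=
      setIntegral_mono_set (hi.mono_set (Ioi_subset_Ioi hx))
        (ae_of_all _ fun t => by simp only [Pi.zero_apply]; positivity)
        (ae_of_all _ Ioc_subset_Ioi_self)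
    have h4 : (∫ t in Ioi a, (u t ^ 2 + g t ^ 2)) - ∫ t in a..x, (u t ^ 2 + g t ^ 2) =
        ∫ t in Ioi x, (u t ^ 2 + g t ^ 2) := by
      rw [intervalIntegral.integral_of_le hx, ← Ioc_union_Ioi_eq_Ioi hx,
        setIntegral_union (Ioc_disjoint_Ioi le_rfl) measurableSet_Ioi
          (hi.mono_set Ioc_subset_Ioi_self) (hi.mono_set (Ioi_subset_Ioi hx))]
      ring
    linarith
  have hsq : Tendsto (fun x => u x ^ 2) atTop (𝓝 0) := by
    have hlim' := (tendsto_const_nhds (x := ∫ t in Ioi a, (u t ^ 2 + g t ^ 2))).sub hlim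
    rw [sub_self] at hlim'
    refine tendsto_of_tendsto_of_tendsto_of_le_of_le' tendsto_const_nhds hlim'
      (Eventually.of_forall fun x => sq_nonneg _) ?_
    filter_upwards [eventually_ge_atTop a] with x hx using hbound x hx
  have := hsq.sqrt
  simp only [Real.sqrt_sq_eq_abs, Real.sqrt_zero] at this
  exact (tendsto_zero_iff_abs_tendsto_zero _).2 this

theorem exists_isMax_Ici {a : ℝ} (h : SobolevOn (Ici a) u g) :
    ∃ x ∈ Ici a, ∀ y ∈ Ici a, |u y| ≤ |u x| := by
  by_cases h0 : ∀ y ∈ Ici a, u y = 0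
  · exact ⟨a, self_mem_Ici, fun y hy => by simp [h0 y hy]⟩
  push Not at h0
  obtain ⟨z, hz, hz0⟩ := h0
  have hev : ∀ᶠ y in cocompact ℝ ⊓ 𝓟 (Ici a), |u y| ≤ |u z| := by
    have h1 : ∀ᶠ y in atTop, |u y| ≤ |u z| := by
      have := h.tendsto_zero.abs
      rw [abs_zero] at this
      exact this.eventually_le_const (abs_pos.2 hz0)
    obtain ⟨R, hR⟩ := eventually_atTop.1 h1
    rw [eventually_inf_principal]
    have : (Icc a R)ᶜ ∈ cocompact ℝ := isCompact_Icc.compl_mem_cocompact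
    filter_upwards [this] with y hy hya
    refine hR y ?_
    by_contra hcon
    exact hy ⟨hya, (not_le.1 hcon).le⟩
  obtain ⟨x, hx, hmax⟩ := h.continuousOn.abs.exists_isMaxOn' isClosed_Ici hz hev
  exact ⟨x, hx, fun y hy => hmax hy⟩

/-- Lower bound for the energy on a half-line `[a, ∞)` in terms of the maximum. -/
theorem energyOn_Ioi_ge {a x : ℝ} (h : SobolevOn (Ici a) u g) (hx : x ∈ Ici a)
    (hM : ∀ y ∈ Ici a, |u y| ≤ |u x|) :
    |u x| ^ 4 / 6 * (halfLineMass - ∫ t in Ioi a, u t ^ 2) ≤ energyOn (Ioi a) u g := by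
  have h1 := h.calibration_abs_le_integral_Ioi hM hx
  rw [calibration_self (abs_nonneg _)] at h1
  have ho := h.mono Ioi_subset_Ici_self
  have hMo := abs_le_Ioi_of_abs_le_Ici hM
  have h2 := ho.integral_calibDensity_mono measurableSet_Ioi hMo (Ioi_subset_Ioi hx)
  rw [ho.integral_calibDensity measurableSet_Ioi hMo] at h2
  linarith

theorem energyOn_Ioi_nonneg {a : ℝ} (h : SobolevOn (Ici a) u g)
    (hm : ∫ t in Ioi a, u t ^ 2 ≤ halfLineMass) : 0 ≤ energyOn (Ioi a) u g := by
  obtain ⟨x, hx, hM⟩ := h.exists_isMax_Ici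
  refine le_trans ?_ (h.energyOn_Ioi_ge hx hM)
  have := sub_nonneg.2 hm
  positivity

/-- Two passes on a half-line: from the end point to `u x` and from there to `0`. -/
theorem two_passes_Ici {a x : ℝ} (h : SobolevOn (Ici a) u g) (hM : ∀ y ∈ Ici a, |u y| ≤ M)
    (hx : x ∈ Ici a) :
    2 * calibration M |u x| - calibration M |u a| ≤ ∫ t in Ioi a, calibDensity M u g t := by
  have hx' : a ≤ x := hx
  have h1 := h.calibration_abs_le_integral_Ioi hM hx
  have h2 := h.abs_calibration_sub_le hM self_mem_Ici hx hx
  have h3 := (abs_sub_abs_le_abs_sub _ _).trans h2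
  rw [abs_calibration, abs_calibration] at h3
  have hi := (h.mono Ioi_subset_Ici_self).integrableOn_calibDensity measurableSet_Ioi
    (abs_le_Ioi_of_abs_le_Ici hM)
  rw [← Ioc_union_Ioi_eq_Ioi hx', setIntegral_union (Ioc_disjoint_Ioi le_rfl) measurableSet_Ioi
      (hi.mono_set Ioc_subset_Ioi_self) (hi.mono_set (Ioi_subset_Ioi hx'))]
  linarith

end SobolevOn

/-! ### Functions on a metric graph -/

namespace MetricGraph

variable {V B H : Type*} {G : MetricGraph V B H} {u v : B ⊕ H → ℝ → ℝ}

instance ordConnected_edge (G : MetricGraph V B H) (e : B ⊕ H) : (G.edge e).OrdConnected := by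
  cases e
  · exact ordConnected_Icc
  · exact ordConnected_Ici

instance ordConnected_openEdge (G : MetricGraph V B H) (e : B ⊕ H) :
    (G.openEdge e).OrdConnected := by
  cases e
  · exact ordConnected_Ioo
  · exact ordConnected_Ioi

theorem isOpen_openEdge (G : MetricGraph V B H) (e : B ⊕ H) : IsOpen (G.openEdge e) := by
  cases e
  · exact isOpen_Ioo
  · exact isOpen_Ioi

theorem measurableSet_edge (G : MetricGraph V B H) (e : B ⊕ H) : MeasurableSet (G.edge e) :=
  OrdConnected.measurableSet inferInstance

theorem measurableSet_openEdge (G : MetricGraph V B H) (e : B ⊕ H) :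
    MeasurableSet (G.openEdge e) := (G.isOpen_openEdge e).measurableSet

theorem openEdge_subset (G : MetricGraph V B H) (e : B ⊕ H) : G.openEdge e ⊆ G.edge e := by
  cases e
  · exact Ioo_subset_Icc_self
  · exact Ioi_subset_Ici_self

theorem edge_subset_closure (G : MetricGraph V B H) (e : B ⊕ H) :
    G.edge e ⊆ closure (G.openEdge e) := by
  cases e with
  | inl b => exact (closure_Ioo (G.len_pos b).ne).ge
  | inr h => exact (closure_Ioi (0 : ℝ)).ge

theorem edge_ae_eq (G : MetricGraph V B H) (e : B ⊕ H) :
    G.edge e =ᵐ[volume] G.openEdge e := by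
  cases e
  · exact Ioo_ae_eq_Icc.symm
  · exact Ioi_ae_eq_Ici.symm

theorem zero_mem_edge (G : MetricGraph V B H) (e : B ⊕ H) : (0 : ℝ) ∈ G.edge e := by
  cases e with
  | inl b => exact ⟨le_rfl, (G.len_pos b).le⟩
  | inr h => exact self_mem_Ici

theorem len_mem_edge (G : MetricGraph V B H) (b : B) : G.len b ∈ G.edge (Sum.inl b) :=
  ⟨(G.len_pos b).le, le_rfl⟩

theorem MemH1.sobolevOn (hu : G.MemH1 u) (e : B ⊕ H) :
    SobolevOn (G.edge e) (u e) (G.der u e) :=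
  sobolevOn_of_isWeakDeriv (G.isOpen_openEdge e) (G.openEdge_subset e) (G.edge_subset_closure e)
    (G.edge_ae_eq e) (hu.2 e).1 (weakDeriv_spec (hu.2 e)).1 (hu.1.1 e) (weakDeriv_spec (hu.2 e)).2

theorem memH1_of_sobolevOn {g : B ⊕ H → ℝ → ℝ} (hs : ∀ e, SobolevOn (G.edge e) (u e) (g e))
    (hw : ∃ w : V → ℝ,
      (∀ b : B, u (Sum.inl b) 0 = w (G.src b) ∧ u (Sum.inl b) (G.len b) = w (G.tgt b)) ∧
      ∀ h : H, u (Sum.inr h) 0 = w (G.foot h)) : G.MemH1 u := by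
  refine ⟨⟨fun e => (hs e).continuousOn, hw⟩, fun e => ?_⟩
  have h' := (hs e).mono (G.openEdge_subset e)
  exact ⟨h'.memLp, g e, h'.memLp_deriv, h'.isWeakDeriv (G.isOpen_openEdge e)⟩

theorem der_ae_eq {e : B ⊕ H} {g : ℝ → ℝ} (hs : SobolevOn (G.edge e) (u e) g) :
    G.der u e =ᵐ[volume.restrict (G.openEdge e)] g := by
  have h' := hs.mono (G.openEdge_subset e)
  exact weakDeriv_ae_eq (G.isOpen_openEdge e) h'.memLp_deriv (h'.isWeakDeriv (G.isOpen_openEdge e))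

theorem MemH1.const_smul (hu : G.MemH1 u) (c : ℝ) : G.MemH1 (c • u) := by
  obtain ⟨w, hB, hH⟩ := hu.1.2
  refine memH1_of_sobolevOn (fun e => (hu.sobolevOn e).const_mul c)
    ⟨fun x => c * w x, fun b => ⟨?_, ?_⟩, fun h => ?_⟩
  · simp [(hB b).1]
  · simp [(hB b).2]
  · simp [hH h]

theorem MemH1.add (hu : G.MemH1 u) (hv : G.MemH1 v) : G.MemH1 (u + v) := by
  obtain ⟨w, hB, hH⟩ := hu.1.2
  obtain ⟨w', hB', hH'⟩ := hv.1.2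
  refine memH1_of_sobolevOn (fun e => (hu.sobolevOn e).add (hv.sobolevOn e))
    ⟨fun x => w x + w' x, fun b => ⟨?_, ?_⟩, fun h => ?_⟩
  · simp [(hB b).1, (hB' b).1]
  · simp [(hB b).2, (hB' b).2]
  · simp [hH h, hH' h]

/-- The mass on one edge. -/
def edgeMass (G : MetricGraph V B H) (u : B ⊕ H → ℝ → ℝ) (e : B ⊕ H) : ℝ :=
  ∫ x in G.openEdge e, u e x ^ 2

/-- The kinetic term on one edge. -/
def edgeKinetic (G : MetricGraph V B H) (u : B ⊕ H → ℝ → ℝ) (e : B ⊕ H) : ℝ :=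
  ∫ x in G.openEdge e, G.der u e x ^ 2

/-- The sextic term on one edge. -/
def edgeSextic (G : MetricGraph V B H) (u : B ⊕ H → ℝ → ℝ) (e : B ⊕ H) : ℝ :=
  ∫ x in G.openEdge e, u e x ^ 6

/-- The energy on one edge. -/
def edgeEnergy (G : MetricGraph V B H) (u : B ⊕ H → ℝ → ℝ) (e : B ⊕ H) : ℝ :=
  1 / 2 * G.edgeKinetic u e - 1 / 6 * G.edgeSextic u e

/-- The cost of `u` on one edge, `M` being a bound for `|u|`: an upper bound for the variation of
`calibration M ∘ u` along the edge. -/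
def edgeCost (G : MetricGraph V B H) (M : ℝ) (u : B ⊕ H → ℝ → ℝ) (e : B ⊕ H) : ℝ :=
  ∫ x in G.openEdge e, calibDensity M (u e) (G.der u e) x

theorem edgeMass_nonneg (G : MetricGraph V B H) (u : B ⊕ H → ℝ → ℝ) (e : B ⊕ H) :
    0 ≤ G.edgeMass u e := integral_nonneg fun _ => sq_nonneg _

theorem edgeKinetic_nonneg (G : MetricGraph V B H) (u : B ⊕ H → ℝ → ℝ) (e : B ⊕ H) :
    0 ≤ G.edgeKinetic u e := integral_nonneg fun _ => sq_nonneg _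

theorem edgeSextic_nonneg (G : MetricGraph V B H) (u : B ⊕ H → ℝ → ℝ) (e : B ⊕ H) :
    0 ≤ G.edgeSextic u e := integral_nonneg fun _ => by simp only [Pi.zero_apply]; positivity

theorem edgeMass_smul (G : MetricGraph V B H) (u : B ⊕ H → ℝ → ℝ) (c : ℝ) (e : B ⊕ H) :
    G.edgeMass (c • u) e = c ^ 2 * G.edgeMass u e := by
  simp only [edgeMass, Pi.smul_apply, smul_eq_mul, mul_pow]
  rw [integral_const_mul]

theorem edgeSextic_smul (G : MetricGraph V B H) (u : B ⊕ H → ℝ → ℝ) (c : ℝ) (e : B ⊕ H) :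
    G.edgeSextic (c • u) e = c ^ 6 * G.edgeSextic u e := by
  simp only [edgeSextic, Pi.smul_apply, smul_eq_mul, mul_pow]
  rw [integral_const_mul]

theorem edgeKinetic_eq_of_sobolevOn {e : B ⊕ H} {g : ℝ → ℝ}
    (hs : SobolevOn (G.edge e) (u e) g) : G.edgeKinetic u e = ∫ x in G.openEdge e, g x ^ 2 := by
  refine integral_congr_ae ?_
  filter_upwards [der_ae_eq hs] with x hx
  rw [hx]

theorem MemH1.edgeKinetic_smul (hu : G.MemH1 u) (c : ℝ) (e : B ⊕ H) :
    G.edgeKinetic (c • u) e = c ^ 2 * G.edgeKinetic u e := by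
  rw [edgeKinetic_eq_of_sobolevOn (u := c • u) ((hu.sobolevOn e).const_mul c), edgeKinetic,
    ← integral_const_mul]
  simp only [mul_pow]

theorem MemH1.exists_isMax_edge (hu : G.MemH1 u) (e : B ⊕ H) :
    ∃ x ∈ G.edge e, ∀ y ∈ G.edge e, |u e y| ≤ |u e x| := by
  cases e with
  | inl b =>
    obtain ⟨x, hx, hmax⟩ := (isCompact_Icc (a := (0 : ℝ)) (b := G.len b)).exists_isMaxOn
      ⟨0, G.zero_mem_edge (Sum.inl b)⟩ (hu.1.1 (Sum.inl b)).abs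
    exact ⟨x, hx, fun y hy => hmax hy⟩
  | inr h => exact SobolevOn.exists_isMax_Ici (hu.sobolevOn (Sum.inr h))

theorem MemH1.exists_isMax [Finite B] [Finite H] [Nonempty (B ⊕ H)] (hu : G.MemH1 u) :
    ∃ e, ∃ x ∈ G.edge e, ∀ e', ∀ y ∈ G.edge e', |u e' y| ≤ |u e x| := by
  choose x hx hmax using hu.exists_isMax_edge
  obtain ⟨e, he⟩ := Finite.exists_max fun e => |u e (x e)|
  exact ⟨e, x e, hx e, fun e' y hy => (hmax e' y hy).trans (he e')⟩

section Cost

variable {M : ℝ}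

theorem MemH1.sobolevOn_openEdge (hu : G.MemH1 u) (e : B ⊕ H) :
    SobolevOn (G.openEdge e) (u e) (G.der u e) :=
  (hu.sobolevOn e).mono (G.openEdge_subset e)

theorem MemH1.edgeCost_eq (hu : G.MemH1 u) {e : B ⊕ H} (hM : ∀ x ∈ G.edge e, |u e x| ≤ M) :
    G.edgeCost M u e = G.edgeEnergy u e + M ^ 4 / 6 * G.edgeMass u e :=
  (hu.sobolevOn_openEdge e).integral_calibDensity (G.measurableSet_openEdge e)
    fun x hx => hM x (G.openEdge_subset e hx)

theorem edgeCost_nonneg {e : B ⊕ H} (hM : ∀ x ∈ G.edge e, |u e x| ≤ M) :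
    0 ≤ G.edgeCost M u e :=
  setIntegral_nonneg (G.measurableSet_openEdge e) fun x hx =>
    calibDensity_nonneg (hM x (G.openEdge_subset e hx))

theorem MemH1.edgeSextic_le (hu : G.MemH1 u) {e : B ⊕ H} (hM : ∀ x ∈ G.edge e, |u e x| ≤ M) :
    G.edgeSextic u e ≤ M ^ 4 * G.edgeMass u e := by
  have hs := hu.sobolevOn_openEdge e
  have hM' : ∀ x ∈ G.openEdge e, |u e x| ≤ M := fun x hx => hM x (G.openEdge_subset e hx)
  unfold edgeSextic edgeMass
  rw [← integral_const_mul]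
  refine setIntegral_mono_on (hs.integrableOn_pow_six (G.measurableSet_openEdge e) hM')
    (hs.integrableOn_sq.const_mul _) (G.measurableSet_openEdge e) fun x hx => ?_
  have := pow_le_pow_left₀ (abs_nonneg _) (hM' x hx) 4
  rw [Even.pow_abs (by decide)] at this
  nlinarith [sq_nonneg (u e x)]

theorem MemH1.calibration_sub_le (hu : G.MemH1 u) {e : B ⊕ H}
    (hM : ∀ x ∈ G.edge e, |u e x| ≤ M) {x y : ℝ} (hx : x ∈ G.edge e) (hy : y ∈ G.edge e) :
    |calibration M (u e y) - calibration M (u e x)| ≤ G.edgeCost M u e := by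
  wlog hxy : x ≤ y generalizing x y
  · rw [abs_sub_comm]; exact this hy hx (le_of_not_ge hxy)
  refine ((hu.sobolevOn e).abs_calibration_sub_le hM hx hy hxy).trans ?_
  unfold edgeCost
  rw [← setIntegral_congr_set (G.edge_ae_eq e)]
  exact (hu.sobolevOn e).integral_calibDensity_mono (G.measurableSet_edge e) hM
    fun t ht => (G.ordConnected_edge e).out hx hy ⟨ht.1.le, ht.2⟩

/-- Passing from the end point of a half-line, or from any of its points, to infinity. -/
theorem MemH1.calibration_le_edgeCost (hu : G.MemH1 u)
    {h : H} (hM : ∀ x ∈ G.edge (Sum.inr h), |u (Sum.inr h) x| ≤ M) {x : ℝ}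
    (hx : x ∈ G.edge (Sum.inr h)) :
    calibration M |u (Sum.inr h) x| ≤ G.edgeCost M u (Sum.inr h) := by
  refine (SobolevOn.calibration_abs_le_integral_Ioi (hu.sobolevOn (Sum.inr h)) hM hx).trans ?_
  exact (hu.sobolevOn_openEdge (Sum.inr h)).integral_calibDensity_mono
    (G.measurableSet_openEdge (Sum.inr h)) (fun t ht => hM t (G.openEdge_subset _ ht))
    (Ioi_subset_Ioi hx)

end Cost

section Paths

variable [Fintype B]

/-- Variation of a vertex function along a trail, in terms of its variation along edges. -/
theorem abs_sub_le_sum_of_isTrail (G : MetricGraph V B H) [DecidableEq V] {Ψ : V → ℝ} {D : B → ℝ}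
    (hD : ∀ b, 0 ≤ D b) (hΨ : ∀ b, |Ψ (G.src b) - Ψ (G.tgt b)| ≤ D b) {x y : V}
    (p : (SimpleGraph.fromRel fun v w => ∃ b, G.src b = v ∧ G.tgt b = w).Walk x y)
    (hp : p.IsTrail) :
    |Ψ x - Ψ y| ≤ ∑ b with s(G.src b, G.tgt b) ∈ p.edges, D b := by
  have h1 : |Ψ x - Ψ y| ≤
      (p.edges.map fun e => ∑ b with s(G.src b, G.tgt b) = e, D b).sum := by
    clear hp
    induction p with
    | nil => simp
    | @cons a b c hadj q ih =>
      rw [SimpleGraph.Walk.edges_cons, List.map_cons, List.sum_cons]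
      refine (abs_sub_le _ (Ψ b) _).trans (add_le_add ?_ ih)
      obtain ⟨-, ⟨e, he1, he2⟩ | ⟨e, he1, he2⟩⟩ := (SimpleGraph.fromRel_adj _ _ _).1 hadj
      · have hm : e ∈ Finset.univ.filter fun e' => s(G.src e', G.tgt e') = s(a, b) := by
          simp [he1, he2]
        refine le_trans ?_ (Finset.single_le_sum (fun i _ => hD i) hm)
        rw [← he1, ← he2]; exact hΨ e
      · have hm : e ∈ Finset.univ.filter fun e' => s(G.src e', G.tgt e') = s(a, b) := by
          simp [he1, he2]
        refine le_trans ?_ (Finset.single_le_sum (fun i _ => hD i) hm)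
        rw [← he1, ← he2, abs_sub_comm]; exact hΨ e
  refine h1.trans_eq ?_
  rw [← List.sum_toFinset _ hp.edges_nodup, Finset.sum_comm' (t' := Finset.univ.filter fun b =>
    s(G.src b, G.tgt b) ∈ p.edges) (s' := fun b => {s(G.src b, G.tgt b)})]
  · simp
  · intro e b
    simp only [List.mem_toFinset, Finset.mem_filter, Finset.mem_univ, true_and,
      Finset.mem_singleton]
    constructor
    · rintro ⟨h1, h2⟩; exact ⟨h2.symm, h2 ▸ h1⟩
    · rintro ⟨h1, h2⟩; exact ⟨h1 ▸ h2, h1.symm⟩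

theorem Connected.abs_sub_le_sum (hconn : G.Connected) {Ψ : V → ℝ} {D : B → ℝ}
    (hD : ∀ b, 0 ≤ D b) (hΨ : ∀ b, |Ψ (G.src b) - Ψ (G.tgt b)| ≤ D b) (x y : V) :
    |Ψ x - Ψ y| ≤ ∑ b, D b := by
  classical
  obtain ⟨p, hp⟩ := (hconn.preconnected x y).exists_isPath
  refine (G.abs_sub_le_sum_of_isTrail hD hΨ p hp.isTrail).trans ?_
  exact Finset.sum_le_sum_of_subset_of_nonneg (Finset.filter_subset _ _) fun i _ _ => hD i

/-- One of the end points of a given edge can be joined to any vertex without using that edge. -/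
theorem Connected.exists_endpoint (hconn : G.Connected) [DecidableEq B] {Ψ : V → ℝ} {D : B → ℝ}
    (hD : ∀ b, 0 ≤ D b) (hΨ : ∀ b, |Ψ (G.src b) - Ψ (G.tgt b)| ≤ D b) (b : B) (y : V) :
    |Ψ (G.src b) - Ψ y| ≤ ∑ b' ∈ Finset.univ.erase b, D b' ∨
      |Ψ (G.tgt b) - Ψ y| ≤ ∑ b' ∈ Finset.univ.erase b, D b' := by
  classical
  have aux : ∀ {x : V}
      (p : (SimpleGraph.fromRel fun v w => ∃ b, G.src b = v ∧ G.tgt b = w).Walk x y),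
      p.IsTrail → s(G.src b, G.tgt b) ∉ p.edges →
      |Ψ x - Ψ y| ≤ ∑ b' ∈ Finset.univ.erase b, D b' := by
    intro x p hp hb
    refine (G.abs_sub_le_sum_of_isTrail hD hΨ p hp).trans ?_
    refine Finset.sum_le_sum_of_subset_of_nonneg (fun b' hb' => ?_) fun i _ _ => hD i
    rw [Finset.mem_filter] at hb'
    refine Finset.mem_erase.2 ⟨?_, Finset.mem_univ _⟩
    rintro rfl
    exact hb hb'.2
  obtain ⟨p, hp⟩ := (hconn.preconnected (G.src b) y).exists_isPath
  by_cases hb : s(G.src b, G.tgt b) ∈ p.edges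
  · -- a path from `src b` through the edge uses it first, and the rest starts at `tgt b`
    right
    generalize hsrc : G.src b = x at p hp hb
    cases p with
    | nil => simp at hb
    | @cons _ z _ hadj q =>
      rw [SimpleGraph.Walk.cons_isPath_iff] at hp
      have hq : s(x, G.tgt b) ∉ q.edges := fun h =>
        hp.2 (q.fst_mem_support_of_mem_edges h)
      rw [SimpleGraph.Walk.edges_cons, List.mem_cons] at hb
      have hz : G.tgt b = z := by
        rcases hb with hb | hb
        · rcases Sym2.eq_iff.1 hb with h | h
          · exact h.2
          · exact absurd h.1 hadj.ne
        · exact absurd hb hq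
      rw [hz]
      exact aux q hp.1.isTrail (by rw [hsrc]; exact hq)
  · exact Or.inl (aux p hp.isTrail hb)

variable {M : ℝ}

/-- Passing between the end points of two half-lines through the bounded edges. -/
theorem MemH1.calibration_foot_sub_foot_le (hu : G.MemH1 u) (hconn : G.Connected)
    (hM : ∀ e, ∀ x ∈ G.edge e, |u e x| ≤ M) (h h' : H) :
    calibration M |u (Sum.inr h) 0| - calibration M |u (Sum.inr h') 0| ≤
      ∑ b, G.edgeCost M u (Sum.inl b) := by
  obtain ⟨w, hB, hH⟩ := hu.1.2
  have := hconn.abs_sub_le_sum (Ψ := fun y => calibration M (w y))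
    (D := fun b => G.edgeCost M u (Sum.inl b)) (fun b => edgeCost_nonneg (hM _)) (fun b => by
      rw [← (hB b).1, ← (hB b).2]
      exact hu.calibration_sub_le (hM _) (G.len_mem_edge b) (G.zero_mem_edge _)) (G.foot h)
        (G.foot h')
  simp only [← hH] at this
  have h3 := (abs_sub_abs_le_abs_sub _ _).trans this
  rwa [abs_calibration, abs_calibration] at h3

/-- Passing from a point of a bounded edge to the end point of a half-line. -/
theorem MemH1.calibration_sub_foot_le (hu : G.MemH1 u) (hconn : G.Connected)
    (hM : ∀ e, ∀ x ∈ G.edge e, |u e x| ≤ M) {b : B} {x : ℝ} (hx : x ∈ G.edge (Sum.inl b)) (h : H) :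
    calibration M |u (Sum.inl b) x| - calibration M |u (Sum.inr h) 0| ≤
      ∑ b, G.edgeCost M u (Sum.inl b) := by
  classical
  obtain ⟨w, hB, hH⟩ := hu.1.2
  have hD : ∀ b, 0 ≤ G.edgeCost M u (Sum.inl b) := fun b => edgeCost_nonneg (hM _)
  have h1 := hconn.exists_endpoint (Ψ := fun y => calibration M (w y))
    (D := fun b => G.edgeCost M u (Sum.inl b)) hD (fun b => by
      rw [← (hB b).1, ← (hB b).2]
      exact hu.calibration_sub_le (hM _) (G.len_mem_edge b) (G.zero_mem_edge _)) b (G.foot h)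
  simp only [← hH] at h1
  rw [← Finset.add_sum_erase _ _ (Finset.mem_univ b), ← abs_calibration, ← abs_calibration]
  refine (abs_sub_abs_le_abs_sub _ _).trans ?_
  rcases h1 with h1 | h1
  · rw [← (hB b).1] at h1
    exact (abs_sub_le _ _ _).trans (add_le_add
      (hu.calibration_sub_le (hM _) (G.zero_mem_edge _) hx) h1)
  · rw [← (hB b).2] at h1
    exact (abs_sub_le _ _ _).trans (add_le_add
      (hu.calibration_sub_le (hM _) (G.len_mem_edge b) hx) h1)

end Paths

section Functionals

variable [Fintype B] [Fintype H]

theorem mass_eq (G : MetricGraph V B H) (u : B ⊕ H → ℝ → ℝ) :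
    G.mass u = ∑ e, G.edgeMass u e := by
  simp only [mass, integral, edgeMass, sq_abs]

theorem kinetic_eq (G : MetricGraph V B H) (u : B ⊕ H → ℝ → ℝ) :
    G.kinetic u = ∑ e, G.edgeKinetic u e := by
  simp only [kinetic, integral, edgeKinetic, sq_abs]

theorem sextic_eq (G : MetricGraph V B H) (u : B ⊕ H → ℝ → ℝ) :
    G.sextic u = ∑ e, G.edgeSextic u e := by
  have : ∀ x : ℝ, |x| ^ 6 = x ^ 6 := fun x => Even.pow_abs (by decide) x
  simp only [sextic, integral, edgeSextic, this]

theorem energy_eq (G : MetricGraph V B H) (u : B ⊕ H → ℝ → ℝ) :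
    G.energy u = ∑ e, G.edgeEnergy u e := by
  simp only [energy, kinetic_eq, sextic_eq, edgeEnergy, Finset.mul_sum, Finset.sum_sub_distrib]

theorem mass_nonneg (G : MetricGraph V B H) (u : B ⊕ H → ℝ → ℝ) : 0 ≤ G.mass u := by
  rw [mass_eq]; exact Finset.sum_nonneg fun e _ => G.edgeMass_nonneg u e

theorem kinetic_nonneg (G : MetricGraph V B H) (u : B ⊕ H → ℝ → ℝ) : 0 ≤ G.kinetic u := by
  rw [kinetic_eq]; exact Finset.sum_nonneg fun e _ => G.edgeKinetic_nonneg u e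

theorem sextic_nonneg (G : MetricGraph V B H) (u : B ⊕ H → ℝ → ℝ) : 0 ≤ G.sextic u := by
  rw [sextic_eq]; exact Finset.sum_nonneg fun e _ => G.edgeSextic_nonneg u e

theorem mass_smul (G : MetricGraph V B H) (u : B ⊕ H → ℝ → ℝ) (c : ℝ) :
    G.mass (c • u) = c ^ 2 * G.mass u := by
  simp only [mass_eq, edgeMass_smul, Finset.mul_sum]

theorem sextic_smul (G : MetricGraph V B H) (u : B ⊕ H → ℝ → ℝ) (c : ℝ) :
    G.sextic (c • u) = c ^ 6 * G.sextic u := by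
  simp only [sextic_eq, edgeSextic_smul, Finset.mul_sum]

theorem MemH1.kinetic_smul (hu : G.MemH1 u) (c : ℝ) :
    G.kinetic (c • u) = c ^ 2 * G.kinetic u := by
  simp only [kinetic_eq, hu.edgeKinetic_smul, Finset.mul_sum]

theorem MemH1.energy_smul (hu : G.MemH1 u) (c : ℝ) :
    G.energy (c • u) = c ^ 2 * (1 / 2 * G.kinetic u) - c ^ 6 * (1 / 6 * G.sextic u) := by
  rw [energy, hu.kinetic_smul, sextic_smul]; ring

theorem mass_sqrt_smul (G : MetricGraph V B H) (u : B ⊕ H → ℝ → ℝ) {s : ℝ} (hs : 0 ≤ s) :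
    G.mass (√s • u) = s * G.mass u := by
  rw [mass_smul, Real.sq_sqrt hs]

theorem MemH1.kinetic_sqrt_smul (hu : G.MemH1 u) {s : ℝ} (hs : 0 ≤ s) :
    G.kinetic (√s • u) = s * G.kinetic u := by
  rw [hu.kinetic_smul, Real.sq_sqrt hs]

theorem MemH1.energy_sqrt_smul (hu : G.MemH1 u) {s : ℝ} (hs : 0 ≤ s) :
    G.energy (√s • u) = s * (1 / 2 * G.kinetic u) - s ^ 3 * (1 / 6 * G.sextic u) := by
  rw [hu.energy_smul, Real.sq_sqrt hs, show √s ^ 6 = (√s ^ 2) ^ 3 by ring, Real.sq_sqrt hs]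

theorem MemH1.sum_edgeCost (hu : G.MemH1 u) {M : ℝ} (hM : ∀ e, ∀ x ∈ G.edge e, |u e x| ≤ M) :
    ∑ e, G.edgeCost M u e = G.energy u + M ^ 4 / 6 * G.mass u := by
  rw [energy_eq, mass_eq, Finset.mul_sum, ← Finset.sum_add_distrib]
  exact Finset.sum_congr rfl fun e _ => hu.edgeCost_eq (hM e)

theorem MemH1.sextic_le (hu : G.MemH1 u) {M : ℝ} (hM : ∀ e, ∀ x ∈ G.edge e, |u e x| ≤ M) :
    G.sextic u ≤ M ^ 4 * G.mass u := by
  rw [sextic_eq, mass_eq, Finset.mul_sum]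
  exact Finset.sum_le_sum fun e _ => hu.edgeSextic_le (hM e)

/-- The maximum of a function on a connected noncompact graph bounds its energy from below. -/
theorem MemH1.energy_ge (hu : G.MemH1 u) (hconn : G.Connected) [Nonempty H] {e : B ⊕ H} {x : ℝ}
    (hx : x ∈ G.edge e) (hM : ∀ e', ∀ y ∈ G.edge e', |u e' y| ≤ |u e x|) :
    |u e x| ^ 4 / 6 * (halfLineMass - G.mass u) ≤ G.energy u := by
  obtain ⟨h⟩ := ‹Nonempty H›
  have key : calibration |u e x| |u e x| ≤ ∑ e', G.edgeCost |u e x| u e' := by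
    have h0 : ∀ e', 0 ≤ G.edgeCost |u e x| u e' := fun e' => edgeCost_nonneg (hM e')
    cases e with
    | inl b =>
      rw [Fintype.sum_sum_type]
      have h1 := hu.calibration_sub_foot_le hconn hM hx h
      have h2 := hu.calibration_le_edgeCost (hM _) (G.zero_mem_edge (Sum.inr h))
      have h3 := Finset.single_le_sum (f := fun h => G.edgeCost |u (Sum.inl b) x| u (Sum.inr h))
        (fun i _ => h0 _) (Finset.mem_univ h)
      linarith
    | inr h' =>
      exact (hu.calibration_le_edgeCost (hM _) hx).trans
        (Finset.single_le_sum (fun i _ => h0 i) (Finset.mem_univ _))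
  rw [calibration_self (abs_nonneg _), hu.sum_edgeCost hM] at key
  linarith

end Functionals

end MetricGraph

/-! ### The Gagliardo-Nirenberg inequality and the critical mass -/

theorem sobolevOn_of_hasDerivAt {S : Set ℝ} [S.OrdConnected] {u g : ℝ → ℝ}
    (hu : ∀ x, HasDerivAt u (g x) x) (hg : Continuous g)
    (hu2 : MemLp u 2 (volume.restrict S)) (hg2 : MemLp g 2 (volume.restrict S)) :
    SobolevOn S u g :=
  ⟨hu2, hg2, fun _ _ _ _ => (intervalIntegral.integral_eq_sub_of_hasDerivAt (fun t _ => hu t)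
    (hg.intervalIntegrable _ _)).symm⟩

theorem integral_pow_mul_exp_neg_mul_Ioi (n : ℕ) {r : ℝ} (hr : 0 < r) :
    ∫ t in Ioi (0 : ℝ), t ^ n * Real.exp (-(r * t)) = n.factorial / r ^ (n + 1) := by
  have h := Real.integral_rpow_mul_exp_neg_mul_Ioi (a := n + 1) (by positivity) hr
  rw [Real.Gamma_nat_eq_factorial] at h
  simp only [add_sub_cancel_right, Real.rpow_natCast] at h
  rw [h, show (n : ℝ) + 1 = ((n + 1 : ℕ) : ℝ) by push_cast; ring, Real.rpow_natCast, one_div,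
    inv_pow]
  field_simp

theorem integrableOn_pow_mul_exp_neg_mul_Ioi (n : ℕ) {r : ℝ} (hr : 0 < r) :
    IntegrableOn (fun t : ℝ => t ^ n * Real.exp (-(r * t))) (Ioi 0) :=
  Integrable.of_integral_ne_zero (by
    rw [integral_pow_mul_exp_neg_mul_Ioi n hr]
    have := n.factorial_pos
    positivity)

namespace MetricGraph

variable {V B H : Type*} {G : MetricGraph V B H} {u : B ⊕ H → ℝ → ℝ}

section Single

variable [DecidableEq (B ⊕ H)] {e : B ⊕ H} {f g : ℝ → ℝ}

theorem sobolevOn_single (hs : SobolevOn (G.edge e) f g) (e' : B ⊕ H) :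
    SobolevOn (G.edge e') ((Pi.single e f : B ⊕ H → ℝ → ℝ) e')
      ((Pi.single e g : B ⊕ H → ℝ → ℝ) e') := by
  by_cases he : e' = e
  · subst he; simpa using hs
  · rw [Pi.single_eq_of_ne he, Pi.single_eq_of_ne he]
    exact ⟨MemLp.zero', MemLp.zero', fun x _ y _ => by simp⟩

theorem edgeMass_single (G : MetricGraph V B H) (e e' : B ⊕ H) (f : ℝ → ℝ) :
    G.edgeMass (Pi.single e f) e' = if e' = e then ∫ x in G.openEdge e, f x ^ 2 else 0 := by
  split_ifs with he
  · subst he; simp [edgeMass]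
  · simp [edgeMass, Pi.single_eq_of_ne he]

theorem edgeSextic_single (G : MetricGraph V B H) (e e' : B ⊕ H) (f : ℝ → ℝ) :
    G.edgeSextic (Pi.single e f) e' = if e' = e then ∫ x in G.openEdge e, f x ^ 6 else 0 := by
  split_ifs with he
  · subst he; simp [edgeSextic]
  · simp [edgeSextic, Pi.single_eq_of_ne he]

theorem edgeKinetic_single (hs : SobolevOn (G.edge e) f g) (e' : B ⊕ H) :
    G.edgeKinetic (Pi.single e f) e' = if e' = e then ∫ x in G.openEdge e, g x ^ 2 else 0 := by
  rw [edgeKinetic_eq_of_sobolevOn (sobolevOn_single hs e')]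
  split_ifs with he
  · subst he; simp
  · simp [Pi.single_eq_of_ne he]

variable [Fintype B] [Fintype H]

theorem mass_single (G : MetricGraph V B H) (e : B ⊕ H) (f : ℝ → ℝ) :
    G.mass (Pi.single e f) = ∫ x in G.openEdge e, f x ^ 2 := by
  simp [mass_eq, edgeMass_single]

theorem sextic_single (G : MetricGraph V B H) (e : B ⊕ H) (f : ℝ → ℝ) :
    G.sextic (Pi.single e f) = ∫ x in G.openEdge e, f x ^ 6 := by
  simp [sextic_eq, edgeSextic_single]

theorem kinetic_single (hs : SobolevOn (G.edge e) f g) :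
    G.kinetic (Pi.single e f) = ∫ x in G.openEdge e, g x ^ 2 := by
  simp [kinetic_eq, edgeKinetic_single hs]

theorem energy_single (hs : SobolevOn (G.edge e) f g) :
    G.energy (Pi.single e f) = energyOn (G.openEdge e) f g := by
  rw [energy, kinetic_single hs, sextic_single, energyOn]

end Single

section Constant

variable [Fintype B] [Fintype H]

/-- The inequality `‖u‖_∞⁴ ≤ C ‖u‖₂² ‖u'‖₂²`, from `MemH1.energy_ge` for multiples of `u`. -/
theorem MemH1.max_pow_four_le (hu : G.MemH1 u) (hconn : G.Connected) [Nonempty H]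
    {e : B ⊕ H} {x : ℝ} (hx : x ∈ G.edge e)
    (hM : ∀ e', ∀ y ∈ G.edge e', |u e' y| ≤ |u e x|) :
    |u e x| ^ 4 * halfLineMass ^ 2 ≤ 12 * G.mass u * G.kinetic u := by
  have hmu := halfLineMass_pos
  have hm := G.mass_nonneg u
  have hk := G.kinetic_nonneg u
  set M := |u e x| with hMdef
  have hM0 : 0 ≤ M := abs_nonneg _
  have key : ∀ s : ℝ, 0 < s → s * (M ^ 4 * (halfLineMass - s * G.mass u)) ≤ 3 * G.kinetic u := by
    intro s hs
    have h4 : √s ^ 4 = s ^ 2 := by rw [show √s ^ 4 = (√s ^ 2) ^ 2 by ring, Real.sq_sqrt hs.le]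
    have h1 := (hu.const_smul √s).energy_ge hconn hx (fun e' y hy => by
      simp only [Pi.smul_apply, smul_eq_mul, abs_mul]
      exact mul_le_mul_of_nonneg_left (hM e' y hy) (abs_nonneg _))
    rw [hu.energy_sqrt_smul hs.le, mass_sqrt_smul _ _ hs.le] at h1
    simp only [Pi.smul_apply, smul_eq_mul, abs_mul, abs_of_nonneg (Real.sqrt_nonneg s), mul_pow]
      at h1
    rw [← hMdef, h4] at h1
    have h2 : 0 ≤ s ^ 3 * (1 / 6 * G.sextic u) := by
      have := G.sextic_nonneg u
      positivity
    have h3 : s * (s * (M ^ 4 * (halfLineMass - s * G.mass u))) ≤ s * (3 * G.kinetic u) := by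
      linarith
    exact le_of_mul_le_mul_left h3 hs
  -- `s = halfLineMass / (2 mass)` is the best choice; for `mass = 0` let `s → ∞`
  rcases hm.eq_or_lt with h0 | hpos
  · rw [← h0, mul_zero, zero_mul]
    simp only [← h0, mul_zero, sub_zero] at key
    by_contra! hcon
    have hM4 : 0 < M ^ 4 := by
      by_contra hle
      have : M ^ 4 = 0 := le_antisymm (not_lt.1 hle) (by positivity)
      rw [this, zero_mul] at hcon
      exact lt_irrefl _ hcon
    have := key ((3 * G.kinetic u + 1) / (M ^ 4 * halfLineMass)) (by positivity)
    rw [div_mul_cancel₀ _ (by positivity)] at this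
    linarith
  · have := key (halfLineMass / (2 * G.mass u)) (by positivity)
    have e1 : halfLineMass / (2 * G.mass u) * (M ^ 4 * (halfLineMass -
        halfLineMass / (2 * G.mass u) * G.mass u)) =
        M ^ 4 * halfLineMass ^ 2 / (4 * G.mass u) := by
      field_simp
      ring
    rw [e1, div_le_iff₀ (by positivity)] at this
    linarith

/-- The constant of the half-line is admissible on every noncompact connected graph: apply
`MemH1.energy_ge` to the multiple of `u` of mass `halfLineMass`. -/
theorem MemH1.sextic_le_halfLine (hu : G.MemH1 u) (hconn : G.Connected) [Nonempty H] :
    G.sextic u ≤ 3 / halfLineMass ^ 2 * G.mass u ^ 2 * G.kinetic u := by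
  have hmu := halfLineMass_pos
  obtain ⟨e, x, hx, hM⟩ := hu.exists_isMax
  rcases (G.mass_nonneg u).eq_or_lt with h0 | hpos
  · have := hu.sextic_le hM
    rw [← h0] at this ⊢
    simpa using this
  · set s := halfLineMass / G.mass u with hs
    have hspos : 0 < s := by positivity
    have h1 := (hu.const_smul √s).energy_ge hconn hx (fun e' y hy => by
      simp only [Pi.smul_apply, smul_eq_mul, abs_mul]
      exact mul_le_mul_of_nonneg_left (hM e' y hy) (abs_nonneg _))
    rw [hu.energy_sqrt_smul hspos.le, mass_sqrt_smul _ _ hspos.le, hs,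
      div_mul_cancel₀ _ hpos.ne', sub_self, mul_zero, ← hs] at h1
    have h2 : s ^ 2 * G.sextic u ≤ 3 * G.kinetic u := by
      refine le_of_mul_le_mul_left ?_ hspos
      linarith
    have h3 : 3 / halfLineMass ^ 2 * G.mass u ^ 2 * G.kinetic u = 3 * G.kinetic u / s ^ 2 := by
      rw [hs]; field_simp
    rw [h3, le_div_iff₀ (by positivity)]
    linarith

theorem gnConstant_le (hconn : G.Connected) [Nonempty H] :
    G.gnConstant ≤ 3 / halfLineMass ^ 2 :=
  csInf_le ⟨0, fun _ h => h.1⟩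
    ⟨by have := halfLineMass_pos; positivity, fun _ hu => hu.sextic_le_halfLine hconn⟩

theorem MemH1.sextic_le_gnConstant (hu : G.MemH1 u) (hconn : G.Connected) [Nonempty H] :
    G.sextic u ≤ G.gnConstant * G.mass u ^ 2 * G.kinetic u := by
  have hne : {K : ℝ | 0 ≤ K ∧
      ∀ u, G.MemH1 u → G.sextic u ≤ K * G.mass u ^ 2 * G.kinetic u}.Nonempty :=
    ⟨3 / halfLineMass ^ 2, by have := halfLineMass_pos; positivity,
      fun _ hu => hu.sextic_le_halfLine hconn⟩
  have hc : 0 ≤ G.mass u ^ 2 * G.kinetic u := mul_nonneg (sq_nonneg _) (G.kinetic_nonneg u)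
  rcases hc.eq_or_lt with h0 | hpos
  · obtain ⟨K, -, hK⟩ := hne
    have := hK u hu
    rw [mul_assoc, ← h0, mul_zero] at this ⊢
    exact this
  · rw [mul_assoc, ← div_le_iff₀ hpos]
    refine le_csInf hne fun K hK => ?_
    rw [div_le_iff₀ hpos, ← mul_assoc]
    exact hK.2 u hu

/-- A half-line carries functions of any mass and of arbitrarily small kinetic energy. -/
theorem exists_spread (G : MetricGraph V B H) [Nonempty H] {μ l : ℝ} (hμ : 0 < μ) (hl : 0 < l) :
    ∃ u, G.MemH1 u ∧ G.mass u = μ ∧ G.kinetic u = l ^ 2 * μ := by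
  classical
  obtain ⟨h⟩ := ‹Nonempty H›
  set c := √(4 * l ^ 3 * μ) with hc
  have hc2 : c ^ 2 = 4 * l ^ 3 * μ := Real.sq_sqrt (by positivity)
  -- `x exp (-l x)` vanishes at the vertex, so that it extends by zero to the rest of the graph
  set f : ℝ → ℝ := fun x => c * (x * Real.exp (-(l * x))) with hf
  set g : ℝ → ℝ := fun x => c * ((1 - l * x) * Real.exp (-(l * x))) with hg
  have hfg : ∀ x, HasDerivAt f (g x) x := by
    intro x
    have h1 : HasDerivAt (fun x => Real.exp (-(l * x))) (Real.exp (-(l * x)) * (-(l * 1))) x :=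
      ((hasDerivAt_id x).const_mul l).neg.exp
    refine (((hasDerivAt_id x).mul h1).const_mul c).congr_deriv ?_
    simp only [hg, id]
    ring
  have h2l : 0 < 2 * l := by positivity
  have hexp : ∀ x : ℝ, Real.exp (-(l * x)) ^ 2 = Real.exp (-(2 * l * x)) := fun x => by
    rw [← Real.exp_nat_mul]; congr 1; push_cast; ring
  have hf2 : ∀ x, f x ^ 2 = c ^ 2 * (x ^ 2 * Real.exp (-(2 * l * x))) := fun x => by
    rw [hf]; simp only [mul_pow, hexp]
  have hg2 : ∀ x, g x ^ 2 = c ^ 2 * (x ^ 0 * Real.exp (-(2 * l * x)) -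
      2 * l * (x ^ 1 * Real.exp (-(2 * l * x))) + l ^ 2 * (x ^ 2 * Real.exp (-(2 * l * x)))) :=
    fun x => by simp only [hg, mul_pow, hexp]; ring
  have i0 := integrableOn_pow_mul_exp_neg_mul_Ioi 0 h2l
  have i1 := (integrableOn_pow_mul_exp_neg_mul_Ioi 1 h2l).const_mul (2 * l)
  have i2 := integrableOn_pow_mul_exp_neg_mul_Ioi 2 h2l
  have i2' := i2.const_mul (l ^ 2)
  have i01 : IntegrableOn (fun x : ℝ => x ^ 0 * Real.exp (-(2 * l * x)) -
      2 * l * (x ^ 1 * Real.exp (-(2 * l * x)))) (Ioi 0) := i0.sub i1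
  have hgc : Continuous g := by rw [hg]; fun_prop
  have hfc : Continuous f := by rw [hf]; fun_prop
  have hIci : ∀ w : ℝ → ℝ, Continuous w → IntegrableOn (fun x => w x ^ 2) (Ioi 0) →
      MemLp w 2 (volume.restrict (Ici 0)) := by
    intro w hw hi
    rw [memLp_two_iff_integrable_sq hw.aestronglyMeasurable]
    exact (integrableOn_Ici_iff_integrableOn_Ioi).2 hi
  have hs : SobolevOn (G.edge (Sum.inr h)) f g := by
    refine sobolevOn_of_hasDerivAt hfg hgc (hIci f hfc ?_) (hIci g hgc ?_)
    · simp only [hf2]; exact i2.const_mul _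
    · simp only [hg2]; exact (i01.add i2').const_mul _
  refine ⟨Pi.single (Sum.inr h) f, memH1_of_sobolevOn (sobolevOn_single hs)
    ⟨0, fun b => ?_, fun h' => ?_⟩, ?_, ?_⟩
  · simp
  · by_cases hh : h' = h
    · subst hh; simp [hf]
    · rw [Pi.single_eq_of_ne (by simpa using hh)]; simp
  · rw [mass_single]
    change ∫ x in Ioi 0, f x ^ 2 = μ
    simp only [hf2]
    rw [integral_const_mul, integral_pow_mul_exp_neg_mul_Ioi 2 h2l, hc2]
    simp [Nat.factorial]
    field_simp
    ring
  · rw [kinetic_single hs]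
    change ∫ x in Ioi 0, g x ^ 2 = _
    simp only [hg2]
    rw [integral_const_mul, integral_add i01 i2', integral_sub i0 i1, integral_const_mul,
      integral_const_mul, integral_pow_mul_exp_neg_mul_Ioi 0 h2l,
      integral_pow_mul_exp_neg_mul_Ioi 1 h2l, integral_pow_mul_exp_neg_mul_Ioi 2 h2l, hc2]
    simp [Nat.factorial]
    field_simp
    ring

theorem MemH1.kinetic_pos (hu : G.MemH1 u) (hconn : G.Connected) [Nonempty H]
    (hm : 0 < G.mass u) : 0 < G.kinetic u := by
  by_contra hcon
  have hk : G.kinetic u = 0 := le_antisymm (not_lt.1 hcon) (G.kinetic_nonneg u)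
  obtain ⟨e, x, hx, hM⟩ := hu.exists_isMax
  have h1 := hu.max_pow_four_le hconn hx hM
  rw [hk, mul_zero] at h1
  have hM0 : |u e x| = 0 := by
    by_contra hne
    have := halfLineMass_pos
    have : 0 < |u e x| := lt_of_le_of_ne (abs_nonneg _) (Ne.symm hne)
    have : 0 < |u e x| ^ 4 * halfLineMass ^ 2 := by positivity
    linarith
  have : G.mass u = 0 := by
    rw [mass_eq]
    refine Finset.sum_eq_zero fun e' _ => ?_
    refine setIntegral_eq_zero_of_forall_eq_zero fun y hy => ?_
    have := hM e' y (G.openEdge_subset e' hy)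
    rw [hM0, abs_nonpos_iff] at this
    rw [this]; ring
  linarith

theorem gnConstant_pos (hconn : G.Connected) [Nonempty H] : 0 < G.gnConstant := by
  have h0 : 0 ≤ G.gnConstant := Real.sInf_nonneg fun _ h => h.1
  refine h0.lt_of_ne fun hzero => ?_
  obtain ⟨u, hu, hm, -⟩ := G.exists_spread one_pos one_pos
  have h1 := hu.sextic_le_gnConstant hconn
  rw [← hzero, zero_mul, zero_mul] at h1
  -- a function with vanishing sextic term is zero almost everywhere
  have hs : G.sextic u = 0 := le_antisymm h1 (G.sextic_nonneg u)
  rw [sextic_eq, Finset.sum_eq_zero_iff_of_nonneg fun e _ => G.edgeSextic_nonneg u e] at hs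
  have : G.mass u = 0 := by
    rw [mass_eq]
    refine Finset.sum_eq_zero fun e he => ?_
    obtain ⟨x, hx, hM⟩ := hu.exists_isMax_edge e
    have hi := (hu.sobolevOn_openEdge e).integrableOn_pow_six (G.measurableSet_openEdge e)
      fun y hy => hM y (G.openEdge_subset e hy)
    have h6 := (integral_eq_zero_iff_of_nonneg (fun y => by
      simp only [Pi.zero_apply]; positivity) hi).1 (hs e he)
    refine integral_eq_zero_of_ae ?_
    filter_upwards [h6] with y hy
    have : u e y = 0 := by simpa using hy
    simp [this]
  rw [hm] at this
  exact one_ne_zero this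

theorem criticalMass_sq (hconn : G.Connected) [Nonempty H] :
    G.criticalMass ^ 2 = 3 / G.gnConstant :=
  Real.sq_sqrt (div_nonneg (by norm_num) (gnConstant_pos hconn).le)

theorem criticalMass_pos (hconn : G.Connected) [Nonempty H] : 0 < G.criticalMass :=
  Real.sqrt_pos.2 (div_pos (by norm_num) (gnConstant_pos hconn))

theorem gnConstant_eq (hconn : G.Connected) [Nonempty H] :
    G.gnConstant = 3 / G.criticalMass ^ 2 := by
  rw [criticalMass_sq hconn]
  have := gnConstant_pos hconn
  field_simp

theorem halfLineMass_le_criticalMass (hconn : G.Connected) [Nonempty H] :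
    halfLineMass ≤ G.criticalMass := by
  refine Real.le_sqrt_of_sq_le ?_
  have := gnConstant_pos hconn
  have := halfLineMass_pos
  rw [le_div_iff₀ (by positivity), mul_comm, ← le_div_iff₀ (by positivity)]
  exact gnConstant_le hconn

/-- Below the critical mass the kinetic term controls the energy. -/
theorem MemH1.kinetic_le_energy (hu : G.MemH1 u) (hconn : G.Connected) [Nonempty H] :
    1 / 2 * (1 - G.mass u ^ 2 / G.criticalMass ^ 2) * G.kinetic u ≤ G.energy u := by
  have h1 := hu.sextic_le_gnConstant hconn
  rw [gnConstant_eq hconn] at h1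
  have e : 3 / G.criticalMass ^ 2 * G.mass u ^ 2 * G.kinetic u =
      3 * (G.mass u ^ 2 / G.criticalMass ^ 2 * G.kinetic u) := by ring
  rw [e] at h1
  unfold energy
  linarith

theorem MemH1.energy_nonneg (hu : G.MemH1 u) (hconn : G.Connected) [Nonempty H]
    (hm : G.mass u ≤ G.criticalMass) : 0 ≤ G.energy u := by
  refine le_trans ?_ (hu.kinetic_le_energy hconn)
  have := G.kinetic_nonneg u
  have h1 : G.mass u ^ 2 / G.criticalMass ^ 2 ≤ 1 :=
    div_le_one_of_le₀ (pow_le_pow_left₀ (G.mass_nonneg u) hm 2) (sq_nonneg _)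
  have := sub_nonneg.2 h1
  positivity

theorem MemH1.energy_pos (hu : G.MemH1 u) (hconn : G.Connected) [Nonempty H]
    (hm0 : 0 < G.mass u) (hm : G.mass u < G.criticalMass) : 0 < G.energy u := by
  refine lt_of_lt_of_le ?_ (hu.kinetic_le_energy hconn)
  have := hu.kinetic_pos hconn hm0
  have h1 : G.mass u ^ 2 / G.criticalMass ^ 2 < 1 := by
    rw [div_lt_one (pow_pos (hm0.trans hm) 2)]
    exact pow_lt_pow_left₀ hm hm0.le two_ne_zero
  have := sub_pos.2 h1
  positivity

/-- Below the critical mass there is no ground state: the infimum `0` is not attained. -/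
theorem not_exists_isGroundState (hconn : G.Connected) [Nonempty H] {μ : ℝ} (hμ0 : 0 < μ)
    (hμ : μ < G.criticalMass) : ¬ ∃ u, G.IsGroundState μ u := by
  rintro ⟨u, ⟨hu, hm⟩, hmin⟩
  have hpos := hu.energy_pos hconn (hm ▸ hμ0) (hm ▸ hμ)
  obtain ⟨v, hv, hvm, hvk⟩ := G.exists_spread hμ0 (l := √(G.energy u / μ)) (by positivity)
  have h1 := hmin v ⟨hv, hvm⟩
  rw [Real.sq_sqrt (by positivity), div_mul_cancel₀ _ hμ0.ne'] at hvk
  have h2 : G.energy v = 1 / 2 * G.kinetic v - 1 / 6 * G.sextic v := rfl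
  have := G.sextic_nonneg v
  linarith

/-- Almost optimal functions, normalised to the critical mass. -/
theorem exists_almost_optimal (hconn : G.Connected) [Nonempty H] {ε : ℝ} (hε : 0 < ε) :
    ∃ u, G.MemH1 u ∧ G.mass u = G.criticalMass ∧ 0 < G.kinetic u ∧
      G.energy u ≤ ε * G.kinetic u := by
  have hμ := criticalMass_pos hconn
  set K' := max 0 (G.gnConstant - 2 * ε * G.gnConstant) with hK'
  have hK'lt : K' < G.gnConstant := by
    have := gnConstant_pos hconn
    refine max_lt this ?_
    have : 0 < 2 * ε * G.gnConstant := by positivity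
    linarith
  have hnot := notMem_of_lt_csInf (s := {K : ℝ | 0 ≤ K ∧ ∀ u, G.MemH1 u →
    G.sextic u ≤ K * G.mass u ^ 2 * G.kinetic u}) hK'lt ⟨0, fun _ h => h.1⟩
  simp only [mem_ofPred_eq, not_and, not_forall, not_le] at hnot
  obtain ⟨u, hu, hlt⟩ := hnot (le_max_left _ _)
  have hm : 0 < G.mass u := by
    refine (G.mass_nonneg u).lt_of_ne fun h0 => ?_
    have := hu.sextic_le_halfLine hconn
    rw [← h0] at this hlt
    simp only [ne_eq, OfNat.ofNat_ne_zero, not_false_eq_true, zero_pow, mul_zero, zero_mul] at *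
    linarith
  have hk := hu.kinetic_pos hconn hm
  set s := G.criticalMass / G.mass u with hs
  have hspos : 0 < s := by positivity
  refine ⟨√s • u, hu.const_smul _, ?_, ?_, ?_⟩
  · rw [mass_sqrt_smul _ _ hspos.le, hs, div_mul_cancel₀ _ hm.ne']
  · rw [hu.kinetic_sqrt_smul hspos.le]; positivity
  · rw [hu.energy_sqrt_smul hspos.le, hu.kinetic_sqrt_smul hspos.le]
    have h1 : (G.gnConstant - 2 * ε * G.gnConstant) * G.mass u ^ 2 * G.kinetic u ≤
        G.sextic u := by
      refine le_trans ?_ hlt.le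
      gcongr
      exact le_max_right _ _
    have h2 : s ^ 2 * (G.gnConstant * G.mass u ^ 2) = 3 := by
      rw [hs, gnConstant_eq hconn]
      field_simp
    have h3 : s ^ 2 * ((G.gnConstant - 2 * ε * G.gnConstant) * G.mass u ^ 2 * G.kinetic u) =
        3 * (1 - 2 * ε) * G.kinetic u := by
      rw [← h2]; ring
    have h4 := mul_le_mul_of_nonneg_left h1 (sq_nonneg s)
    rw [h3] at h4
    have h5 := mul_le_mul_of_nonneg_left h4 hspos.le
    nlinarith
end Constant

end MetricGraph

/-! ### Removing a half-line -/

namespace MetricGraph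

variable {V B H : Type*} {G : MetricGraph V B H} {u : B ⊕ H → ℝ → ℝ}

/-- The restriction of a function to the graph without the half-line `l`. -/
def restrictCompl (l : H) (u : B ⊕ H → ℝ → ℝ) : B ⊕ {h : H // h ≠ l} → ℝ → ℝ :=
  fun e => u (Sum.map id Subtype.val e)

theorem MemH1.restrictCompl (hu : G.MemH1 u) (l : H) :
    (G.removeHalfLine l).MemH1 (restrictCompl l u) := by
  obtain ⟨w, hB, hH⟩ := hu.1.2
  refine ⟨⟨fun e => ?_, w, hB, fun h => hH h⟩, fun e => ?_⟩
  · cases e with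
    | inl b => exact hu.1.1 (Sum.inl b)
    | inr h => exact hu.1.1 (Sum.inr h)
  · cases e with
    | inl b => exact hu.2 (Sum.inl b)
    | inr h => exact hu.2 (Sum.inr h)

theorem Connected.removeHalfLine (hconn : G.Connected) (l : H) :
    (G.removeHalfLine l).Connected := hconn

theorem MemH1.exists_isMax_halfLine (hu : G.MemH1 u) (l : H) :
    ∃ x ∈ G.edge (Sum.inr l), (∀ y ∈ G.edge (Sum.inr l), |u (Sum.inr l) y| ≤ |u (Sum.inr l) x|) ∧
      |u (Sum.inr l) x| ^ 4 / 6 * (halfLineMass - G.edgeMass u (Sum.inr l)) ≤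
        G.edgeEnergy u (Sum.inr l) := by
  obtain ⟨x, hx, hM⟩ := hu.exists_isMax_edge (Sum.inr l)
  exact ⟨x, hx, hM, SobolevOn.energyOn_Ioi_ge (hu.sobolevOn (Sum.inr l)) hx hM⟩

theorem edgeKinetic_le_kinetic [Fintype B] [Fintype H] (G : MetricGraph V B H)
    (u : B ⊕ H → ℝ → ℝ) (e : B ⊕ H) :
    G.edgeKinetic u e ≤ G.kinetic u := by
  rw [kinetic_eq]
  exact Finset.single_le_sum (fun i _ => G.edgeKinetic_nonneg u i) (Finset.mem_univ e)

theorem edgeMass_le_mass [Fintype B] [Fintype H] (G : MetricGraph V B H)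
    (u : B ⊕ H → ℝ → ℝ) (e : B ⊕ H) :
    G.edgeMass u e ≤ G.mass u := by
  rw [mass_eq]
  exact Finset.single_le_sum (fun i _ => G.edgeMass_nonneg u i) (Finset.mem_univ e)

section

variable [Fintype B] [Fintype H] [DecidableEq H]

theorem sum_edges_eq_add (l : H) (f : B ⊕ H → ℝ) :
    ∑ e, f e = f (Sum.inr l) + ∑ e : B ⊕ {h : H // h ≠ l}, f (Sum.map id Subtype.val e) := by
  rw [Fintype.sum_sum_type, Fintype.sum_sum_type,
    Fintype.sum_eq_add_sum_subtype_ne (fun h => f (Sum.inr h)) l]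
  simp only [Sum.map_inl, Sum.map_inr, id]
  ring

theorem mass_eq_add (G : MetricGraph V B H) (u : B ⊕ H → ℝ → ℝ) (l : H) :
    G.mass u = G.edgeMass u (Sum.inr l) + (G.removeHalfLine l).mass (restrictCompl l u) := by
  rw [mass_eq, mass_eq, sum_edges_eq_add l]
  congr 1
  exact Finset.sum_congr rfl fun e _ => by cases e <;> rfl

theorem kinetic_eq_add (G : MetricGraph V B H) (u : B ⊕ H → ℝ → ℝ) (l : H) :
    G.kinetic u = G.edgeKinetic u (Sum.inr l) +
      (G.removeHalfLine l).kinetic (restrictCompl l u) := by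
  rw [kinetic_eq, kinetic_eq, sum_edges_eq_add l]
  congr 1
  exact Finset.sum_congr rfl fun e _ => by cases e <;> rfl

theorem energy_eq_add (G : MetricGraph V B H) (u : B ⊕ H → ℝ → ℝ) (l : H) :
    G.energy u = G.edgeEnergy u (Sum.inr l) +
      (G.removeHalfLine l).energy (restrictCompl l u) := by
  rw [energy_eq, energy_eq, sum_edges_eq_add l]
  congr 1
  exact Finset.sum_congr rfl fun e _ => by cases e <;> rfl

/-- Every half-line can be removed without changing the critical mass, and without making the graph
compact. -/
def RemovableHalfLines (G : MetricGraph V B H) : Prop :=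
  ∀ l : H, Nonempty {h : H // h ≠ l} ∧ (G.removeHalfLine l).criticalMass = G.criticalMass

/-- The energy away from the half-line `l` controls the kinetic term there, because the remaining
graph has the same critical mass. -/
theorem RemovableHalfLines.kinetic_le (hrem : G.RemovableHalfLines) (hconn : G.Connected)
    (hu : G.MemH1 u) (l : H) :
    1 / 2 * (1 - (G.mass u - G.edgeMass u (Sum.inr l)) ^ 2 / G.criticalMass ^ 2) *
      (G.kinetic u - G.edgeKinetic u (Sum.inr l)) ≤
      G.energy u - G.edgeEnergy u (Sum.inr l) := by
  have := (hrem l).1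
  have h := (hu.restrictCompl l).kinetic_le_energy (hconn.removeHalfLine l)
  rw [(hrem l).2] at h
  rw [G.mass_eq_add u l, G.kinetic_eq_add u l, G.energy_eq_add u l]
  simpa only [add_sub_cancel_left] using h

theorem RemovableHalfLines.edgeEnergy_le (hrem : G.RemovableHalfLines) (hconn : G.Connected)
    (hu : G.MemH1 u) (hm : G.mass u ≤ G.criticalMass) (l : H) :
    G.edgeEnergy u (Sum.inr l) ≤ G.energy u := by
  have h := hrem.kinetic_le hconn hu l
  have h1 := G.edgeMass_nonneg u (Sum.inr l)
  have h2 := sub_nonneg.2 (G.edgeMass_le_mass u (Sum.inr l))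
  have h3 := sub_nonneg.2 (G.edgeKinetic_le_kinetic u (Sum.inr l))
  have h4 : (G.mass u - G.edgeMass u (Sum.inr l)) ^ 2 / G.criticalMass ^ 2 ≤ 1 :=
    div_le_one_of_le₀ (pow_le_pow_left₀ h2 (by linarith) 2) (sq_nonneg _)
  have h5 := mul_nonneg (sub_nonneg.2 h4) h3
  linarith

/-- If some half-line carries a mass bounded away from `0` and from its critical mass, then the
energy controls the maximum. -/
theorem RemovableHalfLines.exists_max_pow_four_le (hrem : G.RemovableHalfLines)
    (hconn : G.Connected) {c : ℝ} (hc : 0 < c) (hcm : c ≤ halfLineMass) :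
    ∃ C, 0 < C ∧ ∀ (u : B ⊕ H → ℝ → ℝ) (l : H), G.MemH1 u → G.mass u ≤ G.criticalMass →
      c ≤ G.edgeMass u (Sum.inr l) → G.edgeMass u (Sum.inr l) ≤ halfLineMass - c →
      ∀ e, ∀ x ∈ G.edge e, (∀ e', ∀ y ∈ G.edge e', |u e' y| ≤ |u e x|) →
        |u e x| ^ 4 ≤ C * G.energy u := by
  rcases isEmpty_or_nonempty H with hH | hH
  · exact ⟨1, one_pos, fun u l => (hH.false l).elim⟩
  have hp := halfLineMass_pos
  have hμ := criticalMass_pos hconn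
  have hpμ := halfLineMass_le_criticalMass hconn
  set μ := G.criticalMass with hμdef
  set κ := 1 / 2 * (1 - (μ - c) ^ 2 / μ ^ 2) with hκ
  have hκ0 : 0 < κ := by
    have : (μ - c) ^ 2 / μ ^ 2 < 1 := by
      rw [div_lt_one (by positivity)]
      exact pow_lt_pow_left₀ (by linarith) (by linarith) two_ne_zero
    rw [hκ]; linarith
  refine ⟨12 * μ / halfLineMass ^ 2 * (1 / κ + 2 + 2 * halfLineMass / c), by positivity, ?_⟩
  intro u l hu hm hcl hlc e x hx hM
  obtain ⟨z, hz, hMl, hEl⟩ := hu.exists_isMax_halfLine l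
  set ml := G.edgeMass u (Sum.inr l)
  set Ml := |u (Sum.inr l) z|
  have hE := hrem.kinetic_le hconn hu l
  have hk := sub_nonneg.2 (G.edgeKinetic_le_kinetic u (Sum.inr l))
  have hkin0 := G.edgeKinetic_nonneg u (Sum.inr l)
  have hsq : (G.mass u - ml) ^ 2 / μ ^ 2 ≤ (μ - c) ^ 2 / μ ^ 2 := by
    have := G.edgeMass_le_mass u (Sum.inr l)
    gcongr
  have h1 : κ * (G.kinetic u - G.edgeKinetic u (Sum.inr l)) ≤
      G.energy u - G.edgeEnergy u (Sum.inr l) := by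
    refine le_trans ?_ hE
    refine mul_le_mul_of_nonneg_right ?_ hk
    rw [hκ]; linarith
  have h2 : Ml ^ 4 / 6 * c ≤ G.edgeEnergy u (Sum.inr l) := by
    refine le_trans ?_ hEl
    have : c ≤ halfLineMass - ml := by linarith
    gcongr
  have hκk : 0 ≤ κ * (G.kinetic u - G.edgeKinetic u (Sum.inr l)) := by positivity
  have hM4 : 0 ≤ Ml ^ 4 / 6 * c := by positivity
  have h3 : G.kinetic u - G.edgeKinetic u (Sum.inr l) ≤ G.energy u / κ := by
    rw [le_div_iff₀ hκ0]; linarith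
  have h4 : Ml ^ 4 ≤ 6 * G.energy u / c := by
    rw [le_div_iff₀ hc]; linarith
  have h5 : G.edgeSextic u (Sum.inr l) ≤ 6 * G.energy u / c * halfLineMass := by
    refine (hu.edgeSextic_le hMl).trans ?_
    have : ml ≤ halfLineMass := by linarith
    exact mul_le_mul h4 this (G.edgeMass_nonneg _ _) ((by positivity : 0 ≤ Ml ^ 4).trans h4)
  have h6 : G.edgeKinetic u (Sum.inr l) ≤ 2 * G.energy u + 2 * halfLineMass / c * G.energy u := by
    have h7 : G.edgeEnergy u (Sum.inr l) =
      1 / 2 * G.edgeKinetic u (Sum.inr l) - 1 / 6 * G.edgeSextic u (Sum.inr l) := rfl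
    have h8 : 6 * G.energy u / c * halfLineMass = 3 * (2 * halfLineMass / c * G.energy u) := by
      ring
    linarith
  have h9 : G.kinetic u ≤ (1 / κ + 2 + 2 * halfLineMass / c) * G.energy u := by
    have : G.energy u / κ = 1 / κ * G.energy u := by ring
    linarith
  have h10 := hu.max_pow_four_le hconn hx hM
  have h11 : |u e x| ^ 4 ≤ 12 * μ / halfLineMass ^ 2 * G.kinetic u := by
    rw [div_mul_eq_mul_div, le_div_iff₀ (by positivity)]
    refine h10.trans ?_
    have := G.kinetic_nonneg u
    gcongr
  refine h11.trans ?_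
  rw [mul_assoc]
  gcongr

end

section Core

/-- The mass on the bounded edges. -/
def coreMass [Fintype B] (G : MetricGraph V B H) (u : B ⊕ H → ℝ → ℝ) : ℝ :=
  ∑ b, G.edgeMass u (Sum.inl b)

/-- The mass on the half-lines. -/
def outerMass [Fintype H] (G : MetricGraph V B H) (u : B ⊕ H → ℝ → ℝ) : ℝ :=
  ∑ h, G.edgeMass u (Sum.inr h)

/-- The total length of the bounded edges. -/
def coreLength [Fintype B] (G : MetricGraph V B H) : ℝ := ∑ b, G.len b

theorem coreLength_pos [Fintype B] (G : MetricGraph V B H) [Nonempty B] : 0 < G.coreLength :=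
  Finset.sum_pos (fun b _ => G.len_pos b) Finset.univ_nonempty

theorem coreMass_nonneg [Fintype B] (G : MetricGraph V B H) (u : B ⊕ H → ℝ → ℝ) :
    0 ≤ G.coreMass u :=
  Finset.sum_nonneg fun _ _ => G.edgeMass_nonneg _ _

theorem MemH1.coreMass_le [Fintype B] (hu : G.MemH1 u) {M : ℝ}
    (hM : ∀ e, ∀ x ∈ G.edge e, |u e x| ≤ M) :
    G.coreMass u ≤ M ^ 2 * G.coreLength := by
  rw [coreMass, coreLength, Finset.mul_sum]
  refine Finset.sum_le_sum fun b _ => ?_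
  have h1 : ∫ x in G.openEdge (Sum.inl b), u (Sum.inl b) x ^ 2 ≤
      ∫ _ in G.openEdge (Sum.inl b), M ^ 2 := by
    refine setIntegral_mono_on (hu.sobolevOn_openEdge _).integrableOn_sq
      (integrableOn_const (by simp [openEdge])) (G.measurableSet_openEdge _) fun x hx => ?_
    rw [← sq_abs]
    exact pow_le_pow_left₀ (abs_nonneg _) (hM _ x (G.openEdge_subset _ hx)) 2
  refine h1.trans_eq ?_
  simp [openEdge, (G.len_pos b).le, mul_comm]

theorem outerMass_nonneg [Fintype H] (G : MetricGraph V B H) (u : B ⊕ H → ℝ → ℝ) :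
    0 ≤ G.outerMass u :=
  Finset.sum_nonneg fun _ _ => G.edgeMass_nonneg _ _

theorem mass_eq_core_add_outer [Fintype B] [Fintype H] (G : MetricGraph V B H) (u : B ⊕ H → ℝ → ℝ) :
    G.mass u = G.coreMass u + G.outerMass u := by
  rw [mass_eq, Fintype.sum_sum_type]; rfl

theorem outerMass_sqrt_smul [Fintype H] (G : MetricGraph V B H) (u : B ⊕ H → ℝ → ℝ) {s : ℝ}
    (hs : 0 ≤ s) :
    G.outerMass (√s • u) = s * G.outerMass u := by
  simp only [outerMass, edgeMass_smul, Finset.mul_sum, Real.sq_sqrt hs]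

theorem coreMass_sqrt_smul [Fintype B] (G : MetricGraph V B H) (u : B ⊕ H → ℝ → ℝ) {s : ℝ}
    (hs : 0 ≤ s) :
    G.coreMass (√s • u) = s * G.coreMass u := by
  simp only [coreMass, edgeMass_smul, Finset.mul_sum, Real.sq_sqrt hs]

theorem edgeMass_le_outerMass [Fintype H] (G : MetricGraph V B H) (u : B ⊕ H → ℝ → ℝ) (h : H) :
    G.edgeMass u (Sum.inr h) ≤ G.outerMass u :=
  Finset.single_le_sum (f := fun h => G.edgeMass u (Sum.inr h))
    (fun _ _ => G.edgeMass_nonneg u _) (Finset.mem_univ h)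

theorem MemH1.coreMass_le_of_isMax [Fintype B] (hu : G.MemH1 u) [Nonempty B] {κ : ℝ} (hκ : 0 ≤ κ)
    (h : κ ≤ G.coreMass u) {M : ℝ} (hM : ∀ e, ∀ x ∈ G.edge e, |u e x| ≤ M) :
    (κ / G.coreLength) ^ 2 ≤ M ^ 4 := by
  have hl := G.coreLength_pos
  have h1 : κ / G.coreLength ≤ M ^ 2 := by
    rw [div_le_iff₀ hl]; exact h.trans (hu.coreMass_le hM)
  calc (κ / G.coreLength) ^ 2 ≤ (M ^ 2) ^ 2 := pow_le_pow_left₀ (by positivity) h1 2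
    _ = M ^ 4 := by ring

/-- Mass on the bounded edges forces some kinetic energy: it forces `max |u|` to be large. -/
theorem exists_le_kinetic [Fintype B] [Fintype H] (hconn : G.Connected) [Nonempty B] [Nonempty H]
    {κ : ℝ} (hκ : 0 < κ) :
    ∃ k, 0 < k ∧ ∀ u, G.MemH1 u → G.mass u ≤ G.criticalMass → κ ≤ G.coreMass u →
      k ≤ G.kinetic u := by
  have hp := halfLineMass_pos
  have hμ := criticalMass_pos hconn
  have hl := G.coreLength_pos
  refine ⟨(κ / G.coreLength) ^ 2 * halfLineMass ^ 2 / (12 * G.criticalMass), by positivity, ?_⟩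
  intro u hu hm hcore
  obtain ⟨e, x, hx, hM⟩ := hu.exists_isMax
  have h1 := hu.coreMass_le_of_isMax hκ.le hcore hM
  have h2 := hu.max_pow_four_le hconn hx hM
  have hk := G.kinetic_nonneg u
  rw [div_le_iff₀ (by positivity)]
  calc (κ / G.coreLength) ^ 2 * halfLineMass ^ 2 ≤ |u e x| ^ 4 * halfLineMass ^ 2 := by gcongr
    _ ≤ 12 * G.mass u * G.kinetic u := h2
    _ ≤ 12 * G.criticalMass * G.kinetic u := by gcongr
    _ = G.kinetic u * (12 * G.criticalMass) := by ring

/-- The energy barrier: functions with a prescribed small mass on the half-lines, and some mass on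
the bounded edges, have an energy bounded away from `0`. -/
theorem RemovableHalfLines.exists_barrier [Fintype B] [Fintype H] [DecidableEq H]
    (hrem : G.RemovableHalfLines) (hconn : G.Connected) [Nonempty B] [Nonempty H] {c κ : ℝ}
    (hc : 0 < c) (hcm : c < halfLineMass) (hκ : 0 < κ) :
    ∃ η, 0 < η ∧ ∀ u, G.MemH1 u → G.mass u ≤ G.criticalMass → κ ≤ G.coreMass u →
      G.outerMass u = c → η ≤ G.energy u := by
  have hl := G.coreLength_pos
  have hN : (0 : ℝ) < Fintype.card H := by exact_mod_cast Fintype.card_pos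
  set c₁ := min (c / Fintype.card H) (halfLineMass - c) with hc₁
  have hc₁0 : 0 < c₁ := lt_min (by positivity) (by linarith)
  obtain ⟨C, hC, H1⟩ := hrem.exists_max_pow_four_le hconn hc₁0
    ((min_le_right _ _).trans (by linarith))
  refine ⟨(κ / G.coreLength) ^ 2 / C, by positivity, ?_⟩
  intro u hu hm hcore hout
  obtain ⟨e, x, hx, hM⟩ := hu.exists_isMax
  obtain ⟨l, hl⟩ : ∃ l, c / Fintype.card H ≤ G.edgeMass u (Sum.inr l) := by
    by_contra! hcon
    have : G.outerMass u < ∑ _h : H, c / Fintype.card H :=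
      Finset.sum_lt_sum_of_nonempty Finset.univ_nonempty fun h _ => hcon h
    rw [hout, Finset.sum_const, Finset.card_univ, nsmul_eq_mul, mul_div_cancel₀ _ hN.ne'] at this
    exact lt_irrefl _ this
  have h1 := H1 u l hu hm ((min_le_left _ _).trans hl) (by
    have h2 := G.edgeMass_le_outerMass u l
    have h3 : c₁ ≤ halfLineMass - c := min_le_right _ _
    linarith) e x hx hM
  have h2 := hu.coreMass_le_of_isMax hκ.le hcore hM
  rw [div_le_iff₀ hC]
  linarith

end Core

end MetricGraph

/-! ### Truncated solitons on bounded edges -/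

/-- The profile `cosh^(-1/2)` of the critical soliton. -/
def solitonProfile (x : ℝ) : ℝ := (√(Real.cosh x))⁻¹

theorem solitonProfile_pos (x : ℝ) : 0 < solitonProfile x := by
  have := Real.cosh_pos x
  unfold solitonProfile; positivity

theorem solitonProfile_le_one (x : ℝ) : solitonProfile x ≤ 1 :=
  inv_le_one_of_one_le₀ (Real.one_le_sqrt.2 (Real.one_le_cosh x))

theorem solitonProfile_sq (x : ℝ) : solitonProfile x ^ 2 = (Real.cosh x)⁻¹ := by
  rw [solitonProfile, inv_pow, Real.sq_sqrt (Real.cosh_pos x).le]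

theorem solitonProfile_abs_anti {x y : ℝ} (h : |x| ≤ |y|) :
    solitonProfile y ≤ solitonProfile x := by
  unfold solitonProfile
  have := Real.cosh_pos x
  gcongr
  exact Real.cosh_le_cosh.2 h

theorem hasDerivAt_solitonProfile (x : ℝ) :
    HasDerivAt solitonProfile (-(1 / 2 * (Real.sinh x / Real.cosh x) * solitonProfile x)) x := by
  have hc := Real.cosh_pos x
  have hs : √(Real.cosh x) ≠ 0 := by positivity
  refine (((Real.hasDerivAt_cosh x).sqrt hc.ne').inv hs).congr_deriv ?_
  rw [Real.sq_sqrt hc.le, solitonProfile]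
  field_simp

theorem continuous_solitonProfile : Continuous solitonProfile :=
  continuous_iff_continuousAt.2 fun x => (hasDerivAt_solitonProfile x).continuousAt

theorem integral_inv_cosh_comp {l : ℝ} (hl : 0 < l) (c a b : ℝ) :
    ∫ x in a..b, (Real.cosh (l * (x - c)))⁻¹ =
      (Real.arctan (Real.sinh (l * (b - c))) - Real.arctan (Real.sinh (l * (a - c)))) / l := by
  have hd : ∀ x, HasDerivAt (fun x => Real.arctan (Real.sinh (l * (x - c))) / l)
      (Real.cosh (l * (x - c)))⁻¹ x := by
    intro x
    have h1 : HasDerivAt (fun x => l * (x - c)) l x := by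
      simpa using ((hasDerivAt_id x).sub_const c).const_mul l
    refine ((h1.sinh.arctan).div_const l).congr_deriv ?_
    have := Real.cosh_pos (l * (x - c))
    rw [← Real.cosh_sq']
    field_simp
  rw [intervalIntegral.integral_eq_sub_of_hasDerivAt (fun x _ => hd x)]
  · ring
  · refine Continuous.intervalIntegrable ?_ _ _
    exact (Real.continuous_cosh.comp (by fun_prop)).inv₀ fun x => (Real.cosh_pos _).ne'

theorem integral_soliton_energy_comp {l : ℝ} (hl : 0 < l) (c a b : ℝ) :
    ∫ x in a..b, ((Real.cosh (l * (x - c)))⁻¹ - 2 * (Real.cosh (l * (x - c)))⁻¹ ^ 3) =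
      (Real.sinh (l * (a - c)) / Real.cosh (l * (a - c)) ^ 2 -
        Real.sinh (l * (b - c)) / Real.cosh (l * (b - c)) ^ 2) / l := by
  have hd : ∀ x, HasDerivAt
      (fun x => -(Real.sinh (l * (x - c)) / Real.cosh (l * (x - c)) ^ 2) / l)
      ((Real.cosh (l * (x - c)))⁻¹ - 2 * (Real.cosh (l * (x - c)))⁻¹ ^ 3) x := by
    intro x
    have h1 : HasDerivAt (fun x => l * (x - c)) l x := by
      simpa using ((hasDerivAt_id x).sub_const c).const_mul l
    have hc := Real.cosh_pos (l * (x - c))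
    have h2 : HasDerivAt (fun x => Real.cosh (l * (x - c)) ^ 2)
        (2 * Real.cosh (l * (x - c)) * (Real.sinh (l * (x - c)) * l)) x :=
      (h1.cosh.pow 2).congr_deriv (by simp)
    refine (((h1.sinh.div h2 (by positivity)).neg).div_const l).congr_deriv ?_
    have hsq := Real.cosh_sq (l * (x - c))
    have hsq' : Real.sinh (l * (x - c)) ^ 2 = Real.cosh (l * (x - c)) ^ 2 - 1 := by linarith
    field_simp
    rw [hsq']
    ring
  rw [intervalIntegral.integral_eq_sub_of_hasDerivAt (fun x _ => hd x)]
  · ring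
  · refine Continuous.intervalIntegrable ?_ _ _
    have : Continuous fun x => (Real.cosh (l * (x - c)))⁻¹ :=
      (Real.continuous_cosh.comp (by fun_prop)).inv₀ fun x => (Real.cosh_pos _).ne'
    exact this.sub (continuous_const.mul (this.pow 3))

theorem pow_six_sub_le {x s : ℝ} (hs : 0 ≤ s) (hsx : s ≤ x) (hx : x ≤ 1) :
    x ^ 6 - 6 * s ≤ (x - s) ^ 6 := by
  have h0 : 0 ≤ x - s := by linarith
  have h1 : x - s ≤ 1 := by linarith
  have hx0 : 0 ≤ x := by linarith
  have key : x ^ 6 - (x - s) ^ 6 = s * (x ^ 5 + x ^ 4 * (x - s) + x ^ 3 * (x - s) ^ 2 +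
      x ^ 2 * (x - s) ^ 3 + x * (x - s) ^ 4 + (x - s) ^ 5) := by ring
  have hb : ∀ i j : ℕ, x ^ i * (x - s) ^ j ≤ 1 := fun i j =>
    mul_le_one₀ (pow_le_one₀ hx0 hx) (by positivity) (pow_le_one₀ h0 h1)
  have hsum : x ^ 5 + x ^ 4 * (x - s) + x ^ 3 * (x - s) ^ 2 +
      x ^ 2 * (x - s) ^ 3 + x * (x - s) ^ 4 + (x - s) ^ 5 ≤ 6 := by
    have a0 := hb 5 0
    have a1 := hb 4 1
    have a2 := hb 3 2
    have a3 := hb 2 3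
    have a4 := hb 1 4
    have a5 := hb 0 5
    simp only [pow_zero, pow_one, mul_one, one_mul] at a0 a1 a4 a5
    linarith
  nlinarith [mul_le_mul_of_nonneg_left hsum hs]

theorem exists_large_cube_mul_solitonProfile_le {r δ R : ℝ} (hr : 0 < r) (hδ : 0 < δ) :
    ∃ l, R ≤ l ∧ 1 ≤ l ∧ l ^ 3 * solitonProfile (l * r) ≤ δ := by
  have h1 : ∀ y, 0 ≤ y → solitonProfile y ≤ 2 * Real.exp (-(y / 2)) := by
    intro y hy
    have h2 : Real.exp y / 2 ≤ Real.cosh y := by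
      rw [Real.cosh_eq]; have := Real.exp_pos (-y); linarith
    have h3 : Real.exp (y / 2) / 2 ≤ √(Real.cosh y) := by
      refine Real.le_sqrt_of_sq_le ?_
      have : Real.exp (y / 2) ^ 2 = Real.exp y := by
        rw [← Real.exp_nat_mul]; congr 1; push_cast; ring
      rw [div_pow, this]
      have := Real.exp_pos y
      linarith
    have h4 : (2 * Real.exp (-(y / 2))) = (Real.exp (y / 2) / 2)⁻¹ := by
      rw [Real.exp_neg]; field_simp
    rw [h4]
    exact inv_anti₀ (by positivity) h3
  have h2 := (Real.tendsto_pow_mul_exp_neg_atTop_nhds_zero 3).comp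
    (tendsto_id.atTop_mul_const (show 0 < r / 2 by positivity))
  have h3 : ∀ᶠ l : ℝ in atTop, (l * (r / 2)) ^ 3 * Real.exp (-(l * (r / 2))) <
      δ * (r / 2) ^ 3 / 2 := h2.eventually_lt_const (by positivity)
  obtain ⟨l, hl, hlR, hl1⟩ := (h3.and ((eventually_ge_atTop R).and (eventually_ge_atTop 1))).exists
  refine ⟨l, hlR, hl1, ?_⟩
  have hl0 : 0 < l := by linarith
  have h4 := h1 (l * r) (by positivity)
  have h5 : l ^ 3 * solitonProfile (l * r) ≤ l ^ 3 * (2 * Real.exp (-(l * (r / 2)))) := by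
    rw [← mul_div_assoc]; gcongr
  refine h5.trans ?_
  have hr3 : 0 < (r / 2) ^ 3 := by positivity
  refine le_of_mul_le_mul_right ?_ hr3
  calc l ^ 3 * (2 * Real.exp (-(l * (r / 2)))) * (r / 2) ^ 3
      = 2 * ((l * (r / 2)) ^ 3 * Real.exp (-(l * (r / 2)))) := by ring
    _ ≤ 2 * (δ * (r / 2) ^ 3 / 2) := by gcongr
    _ = δ * (r / 2) ^ 3 := by ring

/-- Highly concentrated solitons of an interval, centred at `c` and shifted so as to vanish at
distance `r` from `c`, have small energy and at most the mass of the soliton of the line, or of the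
half-line if `c` is an end point. -/
theorem exists_truncated_soliton {L c r ε : ℝ} (hL : 0 < L) (hc : c ∈ Icc 0 L) (hr : 0 < r)
    (hcr : ∀ x ∈ Icc 0 L, |x - c| ≤ r) (hε : 0 < ε) :
    ∃ f g : ℝ → ℝ, SobolevOn (Icc 0 L) f g ∧ energyOn (Ioo 0 L) f g ≤ ε ∧
      1 / 4 ≤ ∫ x in Ioo 0 L, f x ^ 2 ∧ ∫ x in Ioo 0 L, f x ^ 2 ≤ 2 * halfLineMass ∧
      (c = 0 ∨ c = L → ∫ x in Ioo 0 L, f x ^ 2 ≤ halfLineMass) ∧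
      (∀ x, |x - c| = r → f x = 0) := by
  obtain ⟨l, hlL, hl1, hls⟩ := exists_large_cube_mul_solitonProfile_le (R := 2 / L) hr
    (show 0 < min (ε / L) (1 / (8 * L)) by positivity)
  have hl0 : 0 < l := by linarith
  set s := solitonProfile (l * r) with hs
  have hs0 : 0 < s := solitonProfile_pos _
  set a := √(√3 / 2 * l) with ha
  have h3 : √3 ^ 2 = 3 := Real.sq_sqrt (by norm_num)
  have h30 : 0 < √3 := by positivity
  have h32 : √3 ≤ 2 := Real.sqrt_le_iff.2 ⟨by norm_num, by norm_num⟩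
  have h31 : 1.7 ≤ √3 := Real.le_sqrt_of_sq_le (by norm_num)
  have ha2 : a ^ 2 = √3 / 2 * l := Real.sq_sqrt (by positivity)
  have ha6 : a ^ 6 = 3 / 4 * l ^ 2 * a ^ 2 := by
    calc a ^ 6 = (a ^ 2) ^ 2 * a ^ 2 := by ring
      _ = √3 ^ 2 * l ^ 2 / 4 * a ^ 2 := by rw [ha2]; ring
      _ = 3 / 4 * l ^ 2 * a ^ 2 := by rw [h3]; ring
  set P : ℝ → ℝ := fun x => solitonProfile (l * (x - c)) with hP
  have hP2 : ∀ x, P x ^ 2 = (Real.cosh (l * (x - c)))⁻¹ := fun x => solitonProfile_sq _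
  have hP0 : ∀ x, 0 < P x := fun x => solitonProfile_pos _
  have hP1 : ∀ x, P x ≤ 1 := fun x => solitonProfile_le_one _
  have hPc : Continuous P := continuous_solitonProfile.comp (by fun_prop)
  have hsP : ∀ x ∈ Icc 0 L, s ≤ P x := fun x hx => solitonProfile_abs_anti (by
    rw [abs_mul, abs_mul, abs_of_pos hr]
    exact mul_le_mul_of_nonneg_left (hcr x hx) (abs_nonneg l))
  -- the truncation `s` makes `f` vanish where `|x - c| = r`; the kinetic term is not affected
  set f : ℝ → ℝ := fun x => a * (P x - s) with hf
  set g : ℝ → ℝ := fun x => a * (-(1 / 2 * (Real.sinh (l * (x - c)) / Real.cosh (l * (x - c))) *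
    P x) * l) with hg
  have hfg : ∀ x, HasDerivAt f (g x) x := by
    intro x
    have h1 : HasDerivAt (fun x => l * (x - c)) l x := by
      simpa using ((hasDerivAt_id x).sub_const c).const_mul l
    exact (((hasDerivAt_solitonProfile _).comp x h1).sub_const s).const_mul a
  have hfc : Continuous f := by rw [hf]; fun_prop
  have hgc : Continuous g := by
    have h1 : Continuous fun x => Real.sinh (l * (x - c)) / Real.cosh (l * (x - c)) :=
      (Real.continuous_sinh.comp (by fun_prop)).div (Real.continuous_cosh.comp (by fun_prop))
        fun x => (Real.cosh_pos _).ne'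
    rw [hg]; fun_prop
  have hmem : ∀ w : ℝ → ℝ, Continuous w → MemLp w 2 (volume.restrict (Icc 0 L)) := by
    intro w hw
    rw [memLp_two_iff_integrable_sq hw.aestronglyMeasurable]
    exact (hw.pow 2).continuousOn.integrableOn_Icc
  have hII : ∀ w : ℝ → ℝ, ∫ x in Ioo 0 L, w x = ∫ x in (0 : ℝ)..L, w x := fun w => by
    rw [intervalIntegral.integral_of_le hL.le, integral_Ioc_eq_integral_Ioo]
  have hci : ∀ w : ℝ → ℝ, Continuous w → IntervalIntegrable w volume 0 L := fun w hw =>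
    hw.intervalIntegrable _ _
  have hcosh : Continuous fun x => (Real.cosh (l * (x - c)))⁻¹ :=
    (Real.continuous_cosh.comp (by fun_prop)).inv₀ fun x => (Real.cosh_pos _).ne'
  have hAL : 0 ≤ Real.sinh (l * (L - c)) :=
    Real.sinh_nonneg_iff.2 (mul_nonneg hl0.le (sub_nonneg.2 hc.2))
  have hA0 : Real.sinh (l * (0 - c)) ≤ 0 :=
    Real.sinh_nonpos_iff.2 (mul_nonpos_of_nonneg_of_nonpos hl0.le (by linarith [hc.1]))
  have hls' : l * s ≤ 1 / (8 * L) := by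
    refine le_trans ?_ (hls.trans (min_le_right _ _))
    have : l ≤ l ^ 3 := le_self_pow₀ hl1 (by norm_num)
    gcongr
  have hmass_le : ∫ x in Ioo 0 L, f x ^ 2 ≤ √3 / 2 * (Real.arctan (Real.sinh (l * (L - c))) -
      Real.arctan (Real.sinh (l * (0 - c)))) := by
    rw [hII]
    have h1 : ∫ x in (0 : ℝ)..L, f x ^ 2 ≤
        ∫ x in (0 : ℝ)..L, a ^ 2 * (Real.cosh (l * (x - c)))⁻¹ := by
      refine intervalIntegral.integral_mono_on hL.le (hci _ (hfc.pow 2))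
        (hci _ (continuous_const.mul hcosh)) fun x hx => ?_
      rw [← hP2, hf]
      simp only [mul_pow]
      have := hsP x hx
      gcongr
      linarith
    rw [intervalIntegral.integral_const_mul, integral_inv_cosh_comp hl0, ha2] at h1
    refine h1.trans_eq ?_
    field_simp
  refine ⟨f, g, sobolevOn_of_hasDerivAt hfg hgc (hmem f hfc) (hmem g hgc), ?_, ?_, ?_, ?_, ?_⟩
  · have hE : energyOn (Ioo 0 L) f g =
        ∫ x in (0 : ℝ)..L, (1 / 2 * g x ^ 2 - 1 / 6 * f x ^ 6) := by
      have i1 := hci (fun x => 1 / 2 * g x ^ 2) (by fun_prop)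
      have i2 := hci (fun x => 1 / 6 * f x ^ 6) (by fun_prop)
      rw [energyOn, hII, hII, intervalIntegral.integral_sub i1 i2,
        intervalIntegral.integral_const_mul, intervalIntegral.integral_const_mul]
    have hle : energyOn (Ioo 0 L) f g ≤ ∫ x in (0 : ℝ)..L, a ^ 2 * l ^ 2 / 8 *
        (((Real.cosh (l * (x - c)))⁻¹ - 2 * (Real.cosh (l * (x - c)))⁻¹ ^ 3) + 6 * s) := by
      rw [hE]
      refine intervalIntegral.integral_mono_on hL.le
        (hci _ ((continuous_const.mul (hgc.pow 2)).sub (continuous_const.mul (hfc.pow 6))))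
        (hci _ (continuous_const.mul ((hcosh.sub (continuous_const.mul (hcosh.pow 3))).add
          continuous_const))) fun x hx => ?_
      have hch := Real.cosh_pos (l * (x - c))
      have hsinh : (Real.sinh (l * (x - c)) / Real.cosh (l * (x - c))) ^ 2 =
          1 - (P x ^ 2) ^ 2 := by
        have := Real.cosh_sq (l * (x - c))
        rw [hP2, div_pow, show Real.sinh (l * (x - c)) ^ 2 = Real.cosh (l * (x - c)) ^ 2 - 1 by
          linarith]
        field_simp
      have hg2 : g x ^ 2 = a ^ 2 * l ^ 2 / 4 * (1 - (P x ^ 2) ^ 2) * P x ^ 2 := by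
        rw [← hsinh, hg]; ring
      have hf6 : a ^ 6 * (P x ^ 6 - 6 * s) ≤ f x ^ 6 := by
        rw [hf]
        simp only [mul_pow]
        exact mul_le_mul_of_nonneg_left (pow_six_sub_le hs0.le (hsP x hx) (hP1 x))
          (by positivity)
      rw [ha6] at hf6
      rw [hg2, ← hP2]
      nlinarith
    refine hle.trans ?_
    have i3 := hci (fun x => (Real.cosh (l * (x - c)))⁻¹ - 2 * (Real.cosh (l * (x - c)))⁻¹ ^ 3)
      (hcosh.sub (continuous_const.mul (hcosh.pow 3)))
    rw [intervalIntegral.integral_const_mul, intervalIntegral.integral_add i3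
      (hci _ continuous_const), integral_soliton_energy_comp hl0,
      intervalIntegral.integral_const, ha2]
    have hneg : (Real.sinh (l * (0 - c)) / Real.cosh (l * (0 - c)) ^ 2 -
        Real.sinh (l * (L - c)) / Real.cosh (l * (L - c)) ^ 2) / l ≤ 0 := by
      have h1 : Real.sinh (l * (0 - c)) / Real.cosh (l * (0 - c)) ^ 2 ≤ 0 :=
        div_nonpos_of_nonpos_of_nonneg hA0 (sq_nonneg _)
      have h2 : 0 ≤ Real.sinh (l * (L - c)) / Real.cosh (l * (L - c)) ^ 2 :=
        div_nonneg hAL (sq_nonneg _)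
      exact div_nonpos_of_nonpos_of_nonneg (by linarith) hl0.le
    have hεs : l ^ 3 * s * L ≤ ε := by
      have := hls.trans (min_le_left _ _)
      rwa [le_div_iff₀ hL] at this
    rw [smul_eq_mul, sub_zero]
    calc √3 / 2 * l * l ^ 2 / 8 * (_ + L * (6 * s))
        ≤ √3 / 2 * l * l ^ 2 / 8 * (0 + L * (6 * s)) := by gcongr
      _ = 3 * √3 / 8 * (l ^ 3 * s * L) := by ring
      _ ≤ 1 * (l ^ 3 * s * L) := by
          have : 3 * √3 / 8 ≤ 1 := by linarith
          gcongr
      _ ≤ ε := by linarith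
  · rw [hII]
    have h1 : ∫ x in (0 : ℝ)..L, a ^ 2 * ((Real.cosh (l * (x - c)))⁻¹ - 2 * s) ≤
        ∫ x in (0 : ℝ)..L, f x ^ 2 := by
      refine intervalIntegral.integral_mono_on hL.le
        (hci _ (continuous_const.mul (hcosh.sub continuous_const)))
        (hci _ (hfc.pow 2)) fun x hx => ?_
      rw [← hP2, hf]
      simp only [mul_pow]
      have := mul_le_mul_of_nonneg_right (hP1 x) hs0.le
      refine mul_le_mul_of_nonneg_left ?_ (sq_nonneg a)
      nlinarith [sq_nonneg s]
    rw [intervalIntegral.integral_const_mul, intervalIntegral.integral_sub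
      (hci _ hcosh) (hci _ continuous_const), integral_inv_cosh_comp hl0,
      intervalIntegral.integral_const, ha2, smul_eq_mul, sub_zero] at h1
    refine le_trans ?_ h1
    have hpi4 : Real.pi / 4 ≤ Real.arctan (Real.sinh (l * (L - c))) -
        Real.arctan (Real.sinh (l * (0 - c))) := by
      have hlL' : 2 ≤ l * L := by rwa [div_le_iff₀ hL] at hlL
      have hone : ∀ y, 1 ≤ y → Real.pi / 4 ≤ Real.arctan (Real.sinh y) := fun y hy => by
        rw [← Real.arctan_one]
        exact Real.arctan_strictMono.monotone
          (hy.trans (Real.self_le_sinh_iff.2 (by linarith)))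
      have e1 : Real.arctan (Real.sinh (l * (0 - c))) = -Real.arctan (Real.sinh (l * c)) := by
        rw [← Real.arctan_neg, ← Real.sinh_neg]; congr 2; ring
      have p1 : 0 ≤ Real.arctan (Real.sinh (l * c)) := Real.arctan_nonneg.2
        (Real.sinh_nonneg_iff.2 (mul_nonneg hl0.le hc.1))
      have p2 : 0 ≤ Real.arctan (Real.sinh (l * (L - c))) := Real.arctan_nonneg.2 hAL
      rw [e1]
      by_cases hcc : 1 ≤ l * c
      · have := hone _ hcc; linarith
      · have := hone (l * (L - c)) (by linarith [not_le.1 hcc])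
        linarith
    have hpi := Real.pi_gt_three
    have hsl : l * s * L ≤ 1 / 8 := by
      calc l * s * L ≤ 1 / (8 * L) * L := by gcongr
        _ = 1 / 8 := by field_simp
    set D := Real.arctan (Real.sinh (l * (L - c))) - Real.arctan (Real.sinh (l * (0 - c)))
    have e2 : √3 / 2 * l * (D / l - L * (2 * s)) = √3 / 2 * D - √3 * (l * s * L) := by
      field_simp
    rw [e2]
    nlinarith
  · refine hmass_le.trans ?_
    have h1 := (Real.arctan_lt_pi_div_two (Real.sinh (l * (L - c)))).le
    have h2 := (Real.neg_pi_div_two_lt_arctan (Real.sinh (l * (0 - c)))).le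
    unfold halfLineMass
    nlinarith
  · intro hcc
    refine hmass_le.trans ?_
    have h1 := (Real.arctan_lt_pi_div_two (Real.sinh (l * (L - c)))).le
    have h2 := (Real.neg_pi_div_two_lt_arctan (Real.sinh (l * (0 - c)))).le
    unfold halfLineMass
    rcases hcc with rfl | rfl
    · simp only [sub_self, mul_zero, Real.sinh_zero, Real.arctan_zero] at *
      nlinarith
    · simp only [sub_self, mul_zero, Real.sinh_zero, Real.arctan_zero] at *
      nlinarith
  · intro x hx
    have : P x = s := by
      refine le_antisymm (solitonProfile_abs_anti ?_) (solitonProfile_abs_anti ?_) <;>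
        rw [abs_mul, abs_mul, hx, abs_of_pos hr]
    simp [hf, this]

namespace MetricGraph

variable {V B H : Type*} {G : MetricGraph V B H} {u : B ⊕ H → ℝ → ℝ}

/-- The edge `b` has a tip at its initial point: no other edge end is attached to that vertex. -/
def IsTipSrc (G : MetricGraph V B H) (b : B) : Prop :=
  (∀ b', b' ≠ b → G.src b' ≠ G.src b) ∧ (∀ b', G.tgt b' ≠ G.src b) ∧ ∀ h, G.foot h ≠ G.src b

/-- The edge `b` has a tip at its final point: no other edge end is attached to that vertex. -/
def IsTipTgt (G : MetricGraph V B H) (b : B) : Prop :=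
  (∀ b', b' ≠ b → G.tgt b' ≠ G.tgt b) ∧ (∀ b', G.src b' ≠ G.tgt b) ∧ ∀ h, G.foot h ≠ G.tgt b

theorem memH1_single_of_zero [DecidableEq (B ⊕ H)] {b : B} {f g : ℝ → ℝ}
    (hs : SobolevOn (G.edge (Sum.inl b)) f g) (h0 : f 0 = 0) (hL : f (G.len b) = 0) :
    G.MemH1 (Pi.single (Sum.inl b) f) := by
  refine memH1_of_sobolevOn (sobolevOn_single hs) ⟨0, fun b' => ?_, fun h => by simp⟩
  by_cases hb : b' = b
  · subst hb; simp [h0, hL]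
  · rw [Pi.single_eq_of_ne (by simpa using hb)]; simp

theorem memH1_single_of_isTipSrc [DecidableEq (B ⊕ H)] {b : B} {f g : ℝ → ℝ}
    (hs : SobolevOn (G.edge (Sum.inl b)) f g) (ht : G.IsTipSrc b) (hL : f (G.len b) = 0) :
    G.MemH1 (Pi.single (Sum.inl b) f) := by
  classical
  refine memH1_of_sobolevOn (sobolevOn_single hs) ⟨Pi.single (G.src b) (f 0), fun b' => ?_,
    fun h => by simp [Pi.single_eq_of_ne (ht.2.2 h)]⟩
  rw [Pi.single_eq_of_ne (ht.2.1 b')]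
  by_cases hb : b' = b
  · subst hb; simp [hL]
  · rw [Pi.single_eq_of_ne (by simpa using hb), Pi.single_eq_of_ne (ht.1 b' hb)]; simp

theorem memH1_single_of_isTipTgt [DecidableEq (B ⊕ H)] {b : B} {f g : ℝ → ℝ}
    (hs : SobolevOn (G.edge (Sum.inl b)) f g) (ht : G.IsTipTgt b) (h0 : f 0 = 0) :
    G.MemH1 (Pi.single (Sum.inl b) f) := by
  classical
  refine memH1_of_sobolevOn (sobolevOn_single hs) ⟨Pi.single (G.tgt b) (f (G.len b)), fun b' => ?_,
    fun h => by simp [Pi.single_eq_of_ne (ht.2.2 h)]⟩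
  rw [Pi.single_eq_of_ne (ht.2.1 b')]
  by_cases hb : b' = b
  · subst hb; simp [h0]
  · rw [Pi.single_eq_of_ne (by simpa using hb), Pi.single_eq_of_ne (ht.1 b' hb)]; simp

variable [Fintype B] [Fintype H]

/-- A function of small energy on one bounded edge, of mass at most the critical one, can be scaled
up to the critical mass without increasing its energy much. -/
theorem exists_core_competitor_of_single (hconn : G.Connected) [Nonempty H]
    [DecidableEq (B ⊕ H)] {b : B} {f g : ℝ → ℝ} {η : ℝ}
    (hu : G.MemH1 (Pi.single (Sum.inl b) f)) (hs : SobolevOn (G.edge (Sum.inl b)) f g)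
    (hE : energyOn (Ioo 0 (G.len b)) f g ≤ η / (8 * G.criticalMass)) (hη : 0 < η)
    (hm : 1 / 4 ≤ ∫ x in Ioo 0 (G.len b), f x ^ 2)
    (hm' : ∫ x in Ioo 0 (G.len b), f x ^ 2 ≤ G.criticalMass) :
    ∃ u, G.MemH1 u ∧ G.mass u = G.criticalMass ∧ G.outerMass u = 0 ∧ G.energy u < η := by
  have hμ := criticalMass_pos hconn
  set m := ∫ x in Ioo 0 (G.len b), f x ^ 2 with hmdef
  have hm0 : 0 < m := by linarith
  set w : B ⊕ H → ℝ → ℝ := Pi.single (Sum.inl b) f with hw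
  have hmass : G.mass w = m := G.mass_single _ _
  set s := G.criticalMass / m with hsdef
  have hs1 : 1 ≤ s := (one_le_div hm0).2 hm'
  have hs0 : 0 ≤ s := by linarith
  refine ⟨√s • w, hu.const_smul _, ?_, ?_, ?_⟩
  · rw [mass_sqrt_smul _ _ hs0, hmass, hsdef, div_mul_cancel₀ _ hm0.ne']
  · rw [outerMass_sqrt_smul _ _ hs0, outerMass, Finset.sum_eq_zero fun h _ => ?_, mul_zero]
    rw [hw, edgeMass_single]; simp
  · rw [hu.energy_sqrt_smul hs0]
    have h1 : G.energy w ≤ η / (8 * G.criticalMass) := by rw [energy_single hs]; exact hE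
    have h2 : G.energy w = 1 / 2 * G.kinetic w - 1 / 6 * G.sextic w := rfl
    have h3 : s * (1 / 6 * G.sextic w) ≤ s ^ 3 * (1 / 6 * G.sextic w) := by
      have := G.sextic_nonneg w
      have : s ≤ s ^ 3 := le_self_pow₀ hs1 (by norm_num)
      gcongr
    have h4 : s ≤ 4 * G.criticalMass := by
      rw [hsdef, div_le_iff₀ hm0]; nlinarith
    calc s * (1 / 2 * G.kinetic w) - s ^ 3 * (1 / 6 * G.sextic w) ≤ s * G.energy w := by
          rw [h2]; linarith
      _ ≤ s * (η / (8 * G.criticalMass)) := by gcongr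
      _ ≤ 4 * G.criticalMass * (η / (8 * G.criticalMass)) := by gcongr
      _ = η / 2 := by field_simp; ring
      _ < η := by linarith

/-- On a graph with a tip, half-solitons concentrated at the tip have small energy. -/
theorem exists_core_competitor_of_isTip (hconn : G.Connected) [Nonempty H] {b : B}
    (ht : G.IsTipSrc b ∨ G.IsTipTgt b) {η : ℝ} (hη : 0 < η) :
    ∃ u, G.MemH1 u ∧ G.mass u = G.criticalMass ∧ G.outerMass u = 0 ∧ G.energy u < η := by
  classical
  have hμ := criticalMass_pos hconn
  have hle := halfLineMass_le_criticalMass hconn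
  have hL := G.len_pos b
  have hη' : 0 < η / (8 * G.criticalMass) := by positivity
  rcases ht with ht | ht
  · obtain ⟨f, g, hs, hE, hm, -, hm', h0⟩ := exists_truncated_soliton (c := 0) hL
      (left_mem_Icc.2 hL.le) hL (fun x hx => by rw [sub_zero, abs_of_nonneg hx.1]; exact hx.2) hη'
    exact exists_core_competitor_of_single hconn (memH1_single_of_isTipSrc hs ht
      (h0 _ (by rw [sub_zero, abs_of_pos hL]))) hs hE hη hm ((hm' (Or.inl rfl)).trans hle)
  · obtain ⟨f, g, hs, hE, hm, -, hm', h0⟩ := exists_truncated_soliton (c := G.len b) hL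
      (right_mem_Icc.2 hL.le) hL (fun x hx => by
        rw [abs_sub_comm, abs_of_nonneg (sub_nonneg.2 hx.2)]; linarith [hx.1]) hη'
    exact exists_core_competitor_of_single hconn (memH1_single_of_isTipTgt hs ht
      (h0 _ (by rw [zero_sub, abs_neg, abs_of_pos hL]))) hs hE hη hm ((hm' (Or.inr rfl)).trans hle)

/-- If the critical mass is at least that of the line, solitons concentrated at the middle of a
bounded edge have small energy. -/
theorem exists_core_competitor_of_le (hconn : G.Connected) [Nonempty H] [hB : Nonempty B]
    (hle : 2 * halfLineMass ≤ G.criticalMass) {η : ℝ} (hη : 0 < η) :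
    ∃ u, G.MemH1 u ∧ G.mass u = G.criticalMass ∧ G.outerMass u = 0 ∧ G.energy u < η := by
  classical
  obtain ⟨b⟩ := hB
  have hμ := criticalMass_pos hconn
  have hL := G.len_pos b
  obtain ⟨f, g, hs, hE, hm, hm', -, h0⟩ := exists_truncated_soliton (c := G.len b / 2)
    (r := G.len b / 2) hL ⟨by linarith, by linarith⟩ (by linarith)
    (fun x hx => abs_le.2 ⟨by linarith [hx.1], by linarith [hx.2]⟩)
    (show 0 < η / (8 * G.criticalMass) by positivity)
  exact exists_core_competitor_of_single hconn (memH1_single_of_zero hs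
    (h0 _ (by rw [zero_sub, abs_neg, abs_of_pos (by linarith)]))
    (h0 _ (by rw [abs_of_pos (by linarith)]; ring))) hs hE hη hm (hm'.trans hle)

end MetricGraph

/-! ### Almost optimal functions on graphs without tips -/

namespace SobolevOn

variable {S : Set ℝ} {u g : ℝ → ℝ} {M : ℝ}

/-- Four consecutive passes. -/
theorem sum_calibration_sub_le [hS : S.OrdConnected] (h : SobolevOn S u g)
    (hM : ∀ x ∈ S, |u x| ≤ M) {a b c d e : ℝ} (ha : a ∈ S) (he : e ∈ S) (hab : a ≤ b)
    (hbc : b ≤ c) (hcd : c ≤ d) (hde : d ≤ e) :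
    |calibration M (u b) - calibration M (u a)| + |calibration M (u c) - calibration M (u b)| +
      |calibration M (u d) - calibration M (u c)| + |calibration M (u e) - calibration M (u d)| ≤
      ∫ t in S, calibDensity M u g t := by
  have hb : b ∈ S := hS.out ha he ⟨hab, by linarith⟩
  have hc : c ∈ S := hS.out ha he ⟨by linarith, by linarith⟩
  have hd : d ∈ S := hS.out ha he ⟨by linarith, by linarith⟩
  have h1 := h.abs_calibration_sub_le hM ha hb hab
  have h2 := h.abs_calibration_sub_le hM hb hc hbc
  have h3 := h.abs_calibration_sub_le hM hc hd hcd
  have h4 := h.abs_calibration_sub_le hM hd he hde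
  have hi := h.integrableOn_calibDensity hS.measurableSet hM
  have hae : a ≤ e := by linarith
  have h5 := h.integral_calibDensity_mono hS.measurableSet hM (T := Ioc a e)
    fun t ht => hS.out ha he ⟨ht.1.le, ht.2⟩
  have hii : ∀ {x y}, x ∈ S → y ∈ S → x ≤ y →
      IntervalIntegrable (calibDensity M u g) volume x y := fun hx hy hxy =>
    (intervalIntegrable_iff_integrableOn_Ioc_of_le hxy).2
      (hi.mono_set fun t ht => hS.out hx hy ⟨ht.1.le, ht.2⟩)
  rw [← intervalIntegral.integral_of_le hab] at h1
  rw [← intervalIntegral.integral_of_le hbc] at h2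
  rw [← intervalIntegral.integral_of_le hcd] at h3
  rw [← intervalIntegral.integral_of_le hde] at h4
  rw [← intervalIntegral.integral_of_le hae,
    ← intervalIntegral.integral_add_adjacent_intervals (hii ha hb hab) (hii hb he (by linarith)),
    ← intervalIntegral.integral_add_adjacent_intervals (hii hb hc hbc) (hii hc he (by linarith)),
    ← intervalIntegral.integral_add_adjacent_intervals (hii hc hd hcd) (hii hd he hde)] at h5
  linarith

/-- On an interval of length `r` a function takes a value bounded by its mean square. -/
theorem exists_abs_le_of_mass (h : SobolevOn S u g) {p r d : ℝ}
    (hr : 0 ≤ r) (hd : 0 ≤ d) (hsub : Icc p (p + r) ⊆ S) (hmass : ∫ x in S, u x ^ 2 < d ^ 2 * r) :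
    ∃ y ∈ Icc p (p + r), |u y| ≤ d := by
  by_contra! hcon
  have h1 : ∫ _ in Icc p (p + r), d ^ 2 ≤ ∫ x in Icc p (p + r), u x ^ 2 := by
    refine setIntegral_mono_on (integrableOn_const (by simp)) (h.integrableOn_sq.mono_set hsub)
      measurableSet_Icc fun x hx => ?_
    rw [← sq_abs (u x)]
    exact pow_le_pow_left₀ hd (hcon x hx).le 2
  have h2 : ∫ x in Icc p (p + r), u x ^ 2 ≤ ∫ x in S, u x ^ 2 :=
    setIntegral_mono_set h.integrableOn_sq (ae_of_all _ fun x => sq_nonneg _) (ae_of_all _ hsub)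
  rw [setIntegral_const] at h1
  simp only [measureReal_def, Real.volume_Icc, add_sub_cancel_left, ENNReal.toReal_ofReal hr,
    smul_eq_mul] at h1
  linarith

end SobolevOn

theorem add_le_sum_of_ne {ι : Type*} [Fintype ι] {f : ι → ℝ} (hf : ∀ i, 0 ≤ f i) {i j : ι}
    (hij : i ≠ j) : f i + f j ≤ ∑ k, f k := by
  classical
  rw [← Finset.sum_pair hij]
  exact Finset.sum_le_sum_of_subset_of_nonneg (Finset.subset_univ _) fun k _ _ => hf k

theorem calibration_abs_sub_le (M a b : ℝ) :
    calibration M |a| - calibration M |b| ≤ |calibration M a - calibration M b| := by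
  rw [← abs_calibration, ← abs_calibration]
  exact abs_sub_abs_le_abs_sub _ _

namespace MetricGraph

variable {V B H : Type*} {G : MetricGraph V B H} {u : B ⊕ H → ℝ → ℝ} {M : ℝ}

theorem MemH1.sum_calibration_sub_le (hu : G.MemH1 u) {e : B ⊕ H}
    (hM : ∀ x ∈ G.edge e, |u e x| ≤ M) {t₀ t₁ t₂ t₃ t₄ : ℝ} (h0 : t₀ ∈ G.edge e)
    (h4 : t₄ ∈ G.edge e) (h01 : t₀ ≤ t₁) (h12 : t₁ ≤ t₂) (h23 : t₂ ≤ t₃) (h34 : t₃ ≤ t₄) :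
    |calibration M (u e t₁) - calibration M (u e t₀)| +
      |calibration M (u e t₂) - calibration M (u e t₁)| +
      |calibration M (u e t₃) - calibration M (u e t₂)| +
      |calibration M (u e t₄) - calibration M (u e t₃)| ≤ G.edgeCost M u e := by
  unfold edgeCost
  rw [← setIntegral_congr_set (G.edge_ae_eq e)]
  exact (hu.sobolevOn e).sum_calibration_sub_le hM h0 h4 h01 h12 h23 h34

theorem MemH1.two_passes (hu : G.MemH1 u) {e : B ⊕ H}
    (hM : ∀ x ∈ G.edge e, |u e x| ≤ M) {y x z : ℝ} (hy : y ∈ G.edge e)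
    (hz : z ∈ G.edge e) (hyx : y ≤ x) (hxz : x ≤ z) :
    2 * calibration M |u e x| - calibration M |u e y| - calibration M |u e z| ≤
      G.edgeCost M u e := by
  have h := hu.sum_calibration_sub_le hM hy hz hyx hxz le_rfl le_rfl
  have h1 := calibration_abs_sub_le M (u e x) (u e y)
  have h2 := calibration_abs_sub_le M (u e x) (u e z)
  rw [abs_sub_comm] at h2
  simp only [sub_self, abs_zero] at h
  linarith

variable [Fintype B] [Fintype H]

/-- On a graph without tips, a function taking values at most `d` on every interval of length `r`
makes two passes from any point of a bounded edge down to `d`. If the point is within distance `r`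
of an end point, the second pass may leave the edge there, or continue on the same edge if that is
a loop. -/
theorem MemH1.two_passes_of_no_tip (hu : G.MemH1 u)
    (hM : ∀ e, ∀ x ∈ G.edge e, |u e x| ≤ M) (hsrc : ∀ b, ¬ G.IsTipSrc b)
    (htgt : ∀ b, ¬ G.IsTipTgt b) {r d : ℝ} (hr : 0 < r) (hlen : ∀ b, 4 * r ≤ G.len b)
    (hsmall : ∀ b p, 0 ≤ p → p + r ≤ G.len b → ∃ y ∈ Icc p (p + r), |u (Sum.inl b) y| ≤ d)
    (hfoot : ∀ h, |u (Sum.inr h) 0| ≤ d) {b : B} {x : ℝ} (hx : x ∈ G.edge (Sum.inl b)) :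
    2 * calibration M |u (Sum.inl b) x| - 2 * calibration M d ≤ ∑ e, G.edgeCost M u e := by
  obtain ⟨w, hB, hH⟩ := hu.1.2
  have hcost : ∀ e, 0 ≤ G.edgeCost M u e := fun e => edgeCost_nonneg (hM e)
  have hsingle : G.edgeCost M u (Sum.inl b) ≤ ∑ e, G.edgeCost M u e :=
    Finset.single_le_sum (fun e _ => hcost e) (Finset.mem_univ _)
  have hmono : ∀ {s : ℝ}, |s| ≤ d → calibration M |s| ≤ calibration M d := fun hs =>
    calibration_mono M hs
  have hl := hlen b
  -- the pass from the vertex value into another edge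
  have hother : ∀ b', b' ≠ b → ∀ z, (G.src b' = z ∨ G.tgt b' = z) →
      calibration M |w z| - calibration M d + G.edgeCost M u (Sum.inl b) ≤
        ∑ e, G.edgeCost M u e := by
    intro b' hb' z hz
    obtain ⟨y, hy, hyd⟩ := hsmall b' 0 le_rfl (by linarith [hlen b'])
    rw [zero_add] at hy
    have hy' : y ∈ G.edge (Sum.inl b') := ⟨hy.1, by linarith [hy.2, hlen b']⟩
    have h1 : calibration M |w z| - calibration M |u (Sum.inl b') y| ≤
        G.edgeCost M u (Sum.inl b') := by
      refine (calibration_abs_sub_le _ _ _).trans ?_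
      rcases hz with hz | hz
      · rw [← hz, ← (hB b').1]
        exact hu.calibration_sub_le (hM _) hy' (G.zero_mem_edge _)
      · rw [← hz, ← (hB b').2]
        exact hu.calibration_sub_le (hM _) hy' (G.len_mem_edge _)
    have h2 := add_le_sum_of_ne hcost (i := Sum.inl b') (j := Sum.inl b) (by simpa using hb')
    have h3 := hmono hyd
    linarith
  rcases lt_or_ge x r with hxr | hxr
  · -- the point is close to the initial vertex
    obtain ⟨y, hy, hyd⟩ := hsmall b (G.len b - r) (by linarith) (by linarith)
    rw [sub_add_cancel] at hy
    have hy' : y ∈ G.edge (Sum.inl b) := ⟨by linarith [hy.1], hy.2⟩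
    have h2p := hu.two_passes (hM _) (G.zero_mem_edge (Sum.inl b)) hy' hx.1
      (by linarith [hy.1])
    rw [(hB b).1] at h2p
    have h3 := hmono hyd
    have hns := hsrc b
    unfold IsTipSrc at hns
    rw [not_and_or, not_and_or] at hns
    push Not at hns
    rcases hns with ⟨b', hb', hbs⟩ | ⟨b', hbs⟩ | ⟨h, hh⟩
    · have := hother b' hb' _ (Or.inl hbs)
      linarith
    · by_cases hb' : b' = b
      · -- a loop, which is entered again at its final point
        subst hb'
        obtain ⟨z, hz, hzd⟩ := hsmall b' r hr.le (by linarith)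
        have h4 := hu.sum_calibration_sub_le (hM _) (G.zero_mem_edge (Sum.inl b'))
          (G.len_mem_edge b') hx.1 (show x ≤ z by linarith [hz.1])
          (show z ≤ y by linarith [hz.2, hy.1]) hy.2
        have c1 := calibration_abs_sub_le M (u (Sum.inl b') x) (u (Sum.inl b') 0)
        have c2 := calibration_abs_sub_le M (u (Sum.inl b') x) (u (Sum.inl b') z)
        have c3 := calibration_abs_sub_le M (u (Sum.inl b') (G.len b')) (u (Sum.inl b') y)
        rw [abs_sub_comm] at c2
        have c4 := abs_nonneg
          (calibration M (u (Sum.inl b') y) - calibration M (u (Sum.inl b') z))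
        have c5 : u (Sum.inl b') (G.len b') = u (Sum.inl b') 0 := by
          rw [(hB b').1, (hB b').2, hbs]
        have c6 := hmono hzd
        rw [c5] at c3 h4
        linarith
      · have := hother b' hb' _ (Or.inr hbs)
        linarith
    · have hw : |w (G.src b)| ≤ d := by rw [← hh, ← hH]; exact hfoot h
      have := hmono hw
      linarith
  rcases lt_or_ge (G.len b - r) x with hxl | hxl
  · -- the point is close to the final vertex
    obtain ⟨y, hy, hyd⟩ := hsmall b 0 le_rfl (by linarith)
    rw [zero_add] at hy
    have hy' : y ∈ G.edge (Sum.inl b) := ⟨hy.1, by linarith [hy.2]⟩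
    have h2p := hu.two_passes (hM _) hy' (G.len_mem_edge b) (by linarith [hy.2]) hx.2
    rw [(hB b).2] at h2p
    have h3 := hmono hyd
    have hns := htgt b
    unfold IsTipTgt at hns
    rw [not_and_or, not_and_or] at hns
    push Not at hns
    rcases hns with ⟨b', hb', hbs⟩ | ⟨b', hbs⟩ | ⟨h, hh⟩
    · have := hother b' hb' _ (Or.inr hbs)
      linarith
    · by_cases hb' : b' = b
      · -- a loop, which is entered again at its initial point
        subst hb'
        obtain ⟨z, hz, hzd⟩ := hsmall b' (G.len b' - 2 * r) (by linarith) (by linarith)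
        have h4 := hu.sum_calibration_sub_le (hM _) (G.zero_mem_edge (Sum.inl b'))
          (G.len_mem_edge b') hy.1 (show y ≤ z by linarith [hz.1, hy.2])
          (show z ≤ x by linarith [hz.2]) hx.2
        have c1 := calibration_abs_sub_le M (u (Sum.inl b') x) (u (Sum.inl b') (G.len b'))
        have c2 := calibration_abs_sub_le M (u (Sum.inl b') x) (u (Sum.inl b') z)
        have c3 := calibration_abs_sub_le M (u (Sum.inl b') 0) (u (Sum.inl b') y)
        rw [abs_sub_comm] at c1 c3
        have c4 := abs_nonneg
          (calibration M (u (Sum.inl b') z) - calibration M (u (Sum.inl b') y))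
        have c5 : u (Sum.inl b') (G.len b') = u (Sum.inl b') 0 := by
          rw [(hB b').1, (hB b').2, hbs]
        have c6 := hmono hzd
        rw [c5] at c1 h4
        linarith
      · have := hother b' hb' _ (Or.inl hbs)
        linarith
    · have hw : |w (G.tgt b)| ≤ d := by rw [← hh, ← hH]; exact hfoot h
      have := hmono hw
      linarith
  · obtain ⟨y, hy, hyd⟩ := hsmall b 0 le_rfl (by linarith)
    obtain ⟨z, hz, hzd⟩ := hsmall b (G.len b - r) (by linarith) (by linarith)
    rw [zero_add] at hy
    rw [sub_add_cancel] at hz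
    have h2p := hu.two_passes (hM _) (e := Sum.inl b) (y := y) (x := x) (z := z)
      ⟨hy.1, by linarith [hy.2]⟩ ⟨by linarith [hz.1], hz.2⟩ (by linarith [hy.2])
      (by linarith [hz.1])
    have h3 := hmono hyd
    have h4 := hmono hzd
    linarith

/-- Almost optimal functions in terms of their maximum. -/
theorem exists_almost_optimal_max (hconn : G.Connected) [Nonempty H] {ε : ℝ} (hε : 0 < ε) :
    ∃ u, G.MemH1 u ∧ G.mass u = G.criticalMass ∧ ∃ e, ∃ x ∈ G.edge e,
      (∀ e', ∀ y ∈ G.edge e', |u e' y| ≤ |u e x|) ∧ 0 < |u e x| ∧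
      G.energy u ≤ ε * |u e x| ^ 4 := by
  have hμ := criticalMass_pos hconn
  obtain ⟨u, hu, hm, hk, hE⟩ := exists_almost_optimal hconn
    (show 0 < min (1 / 6) (2 * ε / G.criticalMass) by positivity)
  obtain ⟨e, x, hx, hM⟩ := hu.exists_isMax
  have h1 := hu.sextic_le hM
  rw [hm] at h1
  have h2 : G.energy u = 1 / 2 * G.kinetic u - 1 / 6 * G.sextic u := rfl
  have h3 : G.energy u ≤ 1 / 6 * G.kinetic u :=
    hE.trans (mul_le_mul_of_nonneg_right (min_le_left _ _) hk.le)
  have h4 : G.energy u ≤ 2 * ε / G.criticalMass * G.kinetic u :=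
    hE.trans (mul_le_mul_of_nonneg_right (min_le_right _ _) hk.le)
  have h5 : 2 * G.kinetic u ≤ |u e x| ^ 4 * G.criticalMass := by linarith
  refine ⟨u, hu, hm, e, x, hx, hM, ?_, ?_⟩
  · refine (abs_nonneg _).lt_of_ne fun h0 => ?_
    rw [← h0] at h5
    norm_num at h5
    linarith
  · refine h4.trans ?_
    rw [div_mul_eq_mul_div, div_le_iff₀ hμ]
    nlinarith

/-- An almost optimal function that is small at the foot of some half-line cannot have a half-line
carrying almost the mass of a half-soliton. -/
theorem MemH1.false_of_heavy_of_light (hu : G.MemH1 u) (hconn : G.Connected)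
    (hmass : G.mass u = G.criticalMass) {D ε d : ℝ}
    (hD : D = 2 * halfLineMass - G.criticalMass) (hD0 : 0 < D) (hε : ε ≤ D / 12)
    {e : B ⊕ H} {x : ℝ} (hx : x ∈ G.edge e) (hM : ∀ e', ∀ y ∈ G.edge e', |u e' y| ≤ |u e x|)
    (hpos : 0 < |u e x|) (hE : G.energy u ≤ ε * |u e x| ^ 4) {l l' : H}
    (hheavy : halfLineMass - D / 4 ≤ G.edgeMass u (Sum.inr l))
    (hlight : |u (Sum.inr l') 0| ≤ d)
    (hd : calibration |u e x| d ≤ |u e x| ^ 4 * (D / 48)) : False := by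
  classical
  set M := |u e x| with hMdef
  have hX : 0 < M ^ 4 := by positivity
  have hcost : ∀ e, 0 ≤ G.edgeCost M u e := fun e => edgeCost_nonneg (hM e)
  have hself := calibration_self hpos.le
  have hld : calibration M |u (Sum.inr l') 0| ≤ M ^ 4 * (D / 48) :=
    (calibration_mono M hlight).trans hd
  have htot := hu.sum_edgeCost hM
  rw [hmass] at htot
  have hεX : ε * M ^ 4 ≤ D / 12 * M ^ 4 := mul_le_mul_of_nonneg_right hε hX.le
  have hsplit : ∑ e', G.edgeCost M u e' = ∑ b, G.edgeCost M u (Sum.inl b) +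
      ∑ h, G.edgeCost M u (Sum.inr h) := Fintype.sum_sum_type _
  by_cases hel : e = Sum.inr l
  · -- the maximum is on the heavy half-line: two passes, the second one ending at `foot l'`
    have h1 : 2 * calibration M M - calibration M |u (Sum.inr l) 0| ≤
        G.edgeCost M u (Sum.inr l) := by
      have hx' : x ∈ G.edge (Sum.inr l) := hel ▸ hx
      have hMl : |u (Sum.inr l) x| = M := by rw [hMdef, hel]
      have h : 2 * calibration M |u (Sum.inr l) x| - calibration M |u (Sum.inr l) 0| ≤
          G.edgeCost M u (Sum.inr l) :=
        SobolevOn.two_passes_Ici (hu.sobolevOn (Sum.inr l)) (hM (Sum.inr l)) hx'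
      rwa [hMl] at h
    have h2 := hu.calibration_foot_sub_foot_le hconn hM l l'
    have h3 := Finset.single_le_sum (f := fun h => G.edgeCost M u (Sum.inr h))
      (fun i _ => hcost _) (Finset.mem_univ l)
    have key : 2 * calibration M M - M ^ 4 * (D / 48) ≤
        G.energy u + M ^ 4 / 6 * G.criticalMass := by linarith
    rw [hself] at key
    have : M ^ 4 * D = M ^ 4 * (2 * halfLineMass - G.criticalMass) := by rw [hD]
    have : 0 < M ^ 4 * D := by positivity
    linarith
  · have h1 : calibration M M - M ^ 4 * (D / 48) ≤
        ∑ e', G.edgeCost M u e' - G.edgeCost M u (Sum.inr l) := by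
      cases e with
      | inl b =>
        have h2 := hu.calibration_sub_foot_le hconn hM hx l'
        have h3 := Finset.single_le_sum (f := fun h => G.edgeCost M u (Sum.inr h))
          (fun i _ => hcost _) (Finset.mem_univ l)
        linarith
      | inr h =>
        have h2 := hu.calibration_le_edgeCost (hM _) hx
        have h3 := add_le_sum_of_ne hcost hel
        have : 0 ≤ M ^ 4 * (D / 48) := by positivity
        linarith
    rw [htot, hu.edgeCost_eq (hM _), hself] at h1
    obtain ⟨z, hz, -, hEl⟩ := hu.exists_isMax_halfLine l
    set m := G.edgeMass u (Sum.inr l)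
    have hX1 : |u (Sum.inr l) z| ^ 4 ≤ M ^ 4 := pow_le_pow_left₀ (abs_nonneg _) (hM _ z hz) 4
    have hX10 : 0 ≤ |u (Sum.inr l) z| ^ 4 := by positivity
    have hDX : 0 < M ^ 4 * D := by positivity
    have hDX' : M ^ 4 * D = 2 * (M ^ 4 * halfLineMass) - M ^ 4 * G.criticalMass := by
      rw [hD]; ring
    rcases le_total m halfLineMass with hm | hm
    · have h4 : 0 ≤ G.edgeEnergy u (Sum.inr l) :=
        le_trans (by have := sub_nonneg.2 hm; positivity) hEl
      have h5 := mul_le_mul_of_nonneg_left hheavy hX.le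
      nlinarith
    · have h4 : M ^ 4 / 6 * (halfLineMass - m) ≤ G.edgeEnergy u (Sum.inr l) := by
        refine le_trans ?_ hEl
        have := sub_nonneg.2 hm
        nlinarith
      nlinarith

/-- On a graph without tips whose critical mass is below that of the line, almost optimal functions
do not concentrate and have little mass on the half-lines. -/
theorem RemovableHalfLines.exists_core_competitor_of_no_tip [DecidableEq H]
    (hrem : G.RemovableHalfLines) (hconn : G.Connected) [Nonempty B] [hHne : Nonempty H]
    (hsrc : ∀ b, ¬ G.IsTipSrc b) (htgt : ∀ b, ¬ G.IsTipTgt b)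
    (hlt : G.criticalMass < 2 * halfLineMass) {c η : ℝ} (hc : 0 < c) (hη : 0 < η) :
    ∃ u, G.MemH1 u ∧ G.mass u = G.criticalMass ∧ G.outerMass u < c ∧ G.energy u < η := by
  have hp := halfLineMass_pos
  have hμ := criticalMass_pos hconn
  have hN : (0 : ℝ) < Fintype.card H := by exact_mod_cast Fintype.card_pos
  obtain ⟨D, hD⟩ : ∃ D, D = 2 * halfLineMass - G.criticalMass := ⟨_, rfl⟩
  have hD0 : 0 < D := by linarith
  set c₁ := min (c / Fintype.card H) (min (halfLineMass / 2) (D / 4)) with hc₁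
  have hc₁0 : 0 < c₁ := by positivity
  have hc₁c : c₁ ≤ c / Fintype.card H := min_le_left _ _
  have hc₁p : c₁ ≤ halfLineMass / 2 := (min_le_right _ _).trans (min_le_left _ _)
  have hc₁D : c₁ ≤ D / 4 := (min_le_right _ _).trans (min_le_right _ _)
  obtain ⟨C, hC, HC⟩ := hrem.exists_max_pow_four_le hconn hc₁0 (by linarith)
  -- the relative size `q = (d / M)²` below which the calibration is negligible
  set q := min (D / 24) (1 / 2) with hq
  have hq0 : 0 < q := by positivity
  have hqD : q ≤ D / 24 := min_le_left _ _
  have hq1 : q ≤ 1 / 2 := min_le_right _ _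
  obtain ⟨b₀, hb₀⟩ := Finite.exists_min G.len
  set r := G.len b₀ / 4 with hr
  have hr0 : 0 < r := by have := G.len_pos b₀; positivity
  have hlen : ∀ b, 4 * r ≤ G.len b := fun b => by rw [hr]; linarith [hb₀ b]
  set K := 2 * G.criticalMass / (q * r) with hK
  have hK0 : 0 < K := by positivity
  set ε := min (min (1 / (2 * C)) (q ^ 2 * halfLineMass / 12)) (min (D / 12) (η / (2 * K ^ 2)))
    with hε
  have hε0 : 0 < ε := by positivity
  have hεC : ε ≤ 1 / (2 * C) := (min_le_left _ _).trans (min_le_left _ _)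
  have hεq : ε ≤ q ^ 2 * halfLineMass / 12 := (min_le_left _ _).trans (min_le_right _ _)
  have hεD : ε ≤ D / 12 := (min_le_right _ _).trans (min_le_left _ _)
  have hεη : ε ≤ η / (2 * K ^ 2) := (min_le_right _ _).trans (min_le_right _ _)
  obtain ⟨u, hu, hm, e, x, hx, hM, hpos, hE⟩ := exists_almost_optimal_max hconn hε0
  set M := |u e x| with hMdef
  have hX : 0 < M ^ 4 := by positivity
  set d := √q * M with hd
  have hd0 : 0 < d := by positivity
  have hd2 : d ^ 2 = q * M ^ 2 := by rw [hd, mul_pow, Real.sq_sqrt hq0.le]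
  have hdcal : calibration M d ≤ M ^ 4 * (D / 48) := by
    refine (calibration_le hd0.le).trans ?_
    rw [hd2]
    have h1 : M ^ 4 * q ≤ M ^ 4 * (D / 24) := mul_le_mul_of_nonneg_left hqD hX.le
    calc M ^ 2 * (q * M ^ 2) / 2 = M ^ 4 * q / 2 := by ring
      _ ≤ M ^ 4 * (D / 24) / 2 := by gcongr
      _ = M ^ 4 * (D / 48) := by ring
  have hdM : d < M := by
    have : d ^ 2 < M ^ 2 := by
      rw [hd2]
      have : 0 < M ^ 2 := by positivity
      nlinarith
    exact lt_of_pow_lt_pow_left₀ 2 hpos.le this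
  -- no half-line has an intermediate mass
  have hdich : ∀ l, G.edgeMass u (Sum.inr l) < c₁ ∨
      halfLineMass - c₁ < G.edgeMass u (Sum.inr l) := by
    intro l
    by_contra! hcon
    have h1 := HC u l hu hm.le hcon.1 hcon.2 e x hx hM
    have h2 : C * G.energy u ≤ C * (1 / (2 * C) * M ^ 4) := by
      have := hE.trans (mul_le_mul_of_nonneg_right hεC hX.le)
      gcongr
    have h3 : C * (1 / (2 * C) * M ^ 4) = M ^ 4 / 2 := by field_simp
    linarith
  -- on light half-lines the function is small
  have hsmallH : ∀ l, G.edgeMass u (Sum.inr l) < c₁ →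
      ∀ y ∈ G.edge (Sum.inr l), |u (Sum.inr l) y| ≤ d := by
    intro l hl y hy
    obtain ⟨z, hz, hMl, hEl⟩ := hu.exists_isMax_halfLine l
    refine (hMl y hy).trans ?_
    have h1 := hrem.edgeEnergy_le hconn hu hm.le l
    have h2 : |u (Sum.inr l) z| ^ 4 / 6 * (halfLineMass / 2) ≤
        |u (Sum.inr l) z| ^ 4 / 6 * (halfLineMass - G.edgeMass u (Sum.inr l)) := by
      gcongr
      linarith
    have h3 : ε * M ^ 4 ≤ q ^ 2 * halfLineMass / 12 * M ^ 4 :=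
      mul_le_mul_of_nonneg_right hεq hX.le
    have h4 : halfLineMass * |u (Sum.inr l) z| ^ 4 ≤ halfLineMass * d ^ 4 := by
      have : d ^ 4 = q ^ 2 * M ^ 4 := by
        rw [show d ^ 4 = (d ^ 2) ^ 2 by ring, hd2]; ring
      rw [this]
      linarith
    have h5 := le_of_mul_le_mul_left h4 hp
    exact le_of_pow_le_pow_left₀ (by norm_num) hd0.le h5
  have hlight : ∀ l, G.edgeMass u (Sum.inr l) < c₁ := by
    intro l
    refine (hdich l).resolve_right fun hheavy => ?_
    obtain ⟨⟨l', hl'⟩⟩ := (hrem l).1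
    rcases hdich l' with h | h
    · exact hu.false_of_heavy_of_light hconn hm hD hD0 hεD hx hM hpos hE (l := l) (by linarith)
        (hsmallH l' h 0 (G.zero_mem_edge _)) hdcal
    · have h1 := add_le_sum_of_ne (f := fun e => G.edgeMass u e) (fun e => G.edgeMass_nonneg u e)
        (i := Sum.inr l') (j := Sum.inr l) (by simpa using hl')
      rw [← mass_eq, hm] at h1
      -- two heavy half-lines would exceed the critical mass
      linarith
  refine ⟨u, hu, hm, ?_, ?_⟩
  · calc G.outerMass u < ∑ _h : H, c₁ :=
          Finset.sum_lt_sum_of_nonempty Finset.univ_nonempty fun h _ => hlight h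
      _ = Fintype.card H * c₁ := by simp
      _ ≤ Fintype.card H * (c / Fintype.card H) := by gcongr
      _ = c := by field_simp
  · -- the maximum is attained on a bounded edge; if it were large there would be two passes
    have hMK : M ^ 2 ≤ K := by
      by_contra! hcon
      cases e with
      | inr l => exact absurd (hsmallH l (hlight l) x hx) (not_le.2 hdM)
      | inl b =>
        have hsmall : ∀ b p, 0 ≤ p → p + r ≤ G.len b →
            ∃ y ∈ Icc p (p + r), |u (Sum.inl b) y| ≤ d := by
          intro b' p hp0 hpr
          refine (hu.sobolevOn (Sum.inl b')).exists_abs_le_of_mass hr0.le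
            hd0.le (fun t ht => ⟨hp0.trans ht.1, ht.2.trans hpr⟩) ?_
          rw [setIntegral_congr_set (G.edge_ae_eq (Sum.inl b'))]
          have h1 := G.edgeMass_le_mass u (Sum.inl b')
          rw [hm] at h1
          refine h1.trans_lt ?_
          rw [hd2]
          have h2 : K * (q * r) = 2 * G.criticalMass := by rw [hK]; field_simp
          have h3 : K * (q * r) < M ^ 2 * (q * r) := by
            have : 0 < q * r := by positivity
            gcongr
          linarith
        have h1 := hu.two_passes_of_no_tip hM hsrc htgt hr0 hlen hsmall
          (fun h => hsmallH h (hlight h) 0 (G.zero_mem_edge _)) hx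
        rw [← hMdef, hu.sum_edgeCost hM, hm, calibration_self hpos.le] at h1
        have h2 : M ^ 4 * D = 2 * (M ^ 4 * halfLineMass) - M ^ 4 * G.criticalMass := by
          rw [hD]; ring
        have h3 : 0 < M ^ 4 * D := by positivity
        have h4 : ε * M ^ 4 ≤ D / 12 * M ^ 4 := mul_le_mul_of_nonneg_right hεD hX.le
        linarith
    calc G.energy u ≤ ε * M ^ 4 := hE
      _ = ε * (M ^ 2) ^ 2 := by ring
      _ ≤ η / (2 * K ^ 2) * K ^ 2 := by gcongr
      _ = η / 2 := by field_simp
      _ < η := by linarith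

/-- There are functions of critical mass with small energy and little mass on the half-lines. -/
theorem RemovableHalfLines.exists_core_competitor [DecidableEq H]
    (hrem : G.RemovableHalfLines) (hconn : G.Connected) [Nonempty B] [hHne : Nonempty H]
    {c η : ℝ} (hc : 0 < c) (hη : 0 < η) :
    ∃ u, G.MemH1 u ∧ G.mass u = G.criticalMass ∧ G.outerMass u < c ∧ G.energy u < η := by
  by_cases ht : ∃ b, G.IsTipSrc b ∨ G.IsTipTgt b
  · obtain ⟨b, hb⟩ := ht
    obtain ⟨u, h1, h2, h3, h4⟩ := exists_core_competitor_of_isTip hconn hb hη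
    exact ⟨u, h1, h2, h3 ▸ hc, h4⟩
  · push Not at ht
    rcases lt_or_ge G.criticalMass (2 * halfLineMass) with hlt | hge
    · exact hrem.exists_core_competitor_of_no_tip hconn (fun b => (ht b).1) (fun b => (ht b).2)
        hlt hc hη
    · obtain ⟨u, h1, h2, h3, h4⟩ := exists_core_competitor_of_le hconn hge hη
      exact ⟨u, h1, h2, h3 ▸ hc, h4⟩

end MetricGraph

/-! ### Weak compactness -/

/-- Bounded sequences of `L²` have weakly convergent subsequences. -/
theorem exists_weak_limit {μ : Measure ℝ} [IsSeparable μ] {g : ℕ → ℝ → ℝ}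
    (hg : ∀ n, MemLp (g n) 2 μ) {C : ℝ} (hC : ∀ n, ∫ x, g n x ^ 2 ∂μ ≤ C) :
    ∃ φ : ℕ → ℕ, StrictMono φ ∧ ∃ γ : ℝ → ℝ, MemLp γ 2 μ ∧ ∀ f : ℝ → ℝ, MemLp f 2 μ →
      Tendsto (fun n => ∫ x, g (φ n) x * f x ∂μ) atTop (𝓝 (∫ x, γ x * f x ∂μ)) := by
  have : Fact ((2 : ENNReal) ≠ ⊤) := ⟨by simp⟩
  have hin : ∀ {a b : ℝ → ℝ} (ha : MemLp a 2 μ) (hb : MemLp b 2 μ),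
      inner ℝ (ha.toLp a) (hb.toLp b) = ∫ x, a x * b x ∂μ := fun ha hb => by
    rw [L2.inner_def]
    refine integral_congr_ae ?_
    filter_upwards [ha.coeFn_toLp, hb.coeFn_toLp] with x h1 h2
    rw [h1, h2]
    simp [mul_comm]
  let F : ℕ → WeakDual ℝ (Lp ℝ 2 μ) := fun n =>
    StrongDual.toWeakDual (innerSL ℝ ((hg n).toLp (g n)))
  have hF : ∀ n, F n ∈
      WeakDual.toStrongDual ⁻¹' Metric.closedBall (0 : StrongDual ℝ (Lp ℝ 2 μ)) √C := by
    intro n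
    have h1 : ‖innerSL ℝ ((hg n).toLp (g n))‖ ≤ √C := by
      rw [innerSL_apply_norm]
      refine Real.le_sqrt_of_sq_le ?_
      rw [← real_inner_self_eq_norm_sq, hin]
      simpa only [sq] using hC n
    rw [mem_preimage, mem_closedBall_zero_iff]
    exact h1
  obtain ⟨Λ, -, φ, hφ, hlim⟩ := WeakDual.isSeqCompact_closedBall ℝ _ _ _ hF
  set γ : Lp ℝ 2 μ := (InnerProductSpace.toDual ℝ (Lp ℝ 2 μ)).symm (WeakDual.toStrongDual Λ)
    with hγ
  refine ⟨φ, hφ, γ, Lp.memLp _, fun f hf => ?_⟩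
  have h1 : Tendsto (fun n => F (φ n) (hf.toLp f)) atTop (𝓝 (Λ (hf.toLp f))) :=
    ((WeakDual.eval_continuous (hf.toLp f)).tendsto Λ).comp hlim
  have h2 : Λ (hf.toLp f) = ∫ x, γ x * f x ∂μ := by
    rw [← hin (Lp.memLp γ) hf, Lp.toLp_coeFn, hγ, InnerProductSpace.toDual_symm_apply]
    rfl
  rw [← h2]
  exact h1.congr fun n => hin (hg (φ n)) hf

/-- A family of properties of subsequences, indexed by a finite type, can be achieved
simultaneously. -/
theorem exists_strictMono_forall {ι : Type*} [Finite ι] {P : ι → (ℕ → ℕ) → Prop}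
    (hsub : ∀ i (φ ψ : ℕ → ℕ), StrictMono ψ → P i φ → P i (φ ∘ ψ))
    (hex : ∀ i (φ : ℕ → ℕ), StrictMono φ → ∃ ψ : ℕ → ℕ, StrictMono ψ ∧ P i (φ ∘ ψ)) :
    ∃ φ, StrictMono φ ∧ ∀ i, P i φ := by
  classical
  have := Fintype.ofFinite ι
  suffices h : ∀ s : Finset ι, ∃ φ, StrictMono φ ∧ ∀ i ∈ s, P i φ by
    obtain ⟨φ, hφ, h⟩ := h Finset.univ
    exact ⟨φ, hφ, fun i => h i (Finset.mem_univ i)⟩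
  intro s
  induction s using Finset.induction_on with
  | empty => exact ⟨id, strictMono_id, by simp⟩
  | insert i s _ ih =>
    obtain ⟨φ, hφ, h⟩ := ih
    obtain ⟨ψ, hψ, h'⟩ := hex i φ hφ
    refine ⟨φ ∘ ψ, hφ.comp hψ, fun j hj => ?_⟩
    rcases Finset.mem_insert.1 hj with rfl | hj
    · exact h'
    · exact hsub j φ ψ hψ (h j hj)

/-- Fatou's lemma for squares. -/
theorem integral_sq_le_of_tendsto {μ : Measure ℝ} {u : ℕ → ℝ → ℝ} {w : ℝ → ℝ} {m : ℝ}
    (hu : ∀ n, MemLp (u n) 2 μ) (hlim : ∀ᵐ x ∂μ, Tendsto (fun n => u n x) atTop (𝓝 (w x)))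
    (hm : Tendsto (fun n => ∫ x, u n x ^ 2 ∂μ) atTop (𝓝 m)) :
    MemLp w 2 μ ∧ ∫ x, w x ^ 2 ∂μ ≤ m := by
  have hw : AEStronglyMeasurable w μ :=
    aestronglyMeasurable_of_tendsto_ae atTop (fun n => (hu n).aestronglyMeasurable) hlim
  have hm0 : 0 ≤ m := ge_of_tendsto' hm fun n => integral_nonneg fun x => sq_nonneg _
  have h1 : ∫⁻ x, ENNReal.ofReal (w x ^ 2) ∂μ ≤ ENNReal.ofReal m := by
    have h2 : ∀ n, ∫⁻ x, ENNReal.ofReal (u n x ^ 2) ∂μ = ENNReal.ofReal (∫ x, u n x ^ 2 ∂μ) :=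
      fun n => (ofReal_integral_eq_lintegral_ofReal (hu n).integrable_sq
        (ae_of_all _ fun x => sq_nonneg _)).symm
    calc ∫⁻ x, ENNReal.ofReal (w x ^ 2) ∂μ
        = ∫⁻ x, liminf (fun n => ENNReal.ofReal (u n x ^ 2)) atTop ∂μ := by
          refine lintegral_congr_ae ?_
          filter_upwards [hlim] with x hx
          exact (((ENNReal.continuous_ofReal.tendsto _).comp (hx.pow 2)).liminf_eq).symm
      _ ≤ liminf (fun n => ∫⁻ x, ENNReal.ofReal (u n x ^ 2) ∂μ) atTop :=
          lintegral_liminf_le' fun n =>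
            ((hu n).aestronglyMeasurable.aemeasurable.pow_const 2).ennreal_ofReal
      _ = ENNReal.ofReal m := by
          simp only [h2]
          exact ((ENNReal.continuous_ofReal.tendsto _).comp hm).liminf_eq
  have h3 : Integrable (fun x => w x ^ 2) μ := by
    refine ⟨hw.pow 2, ?_⟩
    rw [hasFiniteIntegral_iff_ofReal (ae_of_all _ fun x => sq_nonneg _)]
    exact h1.trans_lt ENNReal.ofReal_lt_top
  refine ⟨(memLp_two_iff_integrable_sq hw).2 h3, ?_⟩
  rw [← ofReal_integral_eq_lintegral_ofReal h3 (ae_of_all _ fun x => sq_nonneg _)] at h1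
  exact (ENNReal.ofReal_le_ofReal_iff hm0).1 h1

/-- Weak convergence in `H¹(S)`: pointwise convergence of the functions and weak convergence in `L²`
of the derivatives. -/
structure SobolevTendsto (S : Set ℝ) (u g : ℕ → ℝ → ℝ) (w γ : ℝ → ℝ) : Prop where
  tendsto : ∀ x ∈ S, Tendsto (fun n => u n x) atTop (𝓝 (w x))
  tendsto_deriv : ∀ f : ℝ → ℝ, MemLp f 2 (volume.restrict S) →
    Tendsto (fun n => ∫ x in S, g n x * f x) atTop (𝓝 (∫ x in S, γ x * f x))

namespace SobolevOn

variable {S T : Set ℝ} {u g : ℕ → ℝ → ℝ} {w γ : ℝ → ℝ} {M m C : ℝ}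

/-- Bounded sequences of `H¹(S)` have weakly convergent subsequences. -/
theorem exists_sobolevTendsto [hS : S.OrdConnected] {p : ℝ} (hp : p ∈ S)
    (h : ∀ n, SobolevOn S (u n) (g n)) (hp' : ∀ n, |u n p| ≤ C)
    (hm : ∀ n, ∫ x in S, u n x ^ 2 ≤ C) (hk : ∀ n, ∫ x in S, g n x ^ 2 ≤ C) :
    ∃ φ : ℕ → ℕ, StrictMono φ ∧ ∃ w γ, SobolevOn S w γ ∧
      SobolevTendsto S (fun n => u (φ n)) (fun n => g (φ n)) w γ := by
  obtain ⟨φ, hφ, γ, hγ, hγlim⟩ := exists_weak_limit (fun n => (h n).memLp_deriv) hk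
  obtain ⟨b, -, ψ, hψ, hb⟩ := tendsto_subseq_of_bounded (x := fun n => u (φ n) p)
    (Metric.isBounded_Icc (-C) C) fun n => abs_le.1 (hp' (φ n))
  obtain ⟨m, -, χ, hχ, hm'⟩ := tendsto_subseq_of_bounded
    (x := fun n => ∫ x in S, u (φ (ψ n)) x ^ 2) (Metric.isBounded_Icc 0 C)
    fun n => ⟨integral_nonneg fun x => sq_nonneg _, hm (φ (ψ n))⟩
  have hψχ : Tendsto (ψ ∘ χ) atTop atTop := (hψ.comp hχ).tendsto_atTop
  have hset : ∀ a ∈ S, ∀ b ∈ S, Tendsto (fun n => ∫ t in Ioc a b, g (φ (ψ (χ n))) t) atTop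
      (𝓝 (∫ t in Ioc a b, γ t)) := by
    intro a ha b hb
    have hsub : Ioc a b ⊆ S := Ioc_subset_Icc_self.trans (hS.out ha hb)
    have key : ∀ f : ℝ → ℝ, ∫ t in Ioc a b, f t = ∫ t in S, f t * (Ioc a b).indicator 1 t := by
      intro f
      rw [← integral_indicator measurableSet_Ioc, ← integral_indicator hS.measurableSet]
      refine integral_congr_ae (ae_of_all _ fun t => ?_)
      by_cases ht : t ∈ Ioc a b
      · simp [indicator_of_mem ht, indicator_of_mem (hsub ht)]
      · rw [indicator_of_notMem ht, indicator, indicator_of_notMem ht]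
        simp
    simp only [key]
    exact (hγlim _ (memLp_indicator_const 2 measurableSet_Ioc 1
      (Or.inr (ne_top_of_le_ne_top (by simp) (Measure.restrict_apply_le S (Ioc a b)))))).comp hψχ
  have hint : ∀ x ∈ S, Tendsto (fun n => ∫ t in p..x, g (φ (ψ (χ n))) t) atTop
      (𝓝 (∫ t in p..x, γ t)) := fun x hx =>
    (hset p hp x hx).sub (hset x hx p hp)
  have hlim : ∀ x ∈ S, Tendsto (fun n => u (φ (ψ (χ n))) x) atTop
      (𝓝 (b + ∫ t in p..x, γ t)) := by
    intro x hx
    refine ((hb.comp hχ.tendsto_atTop).add (hint x hx)).congr fun n => ?_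
    rw [← (h _).sub_eq p hp x hx]
    simp
  refine ⟨φ ∘ ψ ∘ χ, hφ.comp (hψ.comp hχ), fun x => b + ∫ t in p..x, γ t, γ, ⟨?_, hγ, ?_⟩,
    ⟨hlim, fun f hf => (hγlim f hf).comp hψχ⟩⟩
  · refine (integral_sq_le_of_tendsto (fun n => (h (φ (ψ (χ n)))).memLp) ?_ hm').1
    rw [ae_restrict_iff' hS.measurableSet]
    exact ae_of_all _ hlim
  · intro x hx y hy
    rw [add_sub_add_left_eq_sub]
    exact intervalIntegral.integral_interval_sub_left (intervalIntegrable_of_memLp_two hγ hp hy)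
      (intervalIntegrable_of_memLp_two hγ hp hx)

theorem integral_sq_le_of_sobolevTendsto (hS : MeasurableSet S) (h : ∀ n, SobolevOn S (u n) (g n))
    (hlim : SobolevTendsto S u g w γ) (hm : Tendsto (fun n => ∫ x in S, u n x ^ 2) atTop (𝓝 m)) :
    ∫ x in S, w x ^ 2 ≤ m := by
  refine (integral_sq_le_of_tendsto (fun n => (h n).memLp) ?_ hm).2
  rw [ae_restrict_iff' hS]
  exact ae_of_all _ hlim.tendsto

theorem tendsto_integral_pow (hTm : MeasurableSet T) (hTS : T ⊆ S)
    (hT : volume T ≠ ⊤)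
    (h : ∀ n, SobolevOn S (u n) (g n)) (hlim : SobolevTendsto S u g w γ)
    (hM : ∀ n, ∀ x ∈ S, |u n x| ≤ M) (k : ℕ) :
    Tendsto (fun n => ∫ x in T, u n x ^ k) atTop (𝓝 (∫ x in T, w x ^ k)) := by
  refine tendsto_integral_of_dominated_convergence (fun _ => M ^ k)
    (fun n => (((h n).mono hTS).memLp.aestronglyMeasurable.pow k))
    (integrableOn_const hT) (fun n => ?_) ?_
  · rw [ae_restrict_iff' hTm]
    refine ae_of_all _ fun x hx => ?_
    rw [norm_pow, Real.norm_eq_abs]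
    exact pow_le_pow_left₀ (abs_nonneg _) (hM n x (hTS hx)) k
  · rw [ae_restrict_iff' hTm]
    exact ae_of_all _ fun x hx => (hlim.tendsto x (hTS hx)).pow k

/-- Lower semicontinuity of the energy on a set of finite measure. -/
theorem energyOn_le_of_sobolevTendsto_of_finite (hS : MeasurableSet S) (hTm : MeasurableSet T)
    (hTS : T ⊆ S) (hT : volume T ≠ ⊤) (h : ∀ n, SobolevOn S (u n) (g n)) (hw : SobolevOn S w γ)
    (hlim : SobolevTendsto S u g w γ) (hM : ∀ n, ∀ x ∈ S, |u n x| ≤ M) {E : ℝ} {e : ℕ → ℝ}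
    (he : Tendsto e atTop (𝓝 E)) (hle : ∀ n, energyOn T (u n) (g n) ≤ e n) :
    energyOn T w γ ≤ E := by
  have h6 := tendsto_integral_pow hTm hTS hT h hlim hM 6
  have hγT := (hw.mono hTS).memLp_deriv
  -- the convexity inequality `2 g γ - γ² ≤ g²` bounds the kinetic term below
  have h2 : Tendsto (fun n => ∫ x in T, g n x * γ x) atTop (𝓝 (∫ x in T, γ x * γ x)) := by
    have h3 := hlim.tendsto_deriv (T.indicator γ) (hw.memLp_deriv.indicator hTm)
    have key : ∀ f : ℝ → ℝ, ∫ x in S, f x * T.indicator γ x = ∫ x in T, f x * γ x := fun f => by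
      rw [← integral_indicator hS, ← integral_indicator hTm]
      refine integral_congr_ae (ae_of_all _ fun x => ?_)
      by_cases hx : x ∈ T
      · simp [hx, hTS hx]
      · simp [hx]
    simpa only [key] using h3
  have h4 : Tendsto (fun n => 1 / 2 * (2 * (∫ x in T, g n x * γ x) - ∫ x in T, γ x ^ 2) -
      1 / 6 * ∫ x in T, u n x ^ 6) atTop (𝓝 (energyOn T w γ)) := by
    have h5 := (((h2.const_mul 2).sub_const (∫ x in T, γ x ^ 2)).const_mul (1 / 2)).sub
      (h6.const_mul (1 / 6))
    convert h5 using 2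
    simp only [energyOn, sq]
    ring
  refine le_of_tendsto_of_tendsto' h4 he fun n => (le_trans ?_ (hle n))
  have hgT := ((h n).mono hTS).memLp_deriv
  have h7 : 2 * (∫ x in T, g n x * γ x) - ∫ x in T, γ x ^ 2 ≤ ∫ x in T, g n x ^ 2 := by
    have hi : Integrable (fun x => 2 * (g n x * γ x)) (volume.restrict T) :=
      (hgT.integrable_mul hγT).const_mul 2
    rw [← integral_const_mul, ← integral_sub hi hγT.integrable_sq]
    refine integral_mono (hi.sub hγT.integrable_sq)
      hgT.integrable_sq fun x => ?_
    nlinarith [sq_nonneg (g n x - γ x)]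
  unfold energyOn
  linarith

/-- Lower semicontinuity of the energy, provided that the energies of the tails are nonnegative. -/
theorem energyOn_le_of_sobolevTendsto (hS : MeasurableSet S) (hS0 : S ⊆ Ici 0)
    (h : ∀ n, SobolevOn S (u n) (g n)) (hw : SobolevOn S w γ)
    (hlim : SobolevTendsto S u g w γ) (hM : ∀ n, ∀ x ∈ S, |u n x| ≤ M)
    (htail : ∀ᶠ R in atTop, ∀ n, 0 ≤ energyOn (S \ Iic R) (u n) (g n)) {E : ℝ}
    (he : Tendsto (fun n => energyOn S (u n) (g n)) atTop (𝓝 E)) : energyOn S w γ ≤ E := by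
  have hMw : ∀ x ∈ S, |w x| ≤ M := fun x hx =>
    le_of_tendsto' (hlim.tendsto x hx).abs fun n => hM n x hx
  have hlimR : ∀ f : ℝ → ℝ, IntegrableOn f S →
      Tendsto (fun R => ∫ x in S ∩ Iic R, f x) atTop (𝓝 (∫ x in S, f x)) := by
    intro f hf
    have h1 := (aecover_Iic (μ := volume.restrict S)
      (tendsto_id (α := ℝ) (x := atTop))).integral_tendsto_of_countably_generated hf
    refine h1.congr fun R => ?_
    rw [Measure.restrict_restrict measurableSet_Iic, inter_comm]
    rfl
  have h1 : Tendsto (fun R => energyOn (S ∩ Iic R) w γ) atTop (𝓝 (energyOn S w γ)) :=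
    ((hlimR _ hw.integrableOn_deriv_sq).const_mul _).sub
      ((hlimR _ (hw.integrableOn_pow_six hS hMw)).const_mul _)
  refine le_of_tendsto h1 ?_
  filter_upwards [htail] with R hR
  refine energyOn_le_of_sobolevTendsto_of_finite hS (hS.inter measurableSet_Iic) inter_subset_left
    ?_ h hw hlim hM he fun n => ?_
  · refine ne_top_of_le_ne_top (b := volume (Icc 0 R)) (by simp) (measure_mono fun x hx => ?_)
    exact ⟨hS0 hx.1, hx.2⟩
  · have h2 := integral_inter_add_sdiff (measurableSet_Iic (a := R)) (h n).integrableOn_deriv_sq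
    have h3 := integral_inter_add_sdiff (measurableSet_Iic (a := R))
      ((h n).integrableOn_pow_six hS (hM n))
    have h4 := hR n
    unfold energyOn at h4 ⊢
    linarith

end SobolevOn

/-! ### Existence of constrained minimizers -/

namespace MetricGraph

variable {V B H : Type*} {G : MetricGraph V B H}

theorem edgeMass_eq_edge (G : MetricGraph V B H) (u : B ⊕ H → ℝ → ℝ) (e : B ⊕ H) :
    G.edgeMass u e = ∫ x in G.edge e, u e x ^ 2 :=
  (setIntegral_congr_set (G.edge_ae_eq e)).symm

theorem edgeEnergy_eq_of_sobolevOn {u : B ⊕ H → ℝ → ℝ} {e : B ⊕ H} {g : ℝ → ℝ}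
    (h : SobolevOn (G.edge e) (u e) g) :
    G.edgeEnergy u e = energyOn (G.edge e) (u e) g := by
  rw [edgeEnergy, edgeKinetic_eq_of_sobolevOn h, edgeSextic, energyOn,
    setIntegral_congr_set (G.edge_ae_eq e), setIntegral_congr_set (G.edge_ae_eq e)]

theorem edge_subset_Ici (G : MetricGraph V B H) (e : B ⊕ H) : G.edge e ⊆ Ici 0 := by
  cases e with
  | inl b => exact Icc_subset_Ici_self
  | inr h => exact Subset.rfl

/-- The ends of all edges carry nonnegative energy: those of the bounded edges are empty, and those
of the half-lines have at most the mass `halfLineMass`. -/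
theorem MemH1.eventually_energyOn_tail_nonneg {u : ℕ → B ⊕ H → ℝ → ℝ} (hu : ∀ n, G.MemH1 (u n))
    (e : B ⊕ H) (hm : ∀ n, ∀ h, G.edgeMass (u n) (Sum.inr h) ≤ halfLineMass) :
    ∀ᶠ R in atTop, ∀ n, 0 ≤ energyOn (G.edge e \ Iic R) (u n e) (G.der (u n) e) := by
  cases e with
  | inl b =>
    filter_upwards [eventually_ge_atTop (G.len b)] with R hR n
    have : G.edge (Sum.inl b) \ Iic R = ∅ := by
      rw [sdiff_eq_empty]
      exact fun x hx => hx.2.trans hR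
    rw [this]
    simp [energyOn]
  | inr h =>
    filter_upwards [eventually_ge_atTop 0] with R hR n
    have h1 : G.edge (Sum.inr h) \ Iic R = Ioi R := by
      ext x
      simp only [edge, Set.mem_sdiff, mem_Ici, mem_Iic, not_le, mem_Ioi]
      exact ⟨fun hx => hx.2, fun hx => ⟨hR.trans hx.le, hx⟩⟩
    have h2 := (hu n).sobolevOn (Sum.inr h)
    rw [h1]
    refine (h2.mono (T := Ici R) (Ici_subset_Ici.2 hR)).energyOn_Ioi_nonneg ?_
    refine le_trans ?_ (hm n h)
    exact setIntegral_mono_set (((hu n).sobolevOn_openEdge _).integrableOn_sq)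
      (ae_of_all _ fun x => sq_nonneg _) (ae_of_all _ (Ioi_subset_Ioi hR))

variable [Fintype B] [Fintype H]

/-- Weak limits of energy-bounded sequences whose mass on the half-lines is subcritical: no mass is
lost on the bounded edges, and the energy is lower semicontinuous, since mass escaping to infinity
carries nonnegative energy. -/
theorem exists_limit_of_bounded (hconn : G.Connected) [Nonempty H] {μ c K E : ℝ}
    (hc : c ≤ halfLineMass) {u : ℕ → B ⊕ H → ℝ → ℝ} (hu : ∀ n, G.MemH1 (u n))
    (hmass : ∀ n, G.mass (u n) = μ) (hout : ∀ n, G.outerMass (u n) ≤ c)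
    (hK : ∀ n, G.kinetic (u n) ≤ K) (hE : Tendsto (fun n => G.energy (u n)) atTop (𝓝 E)) :
    ∃ w, G.MemH1 w ∧ G.mass w ≤ μ ∧ G.outerMass w ≤ c ∧ μ - c ≤ G.coreMass w ∧
      G.energy w ≤ E := by
  have hp := halfLineMass_pos
  have hμ0 : 0 ≤ μ := hmass 0 ▸ G.mass_nonneg _
  have hK0 : 0 ≤ K := (G.kinetic_nonneg _).trans (hK 0)
  obtain ⟨M, hM1, hM⟩ : ∃ M : ℝ, 1 ≤ M ∧ ∀ n, ∀ e, ∀ x ∈ G.edge e, |u n e x| ≤ M := by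
    refine ⟨1 + 12 * μ * K / halfLineMass ^ 2, by
      have : 0 ≤ 12 * μ * K / halfLineMass ^ 2 := by positivity
      linarith, fun n e x hx => ?_⟩
    obtain ⟨e', x', hx', hmax⟩ := (hu n).exists_isMax
    refine (hmax e x hx).trans ?_
    have h1 := (hu n).max_pow_four_le hconn hx' hmax
    rw [hmass n] at h1
    have h2 : |u n e' x'| ^ 4 ≤ 12 * μ * K / halfLineMass ^ 2 := by
      rw [le_div_iff₀ (by positivity)]
      exact h1.trans (mul_le_mul_of_nonneg_left (hK n) (by positivity))
    refine le_trans ?_ (add_le_add_right h2 1)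
    have h3 := abs_nonneg (u n e' x')
    nlinarith [sq_nonneg (|u n e' x'| ^ 2 - 1), sq_nonneg (|u n e' x'| - 1)]
  have hem : ∀ n e, G.edgeMass (u n) e ≤ μ := fun n e => hmass n ▸ G.edgeMass_le_mass _ e
  have hek : ∀ n e, G.edgeKinetic (u n) e ≤ K := fun n e =>
    (G.edgeKinetic_le_kinetic _ e).trans (hK n)
  have hekin : ∀ n e, ∫ x in G.edge e, G.der (u n) e x ^ 2 = G.edgeKinetic (u n) e := fun n e =>
    setIntegral_congr_set (G.edge_ae_eq e)
  set C := M + μ + K + M ^ 4 * μ with hCdef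
  have hMμ : 0 ≤ M ^ 4 * μ := by positivity
  have hcompact : ∃ φ : ℕ → ℕ, StrictMono φ ∧ ∀ e, ∃ w γ m ε,
      SobolevOn (G.edge e) w γ ∧
      SobolevTendsto (G.edge e) (fun n => u (φ n) e) (fun n => G.der (u (φ n)) e) w γ ∧
      Tendsto (fun n => G.edgeMass (u (φ n)) e) atTop (𝓝 m) ∧
      Tendsto (fun n => G.edgeEnergy (u (φ n)) e) atTop (𝓝 ε) := by
    refine exists_strictMono_forall ?_ ?_
    · rintro e φ ψ hψ ⟨w, γ, m, ε, h1, h2, h3, h4⟩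
      have ht := hψ.tendsto_atTop
      exact ⟨w, γ, m, ε, h1, ⟨fun x hx => (h2.tendsto x hx).comp ht,
        fun f hf => (h2.tendsto_deriv f hf).comp ht⟩, h3.comp ht, h4.comp ht⟩
    · intro e φ hφ
      obtain ⟨ψ, hψ, w, γ, h1, h2⟩ := SobolevOn.exists_sobolevTendsto (C := C) (G.zero_mem_edge e)
        (fun n => (hu (φ n)).sobolevOn e)
        (fun n => (hM (φ n) e 0 (G.zero_mem_edge e)).trans (by linarith))
        (fun n => by rw [← edgeMass_eq_edge]; linarith [hem (φ n) e])
        (fun n => by rw [hekin]; linarith [hek (φ n) e])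
      obtain ⟨m, -, χ, hχ, h3⟩ := tendsto_subseq_of_bounded
        (x := fun n => G.edgeMass (u (φ (ψ n))) e) (Metric.isBounded_Icc 0 μ)
        fun n => ⟨G.edgeMass_nonneg _ e, hem _ e⟩
      obtain ⟨ε, -, θ, hθ, h4⟩ := tendsto_subseq_of_bounded
        (x := fun n => G.edgeEnergy (u (φ (ψ (χ n)))) e) (Metric.isBounded_Icc (-C) C)
        fun n => by
          have h5 := (hu (φ (ψ (χ n)))).edgeSextic_le (hM (φ (ψ (χ n))) e)
          have h6 := mul_le_mul_of_nonneg_left (hem (φ (ψ (χ n))) e)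
            (show (0 : ℝ) ≤ M ^ 4 by positivity)
          have h7 := hek (φ (ψ (χ n))) e
          have h8 := G.edgeKinetic_nonneg (u (φ (ψ (χ n)))) e
          have h9 := G.edgeSextic_nonneg (u (φ (ψ (χ n)))) e
          unfold edgeEnergy
          constructor <;> linarith
      have ht := (hχ.comp hθ).tendsto_atTop
      exact ⟨ψ ∘ χ ∘ θ, hψ.comp (hχ.comp hθ), w, γ, m, ε, h1,
        ⟨fun x hx => (h2.tendsto x hx).comp ht, fun f hf => (h2.tendsto_deriv f hf).comp ht⟩,
        h3.comp hθ.tendsto_atTop, h4⟩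
  obtain ⟨φ, hφ, hlim⟩ := hcompact
  choose w γ m ε hw hlim hm hε using hlim
  choose val hvalB hvalH using fun n => (hu n).1.2
  have hmem : G.MemH1 w := by
    refine memH1_of_sobolevOn hw ⟨fun v => limUnder atTop fun n => val (φ n) v,
      fun b => ⟨?_, ?_⟩, fun h => ?_⟩
    · refine (Tendsto.limUnder_eq ?_).symm
      exact ((hlim (Sum.inl b)).tendsto 0 (G.zero_mem_edge _)).congr fun n => (hvalB (φ n) b).1
    · refine (Tendsto.limUnder_eq ?_).symm
      exact ((hlim (Sum.inl b)).tendsto _ (G.len_mem_edge b)).congr fun n => (hvalB (φ n) b).2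
    · refine (Tendsto.limUnder_eq ?_).symm
      exact ((hlim (Sum.inr h)).tendsto 0 (G.zero_mem_edge _)).congr fun n => hvalH (φ n) h
  have hmw : ∀ e, G.edgeMass w e ≤ m e := fun e => by
    rw [edgeMass_eq_edge]
    refine SobolevOn.integral_sq_le_of_sobolevTendsto (G.measurableSet_edge e)
      (fun n => (hu (φ n)).sobolevOn e) (hlim e) ?_
    simpa only [edgeMass_eq_edge] using hm e
  have hεw : ∀ e, G.edgeEnergy w e ≤ ε e := fun e => by
    rw [edgeEnergy_eq_of_sobolevOn (hw e)]
    refine SobolevOn.energyOn_le_of_sobolevTendsto (G.measurableSet_edge e) (G.edge_subset_Ici e)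
      (fun n => (hu (φ n)).sobolevOn e) (hw e) (hlim e) (fun n => hM (φ n) e)
      (MemH1.eventually_energyOn_tail_nonneg (fun n => hu (φ n)) e fun n h =>
        (G.edgeMass_le_outerMass _ h).trans ((hout _).trans hc)) ?_
    refine (hε e).congr fun n => ?_
    exact edgeEnergy_eq_of_sobolevOn ((hu (φ n)).sobolevOn e)
  have hcore : ∀ b, G.edgeMass w (Sum.inl b) = m (Sum.inl b) := fun b => by
    refine tendsto_nhds_unique ?_ (hm (Sum.inl b))
    simp only [edgeMass_eq_edge]
    exact SobolevOn.tendsto_integral_pow (G.measurableSet_edge _) Subset.rfl (by simp [edge])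
      (fun n => (hu (φ n)).sobolevOn (Sum.inl b)) (hlim _) (fun n => hM (φ n) _) 2
  have hmsum : ∑ e, m e = μ := by
    refine tendsto_nhds_unique (tendsto_finsetSum _ fun e _ => hm e) ?_
    simp only [← mass_eq, hmass]
    exact tendsto_const_nhds
  have hmout : ∑ h, m (Sum.inr h) ≤ c :=
    le_of_tendsto' (tendsto_finsetSum _ fun h _ => hm (Sum.inr h)) fun n => hout (φ n)
  have hεsum : ∑ e, ε e = E := by
    refine tendsto_nhds_unique (tendsto_finsetSum _ fun e _ => hε e) ?_
    simp only [← energy_eq]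
    exact hE.comp hφ.tendsto_atTop
  refine ⟨w, hmem, ?_, ?_, ?_, ?_⟩
  · rw [mass_eq, ← hmsum]
    exact Finset.sum_le_sum fun e _ => hmw e
  · exact (Finset.sum_le_sum fun h _ => hmw (Sum.inr h)).trans hmout
  · rw [Fintype.sum_sum_type] at hmsum
    have : G.coreMass w = ∑ b, m (Sum.inl b) := Finset.sum_congr rfl fun b _ => hcore b
    linarith
  · rw [energy_eq, ← hεsum]
    exact Finset.sum_le_sum fun e _ => hεw e

/-- If the energy of `u` is small compared with its kinetic term, then multiplying `u` by a constant
larger than `1` lowers the energy. -/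
theorem MemH1.energy_sqrt_smul_lt {u : B ⊕ H → ℝ → ℝ} (hu : G.MemH1 u)
    (hE : G.energy u < G.kinetic u / 3) {s : ℝ} (hs : 1 < s) :
    G.energy (√s • u) < G.energy u := by
  rw [hu.energy_sqrt_smul (by linarith)]
  unfold energy at hE ⊢
  have h1 : 0 < G.sextic u / 2 - G.kinetic u / 2 := by linarith
  have h2 := G.sextic_nonneg u
  have h3 : 3 ≤ s ^ 2 + s + 1 := by nlinarith
  have h4 : 3 * (1 / 6 * G.sextic u) ≤ (s ^ 2 + s + 1) * (1 / 6 * G.sextic u) :=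
    mul_le_mul_of_nonneg_right h3 (by positivity)
  nlinarith [mul_pos (sub_pos.2 hs)
    (show 0 < (s ^ 2 + s + 1) * (1 / 6 * G.sextic u) - 1 / 2 * G.kinetic u by linarith)]

/-- For masses slightly below the critical one, the energy attains its minimum among the functions
with little mass on the half-lines, and the constraint on the mass of the half-lines is not
active. -/
theorem RemovableHalfLines.exists_minimizer [DecidableEq H] (hrem : G.RemovableHalfLines)
    (hconn : G.Connected) [Nonempty B] [Nonempty H] :
    ∃ μbar, 0 < μbar ∧ μbar < G.criticalMass ∧ ∀ μ, μbar < μ → μ < G.criticalMass →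
      ∃ c u, G.MemH1 u ∧ G.mass u = μ ∧ G.outerMass u < c ∧
        ∀ v, G.MemH1 v → G.mass v = μ → G.outerMass v ≤ c → G.energy u ≤ G.energy v := by
  have hp := halfLineMass_pos
  have hm := criticalMass_pos hconn
  have hpm := halfLineMass_le_criticalMass hconn
  obtain ⟨c, hcdef⟩ : ∃ c, c = halfLineMass / 2 := ⟨_, rfl⟩
  obtain ⟨κ, hκdef⟩ : ∃ κ, κ = G.criticalMass / 4 := ⟨_, rfl⟩
  have hc : 0 < c := by linarith
  have hκ : 0 < κ := by linarith
  obtain ⟨η₀, hη₀, hbar⟩ := hrem.exists_barrier hconn hc (by linarith) hκ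
  obtain ⟨k, hk, hkin⟩ := exists_le_kinetic hconn hκ
  obtain ⟨η, hη, hηη₀, hηk⟩ : ∃ η, 0 < η ∧ η ≤ η₀ ∧ η ≤ k / 3 :=
    ⟨min η₀ (k / 3), by positivity, min_le_left _ _, min_le_right _ _⟩
  obtain ⟨u₀, hu₀, hm₀, ho₀, hE₀⟩ := hrem.exists_core_competitor hconn hc hη
  -- rescaling the competitor to masses slightly below the critical one
  obtain ⟨r, hr1, hr⟩ : ∃ r < 1, ∀ s, r < s → s < 1 → 0 < s → G.energy (√s • u₀) < η := by
    have h1 : Tendsto (fun s : ℝ => s * (1 / 2 * G.kinetic u₀) - s ^ 3 * (1 / 6 * G.sextic u₀))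
        (𝓝 1) (𝓝 (G.energy u₀)) := by
      have : Continuous fun s : ℝ =>
          s * (1 / 2 * G.kinetic u₀) - s ^ 3 * (1 / 6 * G.sextic u₀) := by fun_prop
      convert this.tendsto 1 using 2
      simp [energy]
    obtain ⟨δ, hδ, h2⟩ := Metric.eventually_nhds_iff.1 (h1.eventually_lt_const hE₀)
    refine ⟨1 - δ, by linarith, fun s hs hs1 hs0 => ?_⟩
    rw [hu₀.energy_sqrt_smul hs0.le]
    refine h2 ?_
    rw [Real.dist_eq, abs_lt]
    constructor <;> linarith
  refine ⟨G.criticalMass * max r (3 / 4), by positivity, ?_, ?_⟩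
  · have : max r (3 / 4) < 1 := max_lt hr1 (by norm_num)
    nlinarith
  intro μ hμ hμm
  have hμr : G.criticalMass * r < μ := lt_of_le_of_lt
    (mul_le_mul_of_nonneg_left (le_max_left _ _) hm.le) hμ
  have hμ34 : G.criticalMass * (3 / 4) < μ := lt_of_le_of_lt
    (mul_le_mul_of_nonneg_left (le_max_right _ _) hm.le) hμ
  have hμ0 : 0 < μ := by linarith
  set A : Set (B ⊕ H → ℝ → ℝ) := {v | G.MemH1 v ∧ G.mass v = μ ∧ G.outerMass v ≤ c} with hA
  obtain ⟨v₀, hv₀, hv₀E⟩ : ∃ v ∈ A, G.energy v < η := by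
    have hs0 : 0 < μ / G.criticalMass := by positivity
    have hs1 : μ / G.criticalMass < 1 := (div_lt_one hm).2 hμm
    refine ⟨√(μ / G.criticalMass) • u₀, ⟨hu₀.const_smul _, ?_, ?_⟩, hr _ ?_ hs1 hs0⟩
    · rw [mass_sqrt_smul _ _ hs0.le, hm₀, div_mul_cancel₀ _ hm.ne']
    · rw [outerMass_sqrt_smul _ _ hs0.le]
      have := G.outerMass_nonneg u₀
      nlinarith
    · rw [lt_div_iff₀ hm]
      linarith
  have hbdd : BddBelow (G.energy '' A) := ⟨0, by
    rintro _ ⟨v, hv, rfl⟩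
    exact hv.1.energy_nonneg hconn (by rw [hv.2.1]; exact hμm.le)⟩
  obtain ⟨x, -, hxlim, hx⟩ := exists_seq_tendsto_sInf ⟨_, mem_image_of_mem _ hv₀⟩ hbdd
  choose u hu hux using hx
  set E := sInf (G.energy '' A) with hEdef
  have hEη : E < η := (csInf_le hbdd (mem_image_of_mem _ hv₀)).trans_lt hv₀E
  have hElim : Tendsto (fun n => G.energy (u n)) atTop (𝓝 E) := by simpa only [hux] using hxlim
  obtain ⟨D, hD⟩ := hElim.bddAbove_range
  have hq : 0 < 1 - μ ^ 2 / G.criticalMass ^ 2 := by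
    rw [sub_pos, div_lt_one (by positivity)]
    gcongr
  obtain ⟨w, hw, hwm, hwo, hwc, hwE⟩ := exists_limit_of_bounded hconn (μ := μ) (c := c)
    (K := D / (1 / 2 * (1 - μ ^ 2 / G.criticalMass ^ 2))) (by linarith) (fun n => (hu n).1)
    (fun n => (hu n).2.1) (fun n => (hu n).2.2) (fun n => by
      have h1 := (hu n).1.kinetic_le_energy hconn
      rw [(hu n).2.1] at h1
      rw [le_div_iff₀ (by positivity), mul_comm]
      exact h1.trans (hD (mem_range_self n))) hElim
  have hwκ : κ ≤ G.coreMass w := by linarith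
  have hwk := hkin w hw (by linarith) hwκ
  have hwlt : G.energy w < G.kinetic w / 3 := by linarith
  have hwmass : G.mass w = μ := by
    refine hwm.eq_of_not_lt fun hlt => ?_
    have hw0 : 0 < G.mass w := by
      have := G.mass_eq_core_add_outer w
      have := G.outerMass_nonneg w
      linarith
    have hs : 1 < μ / G.mass w := (one_lt_div hw0).2 hlt
    rcases le_or_gt (μ / G.mass w * G.outerMass w) c with hle | hgt
    · have h1 : √(μ / G.mass w) • w ∈ A := by
        refine ⟨hw.const_smul _, ?_, ?_⟩
        · rw [mass_sqrt_smul _ _ (by linarith), div_mul_cancel₀ _ hw0.ne']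
        · rwa [outerMass_sqrt_smul _ _ (by linarith)]
      have h2 := csInf_le hbdd (mem_image_of_mem _ h1)
      have h3 := hw.energy_sqrt_smul_lt hwlt hs
      linarith
    · -- the ray through `w` meets the barrier
      have ho : 0 < G.outerMass w := by
        refine (G.outerMass_nonneg w).lt_of_ne fun h0 => ?_
        rw [← h0] at hgt
        linarith
      have hs1 : 1 ≤ c / G.outerMass w := (one_le_div ho).2 hwo
      have hs2 : c / G.outerMass w ≤ μ / G.mass w := ((div_lt_iff₀ ho).2 hgt).le
      have hs0 : 0 ≤ c / G.outerMass w := by linarith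
      have h1 := hbar (√(c / G.outerMass w) • w) (hw.const_smul _) (by
          rw [mass_sqrt_smul _ _ hs0]
          rw [le_div_iff₀ hw0] at hs2
          linarith) (by
          rw [coreMass_sqrt_smul _ _ hs0]
          nlinarith) (by rw [outerMass_sqrt_smul _ _ hs0, div_mul_cancel₀ _ ho.ne'])
      rcases hs1.eq_or_lt with h2 | h2
      · rw [← h2, Real.sqrt_one, one_smul] at h1
        linarith
      · have := hw.energy_sqrt_smul_lt hwlt h2
        linarith
  refine ⟨c, w, hw, hwmass, hwo.lt_of_ne fun h => ?_, fun v hv hvm hvo => ?_⟩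
  · have := hbar w hw (by linarith) hwκ h
    linarith
  · exact hwE.trans (csInf_le hbdd (mem_image_of_mem _ ⟨hv, hvm, hvo⟩))

end MetricGraph

/-! ### Criticality of constrained minimizers -/

/-- `∫ (f + t g)ᵏ` is a polynomial in `t`. -/
theorem exists_polynomial_integral_add_pow {μ : Measure ℝ} {f g : ℝ → ℝ} {k : ℕ}
    (h : ∀ m ≤ k, Integrable (fun x => f x ^ m * g x ^ (k - m)) μ) :
    ∃ P : Polynomial ℝ, ∀ t : ℝ, ∫ x, (f x + t * g x) ^ k ∂μ = P.eval t := by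
  refine ⟨∑ m ∈ Finset.range (k + 1), Polynomial.C ((k.choose m : ℝ) *
    ∫ x, f x ^ m * g x ^ (k - m) ∂μ) * Polynomial.X ^ (k - m), fun t => ?_⟩
  have h1 : ∀ x, (f x + t * g x) ^ k = ∑ m ∈ Finset.range (k + 1),
      ((k.choose m : ℝ) * t ^ (k - m)) * (f x ^ m * g x ^ (k - m)) := fun x => by
    rw [add_pow]
    refine Finset.sum_congr rfl fun m _ => ?_
    rw [mul_pow]
    ring
  simp only [h1]
  rw [integral_finsetSum _ fun m hm =>
    (h m (Nat.lt_succ_iff.1 (Finset.mem_range.1 hm))).const_mul _, Polynomial.eval_finsetSum]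
  refine Finset.sum_congr rfl fun m _ => ?_
  rw [integral_const_mul]
  simp only [Polynomial.eval_mul, Polynomial.eval_C, Polynomial.eval_pow, Polynomial.eval_X]
  ring

namespace MetricGraph

variable {V B H : Type*} {G : MetricGraph V B H} {u φ : B ⊕ H → ℝ → ℝ}

theorem MemH1.exists_polynomial_edgeSextic (hu : G.MemH1 u) (hφ : G.MemH1 φ) (e : B ⊕ H) :
    ∃ P : Polynomial ℝ, ∀ t : ℝ, G.edgeSextic (u + t • φ) e = P.eval t := by
  obtain ⟨x₁, -, h1⟩ := hu.exists_isMax_edge e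
  obtain ⟨x₂, -, h2⟩ := hφ.exists_isMax_edge e
  set M := max |u e x₁| |φ e x₂|
  have hs := hu.sobolevOn_openEdge e
  have hs' := hφ.sobolevOn_openEdge e
  refine exists_polynomial_integral_add_pow (f := u e) (g := φ e) (k := 6) fun m hm => ?_
  refine ((hs.integrableOn_sq.add hs'.integrableOn_sq).const_mul (M ^ 4)).mono'
    ((hs.memLp.aestronglyMeasurable.pow m).mul (hs'.memLp.aestronglyMeasurable.pow (6 - m))) ?_
  rw [ae_restrict_iff' (G.measurableSet_openEdge e)]
  refine ae_of_all _ fun x hx => ?_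
  have hx' := G.openEdge_subset e hx
  set a := max |u e x| |φ e x|
  have ha0 : 0 ≤ a := (abs_nonneg _).trans (le_max_left _ _)
  have haM : a ≤ M := max_le_max (h1 x hx') (h2 x hx')
  have ha2 : a ^ 2 ≤ u e x ^ 2 + φ e x ^ 2 := by
    rcases max_choice |u e x| |φ e x| with h | h
    · rw [show a = |u e x| from h, sq_abs]
      linarith [sq_nonneg (φ e x)]
    · rw [show a = |φ e x| from h, sq_abs]
      linarith [sq_nonneg (u e x)]
  calc ‖u e x ^ m * φ e x ^ (6 - m)‖ = |u e x| ^ m * |φ e x| ^ (6 - m) := by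
        rw [norm_mul, norm_pow, norm_pow, Real.norm_eq_abs, Real.norm_eq_abs]
    _ ≤ a ^ m * a ^ (6 - m) := by
        gcongr
        · exact le_max_left _ _
        · exact le_max_right _ _
    _ = a ^ 4 * a ^ 2 := by rw [← pow_add, ← pow_add, Nat.add_sub_cancel' hm]
    _ ≤ M ^ 4 * (u e x ^ 2 + φ e x ^ 2) := by gcongr

theorem integral_add_sq {μ : Measure ℝ} {f g : ℝ → ℝ} (hf : MemLp f 2 μ) (hg : MemLp g 2 μ)
    (t : ℝ) : ∫ x, (f x + t * g x) ^ 2 ∂μ =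
      ∫ x, f x ^ 2 ∂μ + 2 * t * (∫ x, f x * g x ∂μ) + t ^ 2 * ∫ x, g x ^ 2 ∂μ := by
  have h1 : Integrable (fun x => 2 * t * (f x * g x)) μ := (hf.integrable_mul hg).const_mul _
  have h2 : Integrable (fun x => t ^ 2 * g x ^ 2) μ := hg.integrable_sq.const_mul _
  have h3 : Integrable (fun x => f x ^ 2 + 2 * t * (f x * g x)) μ := hf.integrable_sq.add h1
  rw [← integral_const_mul, ← integral_const_mul, ← integral_add hf.integrable_sq h1,
    ← integral_add h3 h2]
  refine integral_congr_ae (ae_of_all _ fun x => ?_)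
  simp only
  ring

theorem MemH1.edgeMass_add_smul (hu : G.MemH1 u) (hφ : G.MemH1 φ) (t : ℝ) (e : B ⊕ H) :
    G.edgeMass (u + t • φ) e = G.edgeMass u e +
      2 * t * (∫ x in G.openEdge e, u e x * φ e x) + t ^ 2 * G.edgeMass φ e :=
  integral_add_sq (hu.sobolevOn_openEdge e).memLp (hφ.sobolevOn_openEdge e).memLp t

theorem MemH1.edgeKinetic_add_smul (hu : G.MemH1 u) (hφ : G.MemH1 φ) (t : ℝ) (e : B ⊕ H) :
    G.edgeKinetic (u + t • φ) e = G.edgeKinetic u e +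
      2 * t * (∫ x in G.openEdge e, G.der u e x * G.der φ e x) + t ^ 2 * G.edgeKinetic φ e := by
  rw [edgeKinetic_eq_of_sobolevOn (u := u + t • φ)
    ((hu.sobolevOn e).add ((hφ.sobolevOn e).const_mul t))]
  exact integral_add_sq (hu.sobolevOn_openEdge e).memLp_deriv
    (hφ.sobolevOn_openEdge e).memLp_deriv t

theorem MemH1.outerMass_add_smul [Fintype H] (hu : G.MemH1 u) (hφ : G.MemH1 φ) (t : ℝ) :
    G.outerMass (u + t • φ) = G.outerMass u +
      2 * t * (∑ h, ∫ x in G.openEdge (Sum.inr h), u (Sum.inr h) x * φ (Sum.inr h) x) +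
      t ^ 2 * G.outerMass φ := by
  simp only [outerMass, hu.edgeMass_add_smul hφ, Finset.sum_add_distrib, Finset.mul_sum]

variable [Fintype B] [Fintype H]

theorem MemH1.mass_add_smul (hu : G.MemH1 u) (hφ : G.MemH1 φ) (t : ℝ) :
    G.mass (u + t • φ) = G.mass u + 2 * t * G.integral (fun e x => u e x * φ e x) +
      t ^ 2 * G.mass φ := by
  simp only [mass_eq, hu.edgeMass_add_smul hφ, Finset.sum_add_distrib, integral, Finset.mul_sum]

theorem MemH1.kinetic_add_smul (hu : G.MemH1 u) (hφ : G.MemH1 φ) (t : ℝ) :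
    G.kinetic (u + t • φ) = G.kinetic u +
      2 * t * G.integral (fun e x => G.der u e x * G.der φ e x) + t ^ 2 * G.kinetic φ := by
  simp only [kinetic_eq, hu.edgeKinetic_add_smul hφ, Finset.sum_add_distrib, integral,
    Finset.mul_sum]

theorem MemH1.exists_polynomial_sextic (hu : G.MemH1 u) (hφ : G.MemH1 φ) :
    ∃ P : Polynomial ℝ, ∀ t : ℝ, G.sextic (u + t • φ) = P.eval t := by
  choose P hP using hu.exists_polynomial_edgeSextic hφ
  refine ⟨∑ e, P e, fun t => ?_⟩
  rw [Polynomial.eval_finsetSum, sextic_eq]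
  exact Finset.sum_congr rfl fun e _ => hP e t

/-- A minimizer among the functions of the same mass with at most mass `c` on the half-lines is a
critical point of the energy, if its own mass on the half-lines is less than `c`. -/
theorem isCriticalPoint_of_minimizer {μ c : ℝ} (hμ : 0 < μ) (hu : G.MemH1 u)
    (hmass : G.mass u = μ) (hout : G.outerMass u < c)
    (hmin : ∀ v, G.MemH1 v → G.mass v = μ → G.outerMass v ≤ c → G.energy u ≤ G.energy v) :
    G.IsCriticalPoint μ u := by
  refine ⟨⟨hu, hmass⟩, fun φ hφ horth => ?_⟩
  obtain ⟨P, hP⟩ := hu.exists_polynomial_sextic hφ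
  set k := G.integral fun e x => G.der u e x * G.der φ e x
  have hm : ∀ t : ℝ, G.mass (u + t • φ) = μ + t ^ 2 * G.mass φ := fun t => by
    rw [hu.mass_add_smul hφ, horth, hmass, mul_zero, add_zero]
  have hm0 : ∀ t : ℝ, 0 < μ + t ^ 2 * G.mass φ := fun t => by
    have := G.mass_nonneg φ
    positivity
  have hv : ∀ t : ℝ, G.MemH1 (u + t • φ) := fun t => hu.add (hφ.const_smul t)
  -- the kinetic and the sextic term along the line, and the factor restoring the mass
  set K : ℝ → ℝ := fun t => 1 / 2 * (G.kinetic u + 2 * t * k + t ^ 2 * G.kinetic φ) with hK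
  set S : ℝ → ℝ := fun t => 1 / 6 * P.eval t with hS
  set s : ℝ → ℝ := fun t => μ / (μ + t ^ 2 * G.mass φ) with hs
  have hs0 : ∀ t, 0 ≤ s t := fun t => by have := hm0 t; positivity
  have hs1 : s 0 = 1 := by simp [hs, hμ.ne']
  have hKe : ∀ t, 1 / 2 * G.kinetic (u + t • φ) = K t := fun t => by rw [hu.kinetic_add_smul hφ]
  have hSe : ∀ t, 1 / 6 * G.sextic (u + t • φ) = S t := fun t => by rw [hP]
  have hKd : HasDerivAt K k 0 := by
    have h1 : HasDerivAt (fun t : ℝ => G.kinetic u + 2 * t * k + t ^ 2 * G.kinetic φ)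
        (0 + 2 * 1 * k + (2 : ℕ) * (0 : ℝ) ^ 1 * G.kinetic φ) 0 :=
      ((hasDerivAt_const _ _).add (((hasDerivAt_id (0 : ℝ)).const_mul 2).mul_const k)).add
        ((hasDerivAt_pow 2 (0 : ℝ)).mul_const _)
    exact (h1.const_mul (1 / 2)).congr_deriv (by ring)
  have hSd : HasDerivAt S (1 / 6 * P.derivative.eval 0) 0 := (P.hasDerivAt 0).const_mul _
  have hsd : HasDerivAt s 0 0 := by
    have h1 : HasDerivAt (fun t : ℝ => μ + t ^ 2 * G.mass φ)
        (0 + (2 : ℕ) * (0 : ℝ) ^ 1 * G.mass φ) 0 :=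
      (hasDerivAt_const _ _).add ((hasDerivAt_pow 2 (0 : ℝ)).mul_const _)
    exact ((hasDerivAt_const (0 : ℝ) μ).div h1 (hm0 0).ne').congr_deriv (by simp)
  have hE : (fun t : ℝ => G.energy (u + t • φ)) = fun t => K t - S t := by
    funext t
    rw [energy, hKe, hSe]
  have hF : ∀ t, G.energy (√(s t) • (u + t • φ)) = s t * K t - s t ^ 3 * S t := fun t => by
    rw [(hv t).energy_sqrt_smul (hs0 t), hKe, hSe]
  -- the renormalisation is of second order in `t`, as `φ` is orthogonal to `u`
  have hFd : HasDerivAt (fun t => s t * K t - s t ^ 3 * S t)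
      (k - 1 / 6 * P.derivative.eval 0) 0 :=
    ((hsd.mul hKd).sub ((hsd.pow 3).mul hSd)).congr_deriv (by simp [hs1])
  have hcont : Continuous s := by
    refine continuous_const.div (by fun_prop) fun t => (hm0 t).ne'
  -- the renormalised line is admissible near `t = 0`
  have hFmin : IsLocalMin (fun t => s t * K t - s t ^ 3 * S t) 0 := by
    have h1 : Tendsto (fun t => G.outerMass (√(s t) • (u + t • φ))) (𝓝 0) (𝓝 (G.outerMass u)) := by
      have h2 : ∀ t, G.outerMass (√(s t) • (u + t • φ)) = s t * (G.outerMass u +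
          2 * t * (∑ h, ∫ x in G.openEdge (Sum.inr h), u (Sum.inr h) x * φ (Sum.inr h) x) +
          t ^ 2 * G.outerMass φ) := fun t => by
        rw [outerMass_sqrt_smul _ _ (hs0 t), hu.outerMass_add_smul hφ]
      simp only [h2]
      refine Continuous.tendsto' (by fun_prop) _ _ ?_
      simp [hs1]
    filter_upwards [h1.eventually_lt_const hout] with t ht
    have h3 := hmin _ ((hv t).const_smul _) (by
      rw [mass_sqrt_smul _ _ (hs0 t), hm, div_mul_cancel₀ _ (hm0 t).ne']) ht.le
    have h4 := hF 0
    rw [hs1, Real.sqrt_one, one_smul, zero_smul, add_zero] at h4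
    rw [hF, h4] at h3
    simpa only [hs1] using h3
  rw [hE]
  exact (hKd.sub hSd).congr_deriv (hFmin.hasDerivAt_eq_zero hFd)

/-- A minimizer among the functions of the same mass with at most mass `c` on the half-lines is a
local minimizer of the energy, if its own mass on the half-lines is less than `c`. -/
theorem isLocalMinimizer_of_minimizer {μ c : ℝ} (hu : G.MemH1 u)
    (hmass : G.mass u = μ) (hout : G.outerMass u < c)
    (hmin : ∀ v, G.MemH1 v → G.mass v = μ → G.outerMass v ≤ c → G.energy u ≤ G.energy v) :
    G.IsLocalMinimizer μ u := by
  have ho := G.outerMass_nonneg u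
  set δ := c - G.outerMass u with hδ
  have hδ0 : 0 < δ := sub_pos.2 hout
  -- `√(outerMass v) ≤ √(outerMass u) + ‖v - u‖`, written without square roots
  set q := δ / (2 * c) with hq
  have hc : 0 < c := by linarith
  have hq0 : 0 < q := by positivity
  refine ⟨⟨hu, hmass⟩, √(δ / (2 * (1 + 1 / q))), by positivity, fun v hv hd => ?_⟩
  refine hmin v hv.1 hv.2 ?_
  have hw : G.MemH1 (v - u) := by
    have := hv.1.add (hu.const_smul (-1))
    rwa [neg_one_smul, ← sub_eq_add_neg] at this
  have h1 : G.outerMass (v - u) ≤ δ / (2 * (1 + 1 / q)) := by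
    have h2 := (Real.sqrt_lt_sqrt_iff (add_nonneg (G.mass_nonneg _) (G.kinetic_nonneg _))).1 hd
    have h3 := G.mass_eq_core_add_outer (v - u)
    have h4 := G.coreMass_nonneg (v - u)
    have h5 := G.kinetic_nonneg (v - u)
    linarith
  have h6 : G.outerMass v ≤ (1 + q) * G.outerMass u + (1 + 1 / q) * G.outerMass (v - u) := by
    simp only [outerMass, Finset.mul_sum, ← Finset.sum_add_distrib]
    refine Finset.sum_le_sum fun h _ => ?_
    have hiu := (hu.sobolevOn_openEdge (Sum.inr h)).integrableOn_sq
    have hiv := (hv.1.sobolevOn_openEdge (Sum.inr h)).integrableOn_sq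
    have hiw := (hw.sobolevOn_openEdge (Sum.inr h)).integrableOn_sq
    unfold edgeMass
    rw [← integral_const_mul, ← integral_const_mul,
      ← integral_add (hiu.const_mul _) (hiw.const_mul _)]
    refine integral_mono hiv ((hiu.const_mul _).add (hiw.const_mul _)) fun x => ?_
    simp only [Pi.sub_apply]
    set a := u (Sum.inr h) x
    set b := v (Sum.inr h) x
    have : (1 + q) * a ^ 2 + (1 + 1 / q) * (b - a) ^ 2 - b ^ 2 = (q * a - (b - a)) ^ 2 / q := by
      field_simp
      ring
    have h7 : 0 ≤ (q * a - (b - a)) ^ 2 / q := by positivity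
    linarith
  have h8 : (1 + 1 / q) * G.outerMass (v - u) ≤ δ / 2 := by
    calc (1 + 1 / q) * G.outerMass (v - u) ≤ (1 + 1 / q) * (δ / (2 * (1 + 1 / q))) := by gcongr
      _ = δ / 2 := by field_simp
  have h9 : q * G.outerMass u ≤ δ / 2 := by
    calc q * G.outerMass u ≤ q * c := by gcongr
      _ = δ / 2 := by rw [hq]; field_simp
  linarith

end MetricGraph

end

theorem theorem1 {V B H : Type*} [Finite V] [Fintype B] [Fintype H] [DecidableEq H]
    (G : MetricGraph V B H) (hconn : G.Connected)
    (hH : 2 ≤ Fintype.card H) (hB : Nonempty B)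
    (hcrit : ∀ l : H, (G.removeHalfLine l).criticalMass = G.criticalMass) :
    ∃ μbar : ℝ, 0 < μbar ∧ μbar < G.criticalMass ∧
      ∀ μ : ℝ, μbar < μ → μ < G.criticalMass →
        (∃ u, G.IsCriticalPoint μ u ∧ G.IsLocalMinimizer μ u) ∧
        ¬ ∃ u, G.IsGroundState μ u := by
  have hHne : Nonempty H := Fintype.card_pos_iff.1 (by omega)
  have hrem : G.RemovableHalfLines := fun l => by
    obtain ⟨h, hh⟩ := Fintype.exists_ne_of_one_lt_card hH l
    exact ⟨⟨⟨h, hh⟩⟩, hcrit l⟩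
  obtain ⟨μbar, h0, h1, h2⟩ := hrem.exists_minimizer hconn
  refine ⟨μbar, h0, h1, fun μ hμ hμ' =>
    ⟨?_, MetricGraph.not_exists_isGroundState hconn (h0.trans hμ) hμ'⟩⟩
  obtain ⟨c, u, hu, hmass, hout, hmin⟩ := h2 μ hμ hμ'
  exact ⟨u, MetricGraph.isCriticalPoint_of_minimizer (h0.trans hμ) hu hmass hout hmin,
    MetricGraph.isLocalMinimizer_of_minimizer hu hmass hout hmin⟩
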